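/- Let $(\mathfrak A,\varphi)$ be a C$^*$-non-commutative probability space (a unital C$^*$-algebra with a state, not assumed tracial or faithful), let $\mathbf X=(X_1,\dots,X_n)$ and $\mathbf Y=(Y_1,\dots,Y_m)$ be tuples of self-adjoint elements of $\mathfrak A$ ($n,m\ge 0$), regarded as left and right operators respectively, and let $B_\ell,B_r\subseteq\mathfrak A$ be unital self-adjoint subalgebras. **Cumulants.** Let $L_2(\mathfrak A,\varphi)$ be the GNS space with $\langle a,b\rangle=\varphi(b^*a)$, put $\varphi(Z\zeta)=\langle Z\zeta,1\rangle$ for $Z\in\mathfrak A$, $\zeta\in L_2(\mathfrak A,\varphi)$, and for a subalgebra $\mathcal A$ let $L_2(\mathcal A,\varphi)$ be the closure of $\mathcal A$ in it. For $\chi:\{1,\dots,N\}\to\{\ell,r\}$ let $BNC(\chi)$ be the set of partitions of $\{1,\dots,N\}$ that are non-crossing for the order which lists first the indices with $\chi=\ell$ increasingly and then those with $\chi=r$ decreasingly. The bi-free cumulants $\kappa_\chi(Z_1,\dots,Z_k,\zeta)$ with $Z_1,\dots,Z_k\in\mathfrak A$, $\zeta\in L_2(\mathfrak A,\varphi)$,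 $\chi(k+1)=\ell$, are those determined by the moment–cumulant formulae $\varphi(Z_1\cdots Z_k\zeta)=\sum_{\pi\in BNC(\chi)}\prod_{V\in\pi}\kappa_{\chi|_V}((Z_1,\dots,Z_k,\zeta)|_V)$, together with the same formulae for the restrictions of the sequence to subsets of the indices. **Conjugate variables.** For unital self-adjoint subalgebras $C_\ell,C_r$ and a self-adjoint $X$, the left bi-free conjugate variable $\mathcal J_\ell(X:(C_\ell,C_r))$ is the (unique, if it exists) $\xi\in L_2((C_\ell\vee C_r)\langle X\rangle,\varphi)$ with $\kappa(\xi)=0$, $\kappa_{\ell,\ell}(X,\xi)=1$, $\kappa_{\ell,\ell}(x,\xi)=0$ for $x\in C_\ell$, $\kappa_{r,\ell}(y,\xi)=0$ for $y\in C_r$, and $\kappa_\chi(Z_1,\dots,Z_k,\xi)=0$ for all $k\ge 2$ whenever $Z_p\in C_\ell\cup\{X\}$ if $\chi(p)=\ell$ and $Z_p\in C_r$ if $\chi(p)=r$. The right bi-free conjugate variable $\mathcal J_r(Y:(C_\ell,C_r))$ is defined in the same way, with $Y$ as a right entry: $\kappa_{r,\ell}(Y,\eta)=1$, and in the last condition $Z_p\in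 C_\ell$ if $\chi(p)=\ell$ and $Z_p\in C_r\cup\{Y\}$ if $\chi(p)=r$. **Fisher information.** With $\hat{\mathbf X}_i$, $\hat{\mathbf Y}_j$ the tuples with the $i$-th, resp. $j$-th, entry removed, $\xi_i=\mathcal J_\ell(X_i:(B_\ell\langle\hat{\mathbf X}_i\rangle,B_r\langle\mathbf Y\rangle))$ and $\eta_j=\mathcal J_r(Y_j:(B_\ell\langle\mathbf X\rangle,B_r\langle\hat{\mathbf Y}_j\rangle))$, put $$\Phi^*(\mathbf X\sqcup\mathbf Y:(B_\ell,B_r))=\sum_{i=1}^n\|\xi_i\|_2^2+\sum_{j=1}^m\|\eta_j\|_2^2$$ if all these conjugate variables exist, and $\infty$ otherwise. **Theorem (bi-free Cramér–Rao inequality).** With the convention $\infty\cdot 0=\infty$, $$\Phi^*(\mathbf X\sqcup\mathbf Y:(B_\ell,B_r))\;\varphi\Big(\sum_{i=1}^nX_i^2+\sum_{j=1}^mY_j^2\Big)\ \ge\ (n+m)^2 .$$ Equality holds if there is $v>0$ such that every $X_i$ and every $Y_j$ has the centred semicircular distribution of variance $v$ with respect to $\varphi$ and the family of pairs of faces $$\{(B_\ell,B_r)\}\cup\{(\mathbb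 C\langle X_i\rangle,\mathbb C)\}_{i=1}^n\cup\{(\mathbb C,\mathbb C\langle Y_j\rangle)\}_{j=1}^m$$ is bi-free with respect to $\varphi$ (in Voiculescu's sense: the faces act on vector spaces with specified state vectors so that their joint distribution is that of the left and right representations on the free product of these spaces, with respect to the vacuum). If $B_\ell=B_r=\mathbb C$, the converse holds as well: equality implies that such a $v>0$ exists and that this family is bi-free. -/

import Mathlib

open scoped ENNReal ComplexOrder

namespace BiFree

universe u

noncomputable section

/-- The two kinds of variables and faces. -/
inductive Side : Type
  | left : Side
  | right : Side

/-! ### Bi-non-crossing partitions and bi-free cumulants -/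

/-- The position of the node `p` in the order attached to `χ`: first the left nodes from top to
bottom, then the right nodes from bottom to top. -/
def nodeRank {N : ℕ} (χ : Fin N → Side) (p : Fin N) : ℤ :=
  match χ p with
  | Side.left => (p : ℤ)
  | Side.right => 2 * (N : ℤ) - (p : ℤ)

/-- A partition of a set `V` of nodes is bi-non-crossing with respect to `χ` if it is non-crossing
for the order attached to `χ`. -/
def IsBNC {N : ℕ} (χ : Fin N → Side) {V : Finset (Fin N)} (π : Finpartition V) : Prop :=
  ∀ U ∈ π.parts, ∀ W ∈ π.parts, U ≠ W → ∀ a ∈ U, ∀ b ∈ W, ∀ c ∈ U, ∀ d ∈ W,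
    ¬ (nodeRank χ a < nodeRank χ b ∧ nodeRank χ b < nodeRank χ c ∧ nodeRank χ c < nodeRank χ d)

open Classical in
/-- The bi-free cumulants attached to the moments `m V` (`V` a set of nodes). They are determined
by the moment-cumulant formulae `m V = ∑ π ∈ BNC(χ|V), ∏ W ∈ π, cumulant χ m W`
(equivalently, by Möbius inversion on the lattice of bi-non-crossing partitions), solved here for
the term of the partition with the single block `V`. -/
def cumulant {N : ℕ} (χ : Fin N → Side) (m : Finset (Fin N) → ℂ) (V : Finset (Fin N)) : ℂ :=
  m V - ∑ π : {π : Finpartition V // IsBNC χ π ∧ V ∉ π.parts},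
    ∏ W : {W : Finset (Fin N) // W ∈ π.1.parts}, cumulant χ m W.1
termination_by V.card
decreasing_by
  have hV : W.1 ≠ V := by
    intro h
    have hW : W.1 ∈ π.1.parts := W.2
    rw [h] at hW
    exact π.2.2 hW
  exact Finset.card_lt_card ((π.1.le W.2).lt_of_ne hV)

/-- The product, in increasing order of the indices, of the `Z p` with `p ∈ V`. -/
def orderedProd {A : Type u} [Monoid A] {k : ℕ} (Z : Fin k → A) (V : Finset (Fin k)) : A :=
  ((V.sort (· ≤ ·)).map Z).prod

section Space

variable {A : Type u} [CStarAlgebra A] [PartialOrder A] [StarOrderedRing A]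

/-- The element of the GNS space of `φ` given by an element of the algebra. -/
def toL2 (φ : A →ₚ[ℂ] ℂ) (a : A) : φ.GNS := ((φ.toPreGNS a : φ.PreGNS) : φ.GNS)

/-- `L₂(B, φ)` for a subalgebra `B`, as a closed subset of the GNS space of `φ`. -/
def L2 (φ : A →ₚ[ℂ] ℂ) (B : StarSubalgebra ℂ A) : Set φ.GNS := closure (toL2 φ '' (B : Set A))

/-- `φ(a ζ) = ⟨a ζ, 1⟩` for `a` in the algebra and `ζ` in the GNS space. (Mathlib's inner product is
linear in the second variable.) -/
def vectorMoment (φ : A →ₚ[ℂ] ℂ) (a : A) (ζ : φ.GNS) : ℂ :=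
  inner ℂ (toL2 φ 1) (φ.gnsStarAlgHom a ζ)

open Classical in
/-- The moment of the entries of `(Z₁, …, Z_k, ζ)` with index in `V`, where the last entry `ζ` is a
vector of the GNS space. -/
def entryMoment (φ : A →ₚ[ℂ] ℂ) {k : ℕ} (Z : Fin k → A) (ζ : φ.GNS) (V : Finset (Fin (k + 1))) :
    ℂ :=
  let a := orderedProd Z (Finset.univ.filter fun p : Fin k => p.castSucc ∈ V)
  if Fin.last k ∈ V then vectorMoment φ a ζ else φ a

/-- The bi-free cumulant `κ_χ(Z₁, …, Z_k, ζ)`, the last entry being treated as a left one. -/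
def biFreeCumulant (φ : A →ₚ[ℂ] ℂ) {k : ℕ} (χ : Fin k → Side) (Z : Fin k → A) (ζ : φ.GNS) : ℂ :=
  cumulant (Fin.snoc χ Side.left : Fin (k + 1) → Side) (entryMoment φ Z ζ) Finset.univ

/-- The pair of algebras `(Bl, Br)` as a function of the side. -/
def facePair (Bl Br : StarSubalgebra ℂ A) : Side → StarSubalgebra ℂ A
  | Side.left => Bl
  | Side.right => Br

/-- `B⟨S⟩`: the unital `*`-subalgebra generated by `B` and the set `S`. -/
def extend (B : StarSubalgebra ℂ A) (S : Set A) : StarSubalgebra ℂ A :=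
  B ⊔ StarAlgebra.adjoin ℂ S

/-- `ξ` is the left (`s = left`) or right (`s = right`) bi-free conjugate variable of the
self-adjoint operator `X` with respect to the pair `B = (B_ℓ, B_r)`: it lies in
`L₂((B_ℓ ∨ B_r)⟨X⟩, φ)`, `κ(ξ) = 0`, `κ(X, ξ) = 1`, `κ(b, ξ) = 0` for `b` in `B_ℓ` or `B_r`, and all
the higher cumulants that end in `ξ` and whose other entries are elements of `B_ℓ` (as left
entries), elements of `B_r` (as right entries) or `X` (as an entry of side `s`) vanish. -/
def IsConjugateVariable (φ : A →ₚ[ℂ] ℂ) (s : Side) (X : A) (B : Side → StarSubalgebra ℂ A)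
    (ξ : φ.GNS) : Prop :=
  ξ ∈ L2 φ (extend (B Side.left ⊔ B Side.right) {X}) ∧
  biFreeCumulant φ ![] ![] ξ = 0 ∧
  biFreeCumulant φ ![s] ![X] ξ = 1 ∧
  (∀ t : Side, ∀ b ∈ B t, biFreeCumulant φ ![t] ![b] ξ = 0) ∧
  ∀ k : ℕ, 2 ≤ k → ∀ (χ : Fin k → Side) (Z : Fin k → A),
    (∀ p, Z p ∈ B (χ p) ∨ (χ p = s ∧ Z p = X)) → biFreeCumulant φ χ Z ξ = 0

/-- The pair `(B_ℓ⟨X_k : k ≠ i⟩, B_r⟨Y⟩)`. -/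
def leftContext {n m : ℕ} (X : Fin n → A) (Y : Fin m → A) (Bl Br : StarSubalgebra ℂ A)
    (i : Fin n) : Side → StarSubalgebra ℂ A :=
  facePair (extend Bl (X '' {k | k ≠ i})) (extend Br (Set.range Y))

/-- The pair `(B_ℓ⟨X⟩, B_r⟨Y_k : k ≠ j⟩)`. -/
def rightContext {n m : ℕ} (X : Fin n → A) (Y : Fin m → A) (Bl Br : StarSubalgebra ℂ A)
    (j : Fin m) : Side → StarSubalgebra ℂ A :=
  facePair (extend Bl (Set.range X)) (extend Br (Y '' {k | k ≠ j}))

open Classical in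
/-- The relative bi-free Fisher information `Φ*(X ⊔ Y : (B_ℓ, B_r))`: the sum of the squared norms
of the bi-free conjugate variables if all of them exist, and `∞` otherwise. (A conjugate variable
is unique when it exists.) -/
def fisherInformation (φ : A →ₚ[ℂ] ℂ) {n m : ℕ} (X : Fin n → A) (Y : Fin m → A)
    (Bl Br : StarSubalgebra ℂ A) : ℝ≥0∞ :=
  if h : (∀ i, ∃ ξ, IsConjugateVariable φ Side.left (X i) (leftContext X Y Bl Br i) ξ) ∧
      (∀ j, ∃ η, IsConjugateVariable φ Side.right (Y j) (rightContext X Y Bl Br j) η) then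
    ∑ i, ENNReal.ofReal (‖(h.1 i).choose‖ ^ 2) + ∑ j, ENNReal.ofReal (‖(h.2 j).choose‖ ^ 2)
  else ⊤

open Classical in
/-- The product of extended non-negative numbers with the convention `∞ · 0 = ∞` when the first
factor is `∞`. -/
def topMul (a b : ℝ≥0∞) : ℝ≥0∞ := if a = ⊤ then ⊤ else a * b

/-- The quantity `Φ*(X ⊔ Y : (B_ℓ, B_r)) · φ(∑ X_i² + ∑ Y_j²)`. -/
def cramerRaoProduct (φ : A →ₚ[ℂ] ℂ) {n m : ℕ} (X : Fin n → A) (Y : Fin m → A)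
    (Bl Br : StarSubalgebra ℂ A) : ℝ≥0∞ :=
  topMul (fisherInformation φ X Y Bl Br)
    (ENNReal.ofReal (φ (∑ i, X i ^ 2 + ∑ j, Y j ^ 2)).re)

/-- The distribution of `a` with respect to `φ` is the centred semicircular distribution of
variance `v`, which has density `√(4 v - t²) / (2 π v)` on `[-2 √v, 2 √v]`. -/
def IsSemicircular (φ : A →ₚ[ℂ] ℂ) (v : ℝ) (a : A) : Prop :=
  ∀ k : ℕ, φ (a ^ k) =
    ((∫ t in (-(2 * √v))..(2 * √v), t ^ k * (√(4 * v - t ^ 2) / (2 * Real.pi * v)) : ℝ) : ℂ)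

end Space

/-! ### Free products of vector spaces with specified state vector, and bi-freeness

Up to isomorphism (choose a basis of the distinguished complement), a vector space with a specified
state vector and a specified complement of it is the space `Pointed S` with basis `Option S`, the
state vector being the basis vector `none` and the complement being spanned by the other basis
vectors. The free product of the spaces `Pointed (S k)` then has as a basis the reduced words
in letters `s ∈ S k`, the state vector being the empty word. -/

section FreeProduct

variable {ι : Type*}

/-- The vector space with basis `Option S` and state vector `none`. -/
abbrev Pointed (S : Type u) : Type u := Option S →₀ ℂ

/-- Reduced words: neighbouring letters come from different index sets. -/
abbrev Word (S : ι → Type u) : Type _ :=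
  {w : List (Σ k, S k) // w.IsChain fun a b => a.1 ≠ b.1}

/-- The empty word. -/
def Word.empty (S : ι → Type u) : Word S := ⟨[], List.isChain_nil⟩

/-- The word read backwards. -/
def Word.reverse {S : ι → Type u} (w : Word S) : Word S :=
  ⟨w.1.reverse, by
    rw [List.isChain_reverse]
    exact w.2.imp fun _ _ h => h.symm⟩

/-- The reduced words that do not start with a letter of index `k`. -/
abbrev Tail (S : ι → Type u) (k : ι) : Type _ :=
  {w : Word S // ∀ a ∈ w.1.head?, a.1 ≠ k}

/-- The word `o · t`, where `none` stands for the empty word. -/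
def glue {S : ι → Type u} (k : ι) (t : Tail S k) : Option (S k) → Word S
  | none => t.1
  | some s => ⟨⟨k, s⟩ :: t.1.1, List.isChain_cons.2 ⟨fun a ha => (t.2 a ha).symm, t.1.2⟩⟩

open Classical in
/-- The decomposition `w = o · t` of a word, where `t` does not start with a letter of index `k`. -/
def split {S : ι → Type u} (k : ι) : Word S → Option (S k) × Tail S k
  | ⟨[], h⟩ => (none, ⟨⟨[], h⟩, by simp⟩)
  | ⟨⟨j, s⟩ :: w, h⟩ =>
    if hj : j = k then
      (some (hj ▸ s), ⟨⟨w, (List.isChain_cons.1 h).2⟩,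
        fun a ha e => (List.isChain_cons.1 h).1 a ha (hj.trans e.symm)⟩)
    else (none, ⟨⟨⟨j, s⟩ :: w, h⟩, by simpa using hj⟩)

/-- The free product of the spaces `Pointed (S k)`. -/
abbrev FreeProd (S : ι → Type u) := Word S →₀ ℂ

/-- The left representation of the linear maps of `Pointed (S k)` on the free product: `T` acts on
the first tensor factor of `Pointed (S k) ⊗ span (Tail S k) ≃ FreeProd S`. -/
def leftRep {S : ι → Type u} (k : ι) (T : Module.End ℂ (Pointed (S k))) :
    Module.End ℂ (FreeProd S) :=
  Finsupp.linearCombination ℂ fun w : Word S =>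
    Finsupp.mapDomain (glue k (split k w).2) (T (Finsupp.single (split k w).1 1))

/-- The reversal of words on the free product. -/
def flip (S : ι → Type u) : Module.End ℂ (FreeProd S) := Finsupp.lmapDomain ℂ ℂ Word.reverse

/-- The right representation: `T` acts on the last tensor factor. -/
def rightRep {S : ι → Type u} (k : ι) (T : Module.End ℂ (Pointed (S k))) :
    Module.End ℂ (FreeProd S) :=
  flip S * leftRep k T * flip S

/-- A letter is an element of a left or of a right face; its value is the underlying element. -/
def letterVal {A : Type u} [CStarAlgebra A] {L R : ι → StarSubalgebra ℂ A} :
    (Σ k, L k ⊕ R k) → A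
  | ⟨_, Sum.inl a⟩ => (a : A)
  | ⟨_, Sum.inr b⟩ => (b : A)

/-- The operator of a letter on the free product: left faces act on the left, right faces on the
right. -/
def letterRep {A : Type u} [CStarAlgebra A] {L R : ι → StarSubalgebra ℂ A} {S : ι → Type u}
    (l : ∀ k, L k →ₐ[ℂ] Module.End ℂ (Pointed (S k)))
    (r : ∀ k, R k →ₐ[ℂ] Module.End ℂ (Pointed (S k))) :
    (Σ k, L k ⊕ R k) → Module.End ℂ (FreeProd S)
  | ⟨k, Sum.inl a⟩ => leftRep k (l k a)
  | ⟨k, Sum.inr b⟩ => rightRep k (r k b)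

/-- Bi-freeness of a family of pairs of faces `(L k, R k)` with respect to `φ`: there are vector
spaces with specified state vectors on which `L k` and `R k` act, such that the joint distribution
of all faces is that of the left representations of the `L k` and the right representations of the
`R k` on the free product, with respect to the vacuum. -/
def IsBiFree {A : Type u} [CStarAlgebra A] [PartialOrder A] (φ : A →ₚ[ℂ] ℂ)
    (L R : ι → StarSubalgebra ℂ A) : Prop :=
  ∃ (S : ι → Type u)
    (l : ∀ k, L k →ₐ[ℂ] Module.End ℂ (Pointed (S k)))
    (r : ∀ k, R k →ₐ[ℂ] Module.End ℂ (Pointed (S k))),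
    ∀ w : List (Σ k, L k ⊕ R k),
      φ (w.map letterVal).prod =
        (w.map (letterRep l r)).prod (Finsupp.single (Word.empty S) 1) (Word.empty S)

end FreeProduct

/-- Left faces of the family `{(B_ℓ, B_r)} ∪ {(X_i, 1)} ∪ {(1, Y_j)}`. -/
def leftFaces {A : Type u} [CStarAlgebra A] {n m : ℕ} (X : Fin n → A)
    (Bl : StarSubalgebra ℂ A) : Unit ⊕ Fin n ⊕ Fin m → StarSubalgebra ℂ A
  | Sum.inl _ => Bl
  | Sum.inr (Sum.inl i) => StarAlgebra.adjoin ℂ {X i}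
  | Sum.inr (Sum.inr _) => ⊥

/-- Right faces of the family `{(B_ℓ, B_r)} ∪ {(X_i, 1)} ∪ {(1, Y_j)}`. -/
def rightFaces {A : Type u} [CStarAlgebra A] {n m : ℕ} (Y : Fin m → A)
    (Br : StarSubalgebra ℂ A) : Unit ⊕ Fin n ⊕ Fin m → StarSubalgebra ℂ A
  | Sum.inl _ => Br
  | Sum.inr (Sum.inl _) => ⊥
  | Sum.inr (Sum.inr j) => StarAlgebra.adjoin ℂ {Y j}

/-- `X` and `Y` are centred semicircular operators of the same (positive) variance, and the family
`{(B_ℓ, B_r)} ∪ {(X_i, 1)} ∪ {(1, Y_j)}` is bi-free. -/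
def IsBiFreeSemicircularSystem {A : Type u} [CStarAlgebra A] [PartialOrder A] (φ : A →ₚ[ℂ] ℂ)
    {n m : ℕ} (X : Fin n → A) (Y : Fin m → A) (Bl Br : StarSubalgebra ℂ A) : Prop :=
  (∃ v : ℝ, 0 < v ∧ (∀ i, IsSemicircular φ v (X i)) ∧ ∀ j, IsSemicircular φ v (Y j)) ∧
  IsBiFree φ (leftFaces (m := m) X Bl) (rightFaces (n := n) Y Br)

end

end BiFree

/-!
For a left or right variable `x` (one of the `X i` or `Y j`), a word is a product of copies of `x`
(the pivot) and of elements of the two algebras with respect to which the conjugate variable of `x`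
is formed. The bi-free difference quotient `∂` of a word (`diff`) has one term for each copy of `x`:
the letters after it on its own side are split off into one tensor factor, and the other letters
remain in the second one. A vector `ξ` has the cumulants of a conjugate variable if and only if
`φ(w ξ) = (φ ⊗ φ)(∂ w)` for all words `w` (`IsConjugateVariable.conjugateRelation`,
`ConjugateRelation.isConjugateVariable`). Indeed, if `ξ` only has pair cumulants, with the pivots,
then in the moment-cumulant formula the block of the last node `ξ` is a pair `{p, ξ}`. The other
blocks lie inside or outside of the interval between `p` and `ξ` in the order of the nodes, the
inside consists of the later nodes on the side of `p`, and the two partial sums are the moments of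
the two parts (`cumulant_eq_pairCumulant_add`).

*Inequality.* For the word `w = x` the relation reads `⟨x, ξ⟩ = 1`, and the Cauchy-Schwarz
inequality for the families of the variables and of their conjugate variables gives the bound
(`card_sq_le_of_inner_eq_one`). Equality holds if and only if all conjugate variables are the
variables divided by one number `v > 0` (`exists_eq_smul_of_card_sq_eq`), that is, if and only if
`φ(w x) = v (φ ⊗ φ)(∂ w)` for all words `w` and all variables `x`.

*Bi-free semicircular systems satisfy this relation* (`apply_wordVal_mul_of_isBiFree`). It suffices
to prove it in the vacuum state of a free product. Let a left variable `x` act on its factor, and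
let `f n` be the vectors obtained from the state vector by the orthogonal polynomials of the
semicircular distribution, so that `x f (n + 1) = f (n + 2) + v f n`, where `f (n + 1)` has no
vacuum component because `x` is semicircular (`isSemicircular_iff`). On the vacuum `x` agrees with
the right creation operator `u · f n ↦ u · f (n + 1)`, which is then moved to the front of the word.
It commutes with the left operators of the other indices, its commutator with `x` is, up to the
sign, `v` times the projection to the vacuum, which produces the terms of `v ∂ w`, and its values
are annihilated by the vacuum functional even after the action of the right operators of the other
indices (`exists_creationRel`). Right variables are treated by reversing all words of the free
product.

*Converse for scalar algebras.* The relation for the powers of one variable shows that its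
distribution is semicircular (`apply_orthoSeq_eq_zero`). Let all faces act on the algebra itself by
left multiplication, with the unit as state vector and the kernel of `φ` as complement. Then the
relation holds in the free product of copies of this space by the preceding paragraph, and it
holds for `φ` by assumption. As it expresses each moment of the variables by moments of lower
degree, the two families have the same moments (`apply_prod_eq_vac`), which is bi-freeness.
-/

namespace BiFree

universe u

noncomputable section

/-! ### Cumulants of families with only pair cumulants at the last node -/

/-- A bi-non-crossing partition of `V`, given by its set of blocks. -/
structure IsBNCBlocks {N : ℕ} (χ : Fin N → Side) (V : Finset (Fin N))
    (P : Finset (Finset (Fin N))) : Prop where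
  nonempty : ∀ W ∈ P, W.Nonempty
  subset : ∀ W ∈ P, W ⊆ V
  cover : ∀ a ∈ V, ∃ W ∈ P, a ∈ W
  disj : ∀ W ∈ P, ∀ W' ∈ P, ∀ a ∈ W, a ∈ W' → W = W'
  nc : ∀ U ∈ P, ∀ W ∈ P, U ≠ W → ∀ a ∈ U, ∀ b ∈ W, ∀ c ∈ U, ∀ d ∈ W,
    ¬ (nodeRank χ a < nodeRank χ b ∧ nodeRank χ b < nodeRank χ c ∧ nodeRank χ c < nodeRank χ d)

open Classical in
/-- The bi-non-crossing partitions of `V`, each given by its set of blocks. -/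
def bncBlocks {N : ℕ} (χ : Fin N → Side) (V : Finset (Fin N)) :
    Finset (Finset (Finset (Fin N))) :=
  Finset.univ.filter (IsBNCBlocks χ V)

theorem mem_bncBlocks {N : ℕ} {χ : Fin N → Side} {V : Finset (Fin N)}
    {P : Finset (Finset (Fin N))} : P ∈ bncBlocks χ V ↔ IsBNCBlocks χ V P := by
  classical
  simp [bncBlocks]

theorem isBNCBlocks_parts {N : ℕ} {χ : Fin N → Side} {V : Finset (Fin N)}
    {π : Finpartition V} (h : IsBNC χ π) : IsBNCBlocks χ V π.parts where
  nonempty _ hW := π.nonempty_of_mem_parts hW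
  subset _ hW := π.le hW
  cover _ ha := π.exists_mem ha
  disj _ hW _ hW' _ ha ha' := π.eq_of_mem_parts hW hW' ha ha'
  nc := h

theorem IsBNCBlocks.exists_parts_eq {N : ℕ} {χ : Fin N → Side} {V : Finset (Fin N)}
    {P : Finset (Finset (Fin N))} (h : IsBNCBlocks χ V P) :
    ∃ π : Finpartition V, IsBNC χ π ∧ π.parts = P := by
  classical
  refine ⟨Finpartition.ofExistsUnique P h.subset (fun a ha => ?_) (fun h0 => ?_), ?_, rfl⟩
  · obtain ⟨W, hW, haW⟩ := h.cover a ha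
    exact ⟨W, ⟨hW, haW⟩, fun W' hW' => h.disj _ hW'.1 _ hW _ hW'.2 haW⟩
  · simpa using h.nonempty _ h0
  · exact h.nc

open Classical in
/-- The recursion for the cumulants, with partitions as sets of blocks. -/
theorem cumulant_eq_sub_sum {N : ℕ} (χ : Fin N → Side) (m : Finset (Fin N) → ℂ)
    (V : Finset (Fin N)) :
    cumulant χ m V =
      m V - ∑ P ∈ (bncBlocks χ V).filter (V ∉ ·), ∏ W ∈ P, cumulant χ m W := by
  rw [cumulant]
  congr 1
  refine Finset.sum_bij (fun π _ => π.1.parts) ?_ ?_ ?_ ?_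
  · intro π _
    exact Finset.mem_filter.2 ⟨mem_bncBlocks.2 (isBNCBlocks_parts π.2.1), π.2.2⟩
  · intro π _ π' _ h
    exact Subtype.ext (Finpartition.ext h)
  · intro P hP
    obtain ⟨hP, hV⟩ := Finset.mem_filter.1 hP
    obtain ⟨π, hπ, rfl⟩ := (mem_bncBlocks.1 hP).exists_parts_eq
    exact ⟨⟨π, hπ, hV⟩, Finset.mem_univ _, rfl⟩
  · intro π _
    exact Finset.prod_coe_sort π.1.parts (cumulant χ m)

theorem IsBNCBlocks.eq_singleton {N : ℕ} {χ : Fin N → Side} {V : Finset (Fin N)}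
    {P : Finset (Finset (Fin N))} (h : IsBNCBlocks χ V P) (hV : V ∈ P) : P = {V} := by
  ext W
  refine ⟨fun hW => ?_, fun hW => by rwa [Finset.mem_singleton.1 hW]⟩
  obtain ⟨a, ha⟩ := h.nonempty _ hW
  exact Finset.mem_singleton.2 (h.disj _ hW _ hV a ha (h.subset _ hW ha))

theorem isBNCBlocks_singleton {N : ℕ} {χ : Fin N → Side} {V : Finset (Fin N)}
    (hV : V.Nonempty) : IsBNCBlocks χ V {V} := by
  constructor <;> simp +contextual [hV]

/-- The moment-cumulant formula. -/
theorem sum_bncBlocks_cumulant {N : ℕ} (χ : Fin N → Side) (m : Finset (Fin N) → ℂ)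
    (hm : m ∅ = 1) (V : Finset (Fin N)) :
    ∑ P ∈ bncBlocks χ V, ∏ W ∈ P, cumulant χ m W = m V := by
  classical
  rcases V.eq_empty_or_nonempty with rfl | hV
  · have : bncBlocks χ (∅ : Finset (Fin N)) = {∅} := by
      ext P
      rw [mem_bncBlocks, Finset.mem_singleton]
      constructor
      · intro h
        refine Finset.eq_empty_of_forall_notMem fun W hW => ?_
        obtain ⟨a, ha⟩ := h.nonempty _ hW
        simpa using h.subset _ hW ha
      · rintro rfl
        constructor <;> simp
    simp [this, hm]
  · rw [← Finset.sum_filter_add_sum_filter_not _ (V ∉ ·)]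
    have : (bncBlocks χ V).filter (¬ V ∉ ·) = {{V}} := by
      ext P
      rw [Finset.mem_filter, mem_bncBlocks, Finset.mem_singleton, not_not]
      constructor
      · exact fun h => h.1.eq_singleton h.2
      · rintro rfl
        exact ⟨isBNCBlocks_singleton hV, by simp⟩
    rw [this, Finset.sum_singleton, Finset.prod_singleton, cumulant_eq_sub_sum χ m V]
    ring

/-- `q` lies strictly between `p` and `l` in the order attached to `χ`. -/
def Between {N : ℕ} (χ : Fin N → Side) (p l q : Fin N) : Prop :=
  (nodeRank χ p < nodeRank χ q ∧ nodeRank χ q < nodeRank χ l) ∨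
    (nodeRank χ l < nodeRank χ q ∧ nodeRank χ q < nodeRank χ p)

theorem nodeRank_injective {N : ℕ} (χ : Fin N → Side) : Function.Injective (nodeRank χ) := by
  intro a b h
  have ha := a.2
  have hb := b.2
  unfold nodeRank at h
  apply Fin.ext
  split at h <;> split at h <;> omega

section Split

variable {N : ℕ} {χ : Fin N → Side} {U I O : Finset (Fin N)} {p l : Fin N}

open Classical in
/-- In a bi-non-crossing partition with a block `{p, l}`, all other blocks lie inside or outside of
the interval between `p` and `l`. -/
theorem IsBNCBlocks.subset_or_subset (hU : U = {p, l} ∪ I ∪ O)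
    (hI : ∀ q ∈ I, Between χ p l q) (hO : ∀ q ∈ O, ¬ Between χ p l q ∧ q ≠ p ∧ q ≠ l)
    {P : Finset (Finset (Fin N))} (h : IsBNCBlocks χ U P) (hpl : {p, l} ∈ P)
    {W : Finset (Fin N)} (hW : W ∈ P) : W = {p, l} ∨ W ⊆ I ∨ W ⊆ O := by
  by_contra! hcon
  obtain ⟨h1, h2, h3⟩ := hcon
  have hmem : ∀ a ∈ W, a ∈ I ∨ a ∈ O := by
    intro a ha
    have := h.subset _ hW ha
    rw [hU] at this
    simp only [Finset.mem_union] at this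
    rcases this with (h' | h') | h'
    · exact absurd (h.disj _ hW _ hpl a ha h') h1
    · exact Or.inl h'
    · exact Or.inr h'
  obtain ⟨b, hb, hbI⟩ := Finset.not_subset.1 h2
  obtain ⟨a, ha, haO⟩ := Finset.not_subset.1 h3
  have haI := hI _ ((hmem a ha).resolve_right haO)
  obtain ⟨hbO, hbp, hbl⟩ := hO _ ((hmem b hb).resolve_left hbI)
  have e1 : nodeRank χ b ≠ nodeRank χ p := fun e => hbp (nodeRank_injective χ e)
  have e2 : nodeRank χ b ≠ nodeRank χ l := fun e => hbl (nodeRank_injective χ e)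
  have hp : p ∈ ({p, l} : Finset (Fin N)) := by simp
  have hl : l ∈ ({p, l} : Finset (Fin N)) := by simp
  have c1 := h.nc _ hW _ hpl h1 b hb p hp a ha l hl
  have c2 := h.nc _ hW _ hpl h1 b hb l hl a ha p hp
  have c3 := h.nc _ hpl _ hW h1.symm p hp a ha l hl b hb
  have c4 := h.nc _ hpl _ hW h1.symm l hl a ha p hp b hb
  unfold Between at haI hbO
  omega

theorem IsBNCBlocks.filter_subset {P : Finset (Finset (Fin N))} (h : IsBNCBlocks χ U P)
    [DecidablePred (· ⊆ I)] (hIU : I ⊆ U) (hc : ∀ W ∈ P, ∀ a ∈ W, a ∈ I → W ⊆ I) :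
    IsBNCBlocks χ I (P.filter (· ⊆ I)) where
  nonempty W hW := h.nonempty W (Finset.mem_filter.1 hW).1
  subset W hW := (Finset.mem_filter.1 hW).2
  cover a ha := by
    obtain ⟨W, hW, haW⟩ := h.cover a (hIU ha)
    exact ⟨W, Finset.mem_filter.2 ⟨hW, hc W hW a haW ha⟩, haW⟩
  disj W hW W' hW' := h.disj W (Finset.mem_filter.1 hW).1 W' (Finset.mem_filter.1 hW').1
  nc W hW W' hW' := h.nc W (Finset.mem_filter.1 hW).1 W' (Finset.mem_filter.1 hW').1

open Classical in
/-- Bi-non-crossing partitions of the inside and of the outside of the interval between `p` and `l`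
are put together, with the block `{p, l}`, to a bi-non-crossing partition. -/
theorem IsBNCBlocks.insert_union (hU : U = {p, l} ∪ I ∪ O)
    (hI : ∀ q ∈ I, Between χ p l q) (hO : ∀ q ∈ O, ¬ Between χ p l q ∧ q ≠ p ∧ q ≠ l)
    {S T : Finset (Finset (Fin N))} (hS : IsBNCBlocks χ I S) (hT : IsBNCBlocks χ O T) :
    IsBNCBlocks χ U (insert {p, l} (S ∪ T)) := by
  have hdisj : ∀ q ∈ I, q ∉ O := fun q hq hq' => (hO q hq').1 (hI q hq)
  have hpI : ∀ q ∈ I, q ≠ p ∧ q ≠ l := by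
    intro q hq
    have := hI q hq
    constructor <;> rintro rfl <;> unfold Between at this <;> omega
  have hSI := fun W hW a ha => hI a (hS.subset W hW ha)
  have hTO := fun W hW a ha => hO a (hT.subset W hW ha)
  constructor
  · intro W hW
    simp only [Finset.mem_insert, Finset.mem_union] at hW
    rcases hW with rfl | hW | hW
    · simp
    · exact hS.nonempty W hW
    · exact hT.nonempty W hW
  · intro W hW
    simp only [Finset.mem_insert, Finset.mem_union] at hW
    rw [hU]
    rcases hW with rfl | hW | hW
    · exact Finset.subset_union_left.trans Finset.subset_union_left
    · exact (hS.subset W hW).trans (Finset.subset_union_right.trans Finset.subset_union_left)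
    · exact (hT.subset W hW).trans Finset.subset_union_right
  · intro a ha
    rw [hU] at ha
    simp only [Finset.mem_union] at ha
    rcases ha with (ha | ha) | ha
    · exact ⟨_, Finset.mem_insert_self _ _, ha⟩
    · obtain ⟨W, hW, haW⟩ := hS.cover a ha
      exact ⟨W, by simp [hW], haW⟩
    · obtain ⟨W, hW, haW⟩ := hT.cover a ha
      exact ⟨W, by simp [hW], haW⟩
  · intro W hW W' hW' a ha ha'
    simp only [Finset.mem_insert, Finset.mem_union] at hW hW'
    rcases hW with rfl | hW | hW <;> rcases hW' with rfl | hW' | hW'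
    · rfl
    · have := hpI a (hS.subset _ hW' ha')
      simp_all
    · have := hO a (hT.subset _ hW' ha')
      simp_all
    · have := hpI a (hS.subset _ hW ha)
      simp_all
    · exact hS.disj _ hW _ hW' a ha ha'
    · exact absurd (hT.subset _ hW' ha') (hdisj a (hS.subset _ hW ha))
    · have := hO a (hT.subset _ hW ha)
      simp_all
    · exact absurd (hT.subset _ hW ha) (hdisj a (hS.subset _ hW' ha'))
    · exact hT.disj _ hW _ hW' a ha ha'
  · intro W hW W' hW' hne a ha b hb c hc d hd
    simp only [Finset.mem_insert, Finset.mem_union] at hW hW'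
    rcases hW with rfl | hW | hW <;> rcases hW' with rfl | hW' | hW'
    · exact absurd rfl hne
    · have h1 := hSI _ hW' b hb
      have h2 := hSI _ hW' d hd
      simp only [Finset.mem_insert, Finset.mem_singleton] at ha hc
      unfold Between at h1 h2
      rcases ha with rfl | rfl <;> rcases hc with rfl | rfl <;> omega
    · have h1 := (hTO _ hW' b hb).1
      have h2 := (hTO _ hW' d hd).1
      simp only [Finset.mem_insert, Finset.mem_singleton] at ha hc
      unfold Between at h1 h2
      rcases ha with rfl | rfl <;> rcases hc with rfl | rfl <;> omega
    · have h1 := hSI _ hW a ha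
      have h2 := hSI _ hW c hc
      simp only [Finset.mem_insert, Finset.mem_singleton] at hb hd
      unfold Between at h1 h2
      rcases hb with rfl | rfl <;> rcases hd with rfl | rfl <;> omega
    · exact hS.nc _ hW _ hW' hne a ha b hb c hc d hd
    · have h1 := hSI _ hW a ha
      have h2 := (hTO _ hW' b hb).1
      have h3 := hSI _ hW c hc
      unfold Between at h1 h2 h3
      omega
    · have h1 := (hTO _ hW a ha).1
      have h2 := (hTO _ hW c hc).1
      simp only [Finset.mem_insert, Finset.mem_singleton] at hb hd
      unfold Between at h1 h2
      rcases hb with rfl | rfl <;> rcases hd with rfl | rfl <;> omega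
    · have h1 := hSI _ hW' b hb
      have h2 := (hTO _ hW c hc).1
      have h3 := hSI _ hW' d hd
      unfold Between at h1 h2 h3
      omega
    · exact hT.nc _ hW _ hW' hne a ha b hb c hc d hd

open Classical in
/-- Summation over the bi-non-crossing partitions with a given block `{p, l}` factors into the
partitions of the inside and those of the outside of the interval between `p` and `l`. -/
theorem sum_bncBlocks_pair (hU : U = {p, l} ∪ I ∪ O)
    (hI : ∀ q ∈ I, Between χ p l q) (hO : ∀ q ∈ O, ¬ Between χ p l q ∧ q ≠ p ∧ q ≠ l)
    (κ : Finset (Fin N) → ℂ) :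
    ∑ P ∈ (bncBlocks χ U).filter ({p, l} ∈ ·), ∏ W ∈ P.erase {p, l}, κ W =
      (∑ P ∈ bncBlocks χ I, ∏ W ∈ P, κ W) * ∑ P ∈ bncBlocks χ O, ∏ W ∈ P, κ W := by
  have hdisj : ∀ q ∈ I, q ∉ O := fun q hq hq' => (hO q hq').1 (hI q hq)
  have hplI : p ∉ I := by
    intro hq
    have := hI p hq
    unfold Between at this
    omega
  have hplO : p ∉ O := fun hq => (hO p hq).2.1 rfl
  have hIU : I ⊆ U := hU ▸ Finset.subset_union_right.trans Finset.subset_union_left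
  have hOU : O ⊆ U := hU ▸ Finset.subset_union_right
  rw [Finset.sum_mul_sum, ← Finset.sum_product']
  refine Finset.sum_bij' (fun P _ => (P.filter (· ⊆ I), P.filter (· ⊆ O)))
    (fun Q _ => insert {p, l} (Q.1 ∪ Q.2)) ?_ ?_ ?_ ?_ ?_
  · intro P hP
    obtain ⟨hP, hpl⟩ := Finset.mem_filter.1 hP
    rw [mem_bncBlocks] at hP
    rw [Finset.mem_product, mem_bncBlocks, mem_bncBlocks]
    constructor
    · refine hP.filter_subset hIU fun W hW a ha haI => ?_
      rcases hP.subset_or_subset hU hI hO hpl hW with rfl | h | h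
      · have := hI a haI
        simp only [Finset.mem_insert, Finset.mem_singleton] at ha
        unfold Between at this
        rcases ha with rfl | rfl <;> omega
      · exact h
      · exact absurd (h ha) (hdisj a haI)
    · refine hP.filter_subset hOU fun W hW a ha haO => ?_
      rcases hP.subset_or_subset hU hI hO hpl hW with rfl | h | h
      · have := hO a haO
        simp only [Finset.mem_insert, Finset.mem_singleton] at ha
        rcases ha with rfl | rfl <;> simp_all
      · exact absurd haO (hdisj a (h ha))
      · exact h
  · intro Q hQ
    rw [Finset.mem_product, mem_bncBlocks, mem_bncBlocks] at hQ
    exact Finset.mem_filter.2 ⟨mem_bncBlocks.2 (IsBNCBlocks.insert_union hU hI hO hQ.1 hQ.2),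
      Finset.mem_insert_self _ _⟩
  · intro P hP
    obtain ⟨hP, hpl⟩ := Finset.mem_filter.1 hP
    rw [mem_bncBlocks] at hP
    ext W
    simp only [Finset.mem_insert, Finset.mem_union, Finset.mem_filter]
    constructor
    · rintro (rfl | h | h)
      · exact hpl
      · exact h.1
      · exact h.1
    · intro hW
      rcases hP.subset_or_subset hU hI hO hpl hW with h | h | h <;> simp [h, hW]
  · intro Q hQ
    rw [Finset.mem_product, mem_bncBlocks, mem_bncBlocks] at hQ
    have hne : ∀ W : Finset (Fin N), W.Nonempty → W ⊆ I → ¬ W ⊆ O := by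
      rintro W ⟨a, ha⟩ h h'
      exact hdisj a (h ha) (h' ha)
    ext W
    · simp only [Finset.mem_insert, Finset.mem_union, Finset.mem_filter]
      constructor
      · rintro ⟨rfl | h | h, h'⟩
        · exact absurd (h' (by simp)) hplI
        · exact h
        · exact absurd (hQ.2.subset W h) (hne W (hQ.2.nonempty W h) h')
      · exact fun h => ⟨Or.inr (Or.inl h), hQ.1.subset W h⟩
    · simp only [Finset.mem_insert, Finset.mem_union, Finset.mem_filter]
      constructor
      · rintro ⟨rfl | h | h, h'⟩
        · exact absurd (h' (by simp)) hplO
        · exact absurd h' (hne W (hQ.1.nonempty W h) (hQ.1.subset W h))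
        · exact h
      · exact fun h => ⟨Or.inr (Or.inr h), hQ.2.subset W h⟩
  · intro P hP
    obtain ⟨hP, hpl⟩ := Finset.mem_filter.1 hP
    rw [mem_bncBlocks] at hP
    have hd : Disjoint (P.filter (· ⊆ I)) (P.filter (· ⊆ O)) := by
      rw [Finset.disjoint_left]
      intro W hW hW'
      obtain ⟨a, ha⟩ := hP.nonempty W (Finset.mem_filter.1 hW).1
      exact hdisj a ((Finset.mem_filter.1 hW).2 ha) ((Finset.mem_filter.1 hW').2 ha)
    rw [← Finset.prod_union hd]
    refine Finset.prod_congr ?_ fun _ _ => rfl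
    ext W
    simp only [Finset.mem_erase, Finset.mem_union, Finset.mem_filter]
    constructor
    · rintro ⟨h, hW⟩
      rcases hP.subset_or_subset hU hI hO hpl hW with h' | h' | h'
      · exact absurd h' h
      · exact Or.inl ⟨hW, h'⟩
      · exact Or.inr ⟨hW, h'⟩
    · rintro (⟨hW, h⟩ | ⟨hW, h⟩)
      · refine ⟨?_, hW⟩
        rintro rfl
        exact hplI (h (by simp))
      · refine ⟨?_, hW⟩
        rintro rfl
        exact hplO (h (by simp))

end Split

/-- The nodes of `V` enclosed by `p` and the last node `l` in the order attached to `χ`. -/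
def innerNodes {N : ℕ} (χ : Fin N → Side) (l : Fin N) (V : Finset (Fin N)) (p : Fin N) :
    Finset (Fin N) :=
  open Classical in V.filter fun q => q ≠ l ∧ p < q ∧ χ q = χ p

/-- The nodes of `V` other than `p` and `l` that are not enclosed by `p` and the last node `l`. -/
def outerNodes {N : ℕ} (χ : Fin N → Side) (l : Fin N) (V : Finset (Fin N)) (p : Fin N) :
    Finset (Fin N) :=
  open Classical in V.filter fun q => q ≠ l ∧ q ≠ p ∧ ¬ (p < q ∧ χ q = χ p)

/-- With respect to the last node `l`, the order attached to `χ` plays no role other than that the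
nodes between `p` and `l` are the later nodes on the side of `p`. The side of `l` itself does not
matter. -/
theorem between_last_iff {N : ℕ} {χ : Fin N → Side} {l : Fin N} (hl : ∀ q, q ≤ l)
    {p q : Fin N} (hp : p ≠ l) (hq : q ≠ l) :
    Between χ p l q ↔ p < q ∧ χ q = χ p := by
  have h1 := hl p
  have h2 := hl q
  have hp' : (p : ℕ) ≠ l := fun h => hp (Fin.ext h)
  have hq' : (q : ℕ) ≠ l := fun h => hq (Fin.ext h)
  have h3 := l.2
  rw [Fin.le_def] at h1 h2
  rw [Fin.lt_def]
  unfold Between nodeRank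
  cases χ p <;> cases χ q <;> cases χ l <;> simp <;> omega

open Classical in
/-- The value of the moment of `V` if the only non-zero cumulants that involve the last node `l` are
the cumulants `c p` of the pairs `{p, l}`. -/
def pairMoment {N : ℕ} (χ : Fin N → Side) (l : Fin N) (c : Fin N → ℂ)
    (m : Finset (Fin N) → ℂ) (V : Finset (Fin N)) : ℂ :=
  ∑ p ∈ V.erase l, c p * (m (innerNodes χ l V p) * m (outerNodes χ l V p))

open Classical in
/-- The cumulant of `V` if the only non-zero cumulants that involve the last node `l` are the
cumulants `c p` of the pairs `{p, l}`. -/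
def pairCumulant {N : ℕ} (l : Fin N) (c : Fin N → ℂ) (V : Finset (Fin N)) : ℂ :=
  ∑ p ∈ V.erase l, if V = {p, l} then c p else 0

/-- If the moments of the proper subsets of `U` containing the last node are those of a family with
pair cumulants only, then the cumulant of `U` measures the deviation of the moment of `U`. -/
theorem cumulant_eq_pairCumulant_add {N : ℕ} (χ : Fin N → Side) {l : Fin N} (hl : ∀ q, q ≤ l)
    (c : Fin N → ℂ) (m : Finset (Fin N) → ℂ) (hm : m ∅ = 1) (U : Finset (Fin N)) (hlU : l ∈ U)
    (h : ∀ V, V ⊂ U → l ∈ V → m V = pairMoment χ l c m V) :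
    cumulant χ m U = pairCumulant l c U + (m U - pairMoment χ l c m U) := by
  classical
  induction U using Finset.strongInduction with
  | H U ih =>
  have hκ : ∀ W, W ⊂ U → l ∈ W → cumulant χ m W = pairCumulant l c W := by
    intro W hW hlW
    rw [ih W hW hlW fun V hV => h V (hV.trans hW), h W hW hlW]
    ring
  -- In a partition other than the one with the single block `U`, only a pair `{p, l}` can be the
  -- block of `l`.
  have key : ∑ P ∈ (bncBlocks χ U).filter (U ∉ ·), ∏ W ∈ P, cumulant χ m W =
      ∑ p ∈ U.erase l, c p * ∑ P ∈ (bncBlocks χ U).filter (fun P => {p, l} ∈ P ∧ U ∉ P),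
        ∏ W ∈ P.erase {p, l}, cumulant χ m W := by
    simp_rw [Finset.mul_sum]
    have h1 : ∀ p ∈ U.erase l, ∑ P ∈ (bncBlocks χ U).filter (fun P => {p, l} ∈ P ∧ U ∉ P),
        c p * ∏ W ∈ P.erase {p, l}, cumulant χ m W =
        ∑ P ∈ (bncBlocks χ U).filter (U ∉ ·), if {p, l} ∈ P then
          c p * ∏ W ∈ P.erase {p, l}, cumulant χ m W else 0 := by
      intro p _
      rw [← Finset.sum_filter, Finset.filter_filter]
      refine Finset.sum_congr (Finset.filter_congr fun P _ => and_comm) fun _ _ => rfl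
    rw [Finset.sum_congr rfl h1, Finset.sum_comm]
    refine Finset.sum_congr rfl fun P hP => ?_
    obtain ⟨hP, hUP⟩ := Finset.mem_filter.1 hP
    rw [mem_bncBlocks] at hP
    obtain ⟨W, hW, hlW⟩ := hP.cover l hlU
    have hWU : W ⊂ U := (hP.subset W hW).ssubset_of_ne fun e => hUP (e ▸ hW)
    rw [← Finset.mul_prod_erase P _ hW, hκ W hWU hlW, pairCumulant, Finset.sum_mul]
    refine (Finset.sum_subset (Finset.erase_subset_erase l hWU.subset) ?_).trans ?_
    · intro p hp hpW
      rw [if_neg, zero_mul]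
      rintro rfl
      exact hpW (by simpa using (Finset.mem_erase.1 hp).1)
    · refine Finset.sum_congr rfl fun p hp => ?_
      by_cases hWp : W = {p, l}
      · rw [if_pos hWp, if_pos (hWp ▸ hW), hWp]
      · rw [if_neg hWp, zero_mul, if_neg]
        exact fun h' => hWp (hP.disj _ hW _ h' l hlW (by simp))
  have hsum : ∀ p ∈ U.erase l, ∑ P ∈ (bncBlocks χ U).filter ({p, l} ∈ ·),
      ∏ W ∈ P.erase {p, l}, cumulant χ m W =
      m (innerNodes χ l U p) * m (outerNodes χ l U p) := by
    intro p hp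
    obtain ⟨hpl, hpU⟩ := Finset.mem_erase.1 hp
    rw [sum_bncBlocks_pair (I := innerNodes χ l U p) (O := outerNodes χ l U p),
      sum_bncBlocks_cumulant χ m hm, sum_bncBlocks_cumulant χ m hm]
    · ext q
      simp only [innerNodes, outerNodes, Finset.mem_union, Finset.mem_insert,
        Finset.mem_singleton, Finset.mem_filter]
      by_cases h1 : q = l
      · simp [h1, hlU]
      by_cases h2 : q = p
      · simp [h2, hpU]
      tauto
    · intro q hq
      simp only [innerNodes, Finset.mem_filter] at hq
      exact (between_last_iff hl hpl hq.2.1).2 hq.2.2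
    · intro q hq
      simp only [outerNodes, Finset.mem_filter] at hq
      exact ⟨fun hb => hq.2.2.2 ((between_last_iff hl hpl hq.2.1).1 hb), hq.2.2.1, hq.2.1⟩
  have hlast : pairMoment χ l c m U = pairCumulant l c U +
      ∑ p ∈ U.erase l, c p * ∑ P ∈ (bncBlocks χ U).filter (fun P => {p, l} ∈ P ∧ U ∉ P),
        ∏ W ∈ P.erase {p, l}, cumulant χ m W := by
    rw [pairMoment, pairCumulant, ← Finset.sum_add_distrib]
    refine Finset.sum_congr rfl fun p hp => ?_
    rw [← hsum p hp]
    by_cases hUp : U = {p, l}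
    · rw [if_pos hUp]
      have e1 : (bncBlocks χ U).filter ({p, l} ∈ ·) = {{U}} := by
        ext P
        rw [Finset.mem_filter, mem_bncBlocks, Finset.mem_singleton, ← hUp]
        exact ⟨fun h' => h'.1.eq_singleton h'.2, by
          rintro rfl
          exact ⟨isBNCBlocks_singleton ⟨l, hlU⟩, by simp⟩⟩
      have e2 : (bncBlocks χ U).filter (fun P => {p, l} ∈ P ∧ U ∉ P) = ∅ := by
        rw [← hUp]
        exact Finset.filter_false_of_mem fun P _ h' => h'.2 h'.1
      rw [e1, e2, Finset.sum_singleton, ← hUp]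
      simp
    · rw [if_neg hUp, zero_add]
      congr 1
      refine Finset.sum_congr (Finset.filter_congr fun P hP => ?_) fun _ _ => rfl
      rw [mem_bncBlocks] at hP
      refine ⟨fun h' => ⟨h', fun h'' => hUp ?_⟩, fun h' => h'.1⟩
      exact hP.disj _ h'' _ h' l hlU (by simp)
  rw [cumulant_eq_sub_sum, key, hlast]
  ring

/-! ### Words and the bi-free difference quotient -/

/-- A letter of a word in operators that act on two sides: a distinguished operator (the pivot), an
operator on the same side as the pivot, or an operator on the opposite side. -/
inductive Letter (B : Type*)
  | pivot : Letter B
  | same (b : B) : Letter B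
  | opp (b : B) : Letter B

namespace Letter

variable {B C : Type*}

/-- The operator of a letter, where the pivot stands for `X`. -/
def val (X : B) : Letter B → B
  | pivot => X
  | same b => b
  | opp b => b

/-- Whether the letter acts on the side of the pivot. -/
def isSame : Letter B → Bool
  | pivot => true
  | same _ => true
  | opp _ => false

/-- The letters with values in `S` (on the side of the pivot) and `T` (on the opposite side). -/
def Mem (S T : Set B) : Letter B → Prop
  | pivot => True
  | same b => b ∈ S
  | opp b => b ∈ T

/-- The letter with `f` applied to its operator. -/
def map (f : B → C) : Letter B → Letter C
  | pivot => pivot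
  | same b => same (f b)
  | opp b => opp (f b)

theorem val_map (f : B → C) (X : B) (a : Letter B) : (a.map f).val (f X) = f (a.val X) := by
  cases a <;> rfl

theorem isSame_map (f : B → C) (a : Letter B) : (a.map f).isSame = a.isSame := by
  cases a <;> rfl

end Letter

section Words

section Semiring

variable {B : Type*} [Semiring B]

/-- The product of the letters of a word. -/
def wordVal (X : B) (w : List (Letter B)) : B := (w.map (Letter.val X)).prod

@[simp] theorem wordVal_nil (X : B) : wordVal X [] = 1 := rfl

@[simp] theorem wordVal_cons (X : B) (a : Letter B) (w : List (Letter B)) :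
    wordVal X (a :: w) = a.val X * wordVal X w := by
  simp [wordVal]

/-- The product of the letters on the side of the pivot. -/
def sameProd (X : B) (w : List (Letter B)) : B := wordVal X (w.filter Letter.isSame)

/-- The product of the letters on the side opposite to the pivot. -/
def oppProd (X : B) (w : List (Letter B)) : B := wordVal X (w.filter fun a => !a.isSame)

theorem oppProd_pivot (X : B) (w : List (Letter B)) :
    oppProd X (.pivot :: w) = oppProd X w := rfl

theorem oppProd_same (X b : B) (w : List (Letter B)) :
    oppProd X (.same b :: w) = oppProd X w := rfl

theorem oppProd_opp (X b : B) (w : List (Letter B)) :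
    oppProd X (.opp b :: w) = b * oppProd X w := by
  simp [oppProd, Letter.isSame, Letter.val]

theorem sameProd_pivot (X : B) (w : List (Letter B)) :
    sameProd X (.pivot :: w) = X * sameProd X w := by
  rw [sameProd, List.filter_cons_of_pos rfl, wordVal_cons]
  rfl

theorem sameProd_same (X b : B) (w : List (Letter B)) :
    sameProd X (.same b :: w) = b * sameProd X w := by
  rw [sameProd, List.filter_cons_of_pos rfl, wordVal_cons]
  rfl

end Semiring

variable {B C : Type*} [Semiring B] [Algebra ℂ B] [Semiring C] [Algebra ℂ C]

/-- The bi-free difference quotient of a word with respect to the pivot, with `ψ` applied to one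
tensor factor: each occurrence of the pivot contributes `ψ` of the letters after it that are on its
side, times the product of all the other letters. -/
def diff (ψ : B → ℂ) (X : B) : List (Letter B) → B
  | [] => 0
  | .pivot :: w => ψ (sameProd X w) • oppProd X w + X * diff ψ X w
  | .same b :: w => b * diff ψ X w
  | .opp b :: w => b * diff ψ X w

theorem diff_cons (ψ : B → ℂ) (X : B) (a : Letter B) (w : List (Letter B)) :
    diff ψ X (a :: w) = (open Classical in if a = .pivot then ψ (sameProd X w) • oppProd X w else 0)
      + a.val X * diff ψ X w := by
  cases a <;> simp [diff, Letter.val]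

theorem wordVal_map (f : B →ₐ[ℂ] C) (X : B) (w : List (Letter B)) :
    wordVal (f X) (w.map (Letter.map f)) = f (wordVal X w) := by
  induction w with
  | nil => simp
  | cons a w ih => simp [ih, Letter.val_map]

theorem sameProd_map (f : B →ₐ[ℂ] C) (X : B) (w : List (Letter B)) :
    sameProd (f X) (w.map (Letter.map f)) = f (sameProd X w) := by
  rw [sameProd, sameProd, ← wordVal_map, List.filter_map]
  simp [Function.comp_def, Letter.isSame_map]

theorem oppProd_map (f : B →ₐ[ℂ] C) (X : B) (w : List (Letter B)) :
    oppProd (f X) (w.map (Letter.map f)) = f (oppProd X w) := by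
  rw [oppProd, oppProd, ← wordVal_map, List.filter_map]
  simp [Function.comp_def, Letter.isSame_map]

theorem diff_map (f : B →ₐ[ℂ] C) (ψ : C → ℂ) (X : B) (w : List (Letter B)) :
    diff ψ (f X) (w.map (Letter.map f)) = f (diff (fun b => ψ (f b)) X w) := by
  induction w with
  | nil => simp [diff]
  | cons a w ih => cases a <;> simp [diff, Letter.map, ih, sameProd_map, oppProd_map]

/-- The difference quotient as a sum over the positions of the pivot. -/
theorem apply_diff_eq_sum (ψ : B →ₗ[ℂ] ℂ) (X : B) {k : ℕ} (Z : Fin k → Letter B)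
    (l : List (Fin k)) (hl : l.Pairwise (· < ·)) (c : B) :
    ψ (c * diff ψ X (l.map Z)) = (l.map fun p => open Classical in
      if Z p = .pivot then
        ψ (wordVal X ((l.filter fun q => p < q ∧ (Z q).isSame).map Z)) *
        ψ (c * wordVal X ((l.filter fun q => q ≠ p ∧ ¬ (p < q ∧ (Z q).isSame)).map Z))
      else 0).sum := by
  classical
  induction l generalizing c with
  | nil => simp [diff]
  | cons a l ih =>
    obtain ⟨ha, hl⟩ := List.pairwise_cons.1 hl
    rw [List.map_cons, diff_cons, mul_add, map_add, ← mul_assoc, ih hl, List.map_cons,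
      List.sum_cons]
    congr 1
    · by_cases hZ : Z a = .pivot
      · have e1 : sameProd X (l.map Z) =
            wordVal X (((a :: l).filter fun q => a < q ∧ (Z q).isSame).map Z) := by
          rw [sameProd, List.filter_map, List.filter_cons_of_neg (by simp)]
          congr 2
          exact List.filter_congr fun q hq => by simp [ha q hq]
        have e2 : oppProd X (l.map Z) =
            wordVal X (((a :: l).filter fun q => q ≠ a ∧ ¬ (a < q ∧ (Z q).isSame)).map Z) := by
          rw [oppProd, List.filter_map, List.filter_cons_of_neg (by simp)]
          congr 2
          exact List.filter_congr fun q hq => by simp [ha q hq, (ha q hq).ne']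
        rw [if_pos hZ, if_pos hZ, e1, e2]
        simp
      · simp [hZ]
    · congr 1
      refine List.map_congr_left fun p hp => ?_
      have hap := ha p hp
      rw [List.filter_cons_of_neg (by simp [hap.le]),
        List.filter_cons_of_pos (by simp [hap.le, hap.ne])]
      simp [mul_assoc]

end Words

/-! ### Conjugate variables in terms of moments -/

/-- The opposite side. -/
def Side.other : Side → Side
  | .left => .right
  | .right => .left

/-- The side of a letter if the pivot acts on the side `s`. -/
def Letter.side {B : Type*} (s : Side) (a : Letter B) : Side := if a.isSame then s else s.other

theorem Letter.side_eq_iff {B : Type*} {s : Side} {a : Letter B} :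
    a.side s = s ↔ a.isSame = true := by
  unfold Letter.side
  split
  · simp_all
  · cases s <;> simp_all [Side.other]

theorem sort_filter {k : ℕ} (V : Finset (Fin k)) (P : Fin k → Prop) [DecidablePred P] :
    (V.filter P).sort (· ≤ ·) = (V.sort (· ≤ ·)).filter P := by
  refine List.Perm.eq_of_pairwise' (r := (· ≤ ·)) (Finset.pairwise_sort _ _)
    ((Finset.pairwise_sort _ _).filter _) ?_
  rw [List.perm_ext_iff_of_nodup (Finset.sort_nodup _ _) ((Finset.sort_nodup _ _).filter _)]
  simp

/-- The subword with the indices in `V`. -/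
def subword {A : Type*} {k : ℕ} (Z : Fin k → Letter A) (V : Finset (Fin k)) : List (Letter A) :=
  (V.sort (· ≤ ·)).map Z

theorem wordVal_subword {A : Type*} [Semiring A] {k : ℕ} (X : A) (Z : Fin k → Letter A)
    (V : Finset (Fin k)) :
    wordVal X (subword Z V) = orderedProd (fun p => (Z p).val X) V := by
  simp [wordVal, subword, orderedProd, Function.comp_def]

theorem subword_univ {A : Type*} {k : ℕ} (Z : Fin k → Letter A) :
    subword Z Finset.univ = List.ofFn Z := by
  simp [subword, Fin.sort_univ, List.ofFn_eq_map]

theorem Letter.mem_side {A : Type*} [CStarAlgebra A] {B : Side → StarSubalgebra ℂ A} {s : Side}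
    {X : A} {a : Letter A} (ha : a.Mem (B s : Set A) (B s.other : Set A)) :
    a.val X ∈ B (a.side s) ∨ (a.side s = s ∧ a.val X = X) := by
  cases a <;> simp_all [Letter.Mem, Letter.val, Letter.side, Letter.isSame]

theorem Letter.exists_of_mem {A : Type*} [CStarAlgebra A] {B : Side → StarSubalgebra ℂ A}
    {s t : Side} {X z : A} (h : z ∈ B t ∨ (t = s ∧ z = X)) :
    ∃ a : Letter A, a.Mem (B s : Set A) (B s.other : Set A) ∧ a.side s = t ∧ a.val X = z := by
  rcases h with h | ⟨rfl, rfl⟩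
  · by_cases hts : t = s
    · subst hts
      exact ⟨.same z, h, by simp [Letter.side, Letter.isSame], rfl⟩
    · have : t = s.other := by cases s <;> cases t <;> simp_all [Side.other]
      subst this
      exact ⟨.opp z, h, by simp [Letter.side, Letter.isSame], rfl⟩
  · exact ⟨.pivot, trivial, by simp [Letter.side, Letter.isSame], rfl⟩

section Moments

variable {A : Type u} [CStarAlgebra A] [PartialOrder A] [StarOrderedRing A]

/-- The relation `φ(w ξ) = (φ ⊗ φ)(∂ w)` between `ξ` and the bi-free difference quotient `∂` with
respect to `X`, for all words with letters in `S` on the side of `X` and in `T` on the opposite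
side. -/
def ConjugateRelation (φ : A →ₚ[ℂ] ℂ) (X : A) (S T : Set A) (ξ : φ.GNS) : Prop :=
  ∀ w : List (Letter A), (∀ a ∈ w, a.Mem S T) →
    vectorMoment φ (wordVal X w) ξ = φ (diff φ X w)

open Classical in
theorem apply_diff_subword {A : Type*} [CStarAlgebra A] [PartialOrder A] (φ : A →ₚ[ℂ] ℂ) (X : A)
    {k : ℕ} (Z : Fin k → Letter A) (V : Finset (Fin k)) :
    φ (diff φ X (subword Z V)) = ∑ p ∈ V, if Z p = .pivot then
        φ (orderedProd (fun p => (Z p).val X) (V.filter fun q => p < q ∧ (Z q).isSame)) *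
        φ (orderedProd (fun p => (Z p).val X)
          (V.filter fun q => q ≠ p ∧ ¬ (p < q ∧ (Z q).isSame)))
      else 0 := by
  have h := apply_diff_eq_sum φ.toLinearMap X Z (V.sort (· ≤ ·))
    (Finset.sortedLT_sort V).pairwise 1
  rw [one_mul] at h
  refine h.trans ?_
  rw [← List.sum_toFinset _ (Finset.sort_nodup _ _), Finset.sort_toFinset]
  refine Finset.sum_congr rfl fun p _ => ?_
  simp_rw [← wordVal_subword, subword, sort_filter, one_mul]
  congr

/-- The coefficients of the pair cumulants: `1` for the pivot and `0` for all other letters. -/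
def pivotCoeff {k : ℕ} (Z : Fin k → Letter A) : Fin (k + 1) → ℂ :=
  open Classical in Fin.snoc (α := fun _ => ℂ) (fun p => if Z p = .pivot then 1 else 0) 0

theorem entryMoment_of_mem (φ : A →ₚ[ℂ] ℂ) {k : ℕ} (Z : Fin k → A) (ξ : φ.GNS)
    {V : Finset (Fin (k + 1))} {V' : Finset (Fin k)} (h : Fin.last k ∈ V)
    (hV : ∀ p, p ∈ V' ↔ p.castSucc ∈ V) :
    entryMoment φ Z ξ V = vectorMoment φ (orderedProd Z V') ξ := by
  classical
  rw [entryMoment, if_pos h]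
  congr
  ext p
  simp [hV]

theorem entryMoment_of_notMem (φ : A →ₚ[ℂ] ℂ) {k : ℕ} (Z : Fin k → A) (ξ : φ.GNS)
    {V : Finset (Fin (k + 1))} {V' : Finset (Fin k)} (h : Fin.last k ∉ V)
    (hV : ∀ p, p ∈ V' ↔ p.castSucc ∈ V) :
    entryMoment φ Z ξ V = φ (orderedProd Z V') := by
  classical
  rw [entryMoment, if_neg h]
  congr
  ext p
  simp [hV]

/-- For the entries of `(Z₁, …, Z_k, ξ)`, the sum over the pairs of a pivot and the last node is the
difference quotient. -/
theorem pairMoment_entryMoment (φ : A →ₚ[ℂ] ℂ) (s : Side) (X : A) {k : ℕ} (Z : Fin k → Letter A)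
    (ξ : φ.GNS) {V : Finset (Fin (k + 1))} {V' : Finset (Fin k)}
    (hV : ∀ p, p ∈ V' ↔ p.castSucc ∈ V) :
    pairMoment (Fin.snoc (fun p => (Z p).side s) Side.left : Fin (k + 1) → Side) (Fin.last k)
      (pivotCoeff Z) (entryMoment φ (fun p => (Z p).val X) ξ) V =
    φ (diff φ X (subword Z V')) := by
  classical
  rw [apply_diff_subword, pairMoment]
  have hmap : V.erase (Fin.last k) = V'.map Fin.castSuccEmb := by
    ext q
    refine Fin.lastCases ?_ (fun p => ?_) q
    · simp
    · simp [hV]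
  rw [hmap, Finset.sum_map]
  refine Finset.sum_congr rfl fun p _ => ?_
  simp only [pivotCoeff, Fin.coe_castSuccEmb, Fin.snoc_castSucc]
  by_cases hZ : Z p = .pivot
  · rw [if_pos hZ, if_pos hZ, one_mul]
    have hs : (Z p).side s = s := by simp [hZ, Letter.side, Letter.isSame]
    congr 1
    · refine entryMoment_of_notMem φ _ ξ (by simp [innerNodes]) fun q => ?_
      simp only [innerNodes, Finset.mem_filter, hV, Fin.snoc_castSucc, hs, Letter.side_eq_iff,
        Fin.castSucc_lt_castSucc_iff]
      simp [Fin.ext_iff, q.2.ne]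
    · refine entryMoment_of_notMem φ _ ξ (by simp [outerNodes]) fun q => ?_
      simp only [outerNodes, Finset.mem_filter, hV, Fin.snoc_castSucc, hs, Letter.side_eq_iff,
        Fin.castSucc_lt_castSucc_iff]
      simp [Fin.ext_iff, q.2.ne]
  · rw [if_neg hZ, if_neg hZ, zero_mul]

/-- If the conjugate relation holds for all proper subwords, the cumulant measures its failure for
the word itself. -/
theorem biFreeCumulant_eq (φ : A →ₚ[ℂ] ℂ) (hφ : φ 1 = 1) (s : Side) (X : A) {k : ℕ}
    (Z : Fin k → Letter A) (ξ : φ.GNS)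
    (h : ∀ V, V ≠ Finset.univ →
      vectorMoment φ (wordVal X (subword Z V)) ξ = φ (diff φ X (subword Z V))) :
    biFreeCumulant φ (fun p => (Z p).side s) (fun p => (Z p).val X) ξ =
      pairCumulant (Fin.last k) (pivotCoeff Z) Finset.univ +
      (vectorMoment φ (wordVal X (List.ofFn Z)) ξ - φ (diff φ X (List.ofFn Z))) := by
  classical
  rw [biFreeCumulant, cumulant_eq_pairCumulant_add _ Fin.le_last (pivotCoeff Z) _ ?_ _
    (Finset.mem_univ _) ?_]
  · rw [pairMoment_entryMoment φ s X Z ξ (V' := Finset.univ) (by simp), subword_univ,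
      entryMoment_of_mem φ _ ξ (V' := Finset.univ) (by simp) (by simp), ← wordVal_subword,
      subword_univ]
  · rw [entryMoment_of_notMem φ _ ξ (V' := ∅) (by simp) (by simp)]
    simp [orderedProd, hφ]
  · intro V hVU hl
    obtain ⟨V', hV⟩ : ∃ V' : Finset (Fin k), ∀ p, p ∈ V' ↔ p.castSucc ∈ V :=
      ⟨Finset.univ.filter fun p => p.castSucc ∈ V, by simp⟩
    rw [pairMoment_entryMoment φ s X Z ξ hV, entryMoment_of_mem φ _ ξ hl hV, ← wordVal_subword]
    refine h _ fun hu => hVU.ne ?_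
    ext q
    simp only [Finset.mem_univ, iff_true]
    refine Fin.lastCases hl (fun p => ?_) q
    exact (hV p).1 (hu ▸ Finset.mem_univ p)

theorem pairCumulant_zero (c : Fin 1 → ℂ) :
    pairCumulant (Fin.last 0) c Finset.univ = 0 := by
  classical
  simp [pairCumulant]

theorem pairCumulant_one (c : Fin 2 → ℂ) :
    pairCumulant (Fin.last 1) c Finset.univ = c 0 := by
  classical
  have : (Finset.univ : Finset (Fin 2)).erase (Fin.last 1) = {0} := by decide
  rw [pairCumulant, this, Finset.sum_singleton, if_pos (by decide)]

theorem pairCumulant_of_two_le {k : ℕ} (hk : 2 ≤ k) (c : Fin (k + 1) → ℂ) :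
    pairCumulant (Fin.last k) c Finset.univ = 0 := by
  classical
  refine Finset.sum_eq_zero fun p _ => if_neg fun h => ?_
  have h1 := congrArg Finset.card h
  have h2 := Finset.card_le_two (a := p) (b := Fin.last k)
  rw [← h1, Finset.card_univ, Fintype.card_fin] at h2
  omega

theorem fin_one_eq {α : Type*} (f : Fin 1 → α) : f = ![f 0] := by
  ext i
  rw [Subsingleton.elim i 0]
  rfl

/-- A conjugate variable satisfies the conjugate relation: by induction on the length of the word,
the prescribed value of the cumulant of the word determines its moment. -/
theorem IsConjugateVariable.conjugateRelation {φ : A →ₚ[ℂ] ℂ} (hφ : φ 1 = 1) {s : Side} {X : A}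
    {B : Side → StarSubalgebra ℂ A} {ξ : φ.GNS} (h : IsConjugateVariable φ s X B ξ) :
    ConjugateRelation φ X (B s) (B s.other) ξ := by
  classical
  obtain ⟨-, h0, h1, hB, h2⟩ := h
  suffices H : ∀ k, ∀ w : List (Letter A), w.length = k → (∀ a ∈ w, a.Mem (B s) (B s.other)) →
      vectorMoment φ (wordVal X w) ξ = φ (diff φ X w) from fun w => H _ w rfl
  intro k
  induction k using Nat.strong_induction_on with
  | _ k ih =>
  rintro w rfl hw
  have hκ : ∀ {k : ℕ} (Z : Fin k → Letter A), (∀ p, (Z p).Mem (B s : Set A) (B s.other)) →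
      biFreeCumulant φ (fun p => (Z p).side s) (fun p => (Z p).val X) ξ =
        pairCumulant (Fin.last _) (pivotCoeff Z) Finset.univ := by
    clear ih hw w
    intro k Z hZm
    rcases k with - | - | k
    · rw [pairCumulant_zero, Subsingleton.elim (fun p => (Z p).side s) ![],
        Subsingleton.elim (fun p => (Z p).val X) ![], h0]
    · rw [pairCumulant_one, fin_one_eq (fun p => (Z p).side s), fin_one_eq fun p => (Z p).val X]
      have hm := hZm 0
      have hc : pivotCoeff Z 0 = if Z 0 = .pivot then 1 else 0 :=
        Fin.snoc_castSucc (α := fun _ => ℂ) (n := 1) _ _ 0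
      rw [hc]
      cases hz : Z 0 with
      | pivot => simpa [Letter.side, Letter.isSame, Letter.val] using h1
      | same b =>
        rw [hz] at hm
        simpa [Letter.side, Letter.isSame, Letter.val] using hB s b hm
      | opp b =>
        rw [hz] at hm
        simpa [Letter.side, Letter.isSame, Letter.val] using hB s.other b hm
    · rw [pairCumulant_of_two_le (by omega)]
      exact h2 _ (by omega) _ _ fun p => Letter.mem_side (hZm p)
  set Z : Fin w.length → Letter A := w.get with hZ
  have hZm : ∀ p, (Z p).Mem (B s : Set A) (B s.other : Set A) := fun p => hw _ (w.get_mem p)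
  have key := biFreeCumulant_eq φ hφ s X Z ξ fun V hV => by
    refine ih V.card ?_ _ (by simp [subword]) ?_
    · simpa using Finset.card_lt_card (Finset.ssubset_univ_iff.2 hV)
    · intro a ha
      obtain ⟨p, -, rfl⟩ := List.mem_map.1 ha
      exact hZm p
  rw [hκ Z hZm] at key
  have hof : List.ofFn Z = w := List.ofFn_get w
  rw [hof] at key
  linear_combination -key

/-- A vector of the right `L₂`-space that satisfies the conjugate relation is a conjugate
variable. -/
theorem ConjugateRelation.isConjugateVariable {φ : A →ₚ[ℂ] ℂ} (hφ : φ 1 = 1) {s : Side} {X : A}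
    {B : Side → StarSubalgebra ℂ A} {ξ : φ.GNS}
    (hξ : ξ ∈ L2 φ (extend (B Side.left ⊔ B Side.right) {X}))
    (h : ConjugateRelation φ X (B s) (B s.other) ξ) : IsConjugateVariable φ s X B ξ := by
  classical
  have key : ∀ {k : ℕ} (χ : Fin k → Side) (Z : Fin k → A) (Z' : Fin k → Letter A),
      (∀ p, (Z' p).Mem (B s) (B s.other) ∧ (Z' p).side s = χ p ∧ (Z' p).val X = Z p) →
      biFreeCumulant φ χ Z ξ = pairCumulant (Fin.last k) (pivotCoeff Z') Finset.univ := by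
    intro k χ Z Z' hZ
    have hχ : χ = fun p => (Z' p).side s := funext fun p => (hZ p).2.1.symm
    have hZ' : Z = fun p => (Z' p).val X := funext fun p => (hZ p).2.2.symm
    rw [hχ, hZ', biFreeCumulant_eq φ hφ s X Z' ξ, h, sub_self, add_zero]
    · intro a ha
      obtain ⟨p, rfl⟩ := (List.mem_ofFn' _ _).1 ha
      exact (hZ p).1
    · intro V _
      refine h _ fun a ha => ?_
      obtain ⟨p, -, rfl⟩ := List.mem_map.1 ha
      exact (hZ p).1
  have hc : ∀ Z : Fin 1 → Letter A, pivotCoeff Z 0 = if Z 0 = .pivot then 1 else 0 :=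
    fun Z => Fin.snoc_castSucc (α := fun _ => ℂ) (n := 1) _ _ 0
  refine ⟨hξ, ?_, ?_, ?_, ?_⟩
  · rw [key ![] ![] ![] (fun p => p.elim0), pairCumulant_zero]
  · rw [key ![s] ![X] ![.pivot] fun p => ?_, pairCumulant_one, hc]
    · simp
    · rw [Subsingleton.elim p 0]
      exact ⟨trivial, rfl, rfl⟩
  · intro t b hb
    by_cases hts : t = s
    · subst hts
      rw [key ![t] ![b] ![.same b] fun p => ?_, pairCumulant_one, hc]
      · simp
      · rw [Subsingleton.elim p 0]
        exact ⟨hb, rfl, rfl⟩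
    · have : t = s.other := by cases s <;> cases t <;> simp_all [Side.other]
      subst this
      rw [key ![s.other] ![b] ![.opp b] fun p => ?_, pairCumulant_one, hc]
      · simp
      · rw [Subsingleton.elim p 0]
        exact ⟨hb, rfl, rfl⟩
  · intro k hk χ Z hZ
    choose Z' hZ' using fun p => Letter.exists_of_mem (hZ p)
    rw [key χ Z Z' hZ', pairCumulant_of_two_le hk]

end Moments

/-! ### The left and right representations on a free product -/

section FreeProductModel

variable {ι : Type*} {S : ι → Type u}

theorem glue_split (k : ι) (w : Word S) : glue k (split k w).2 (split k w).1 = w := by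
  obtain ⟨_ | ⟨⟨j, s⟩, w⟩, h⟩ := w
  · rfl
  · by_cases hj : j = k
    · subst hj
      simp [split, glue]
    · simp [split, glue, hj]

theorem split_glue (k : ι) (t : Tail S k) (o : Option (S k)) : split k (glue k t o) = (o, t) := by
  obtain ⟨⟨t, ht⟩, htk⟩ := t
  cases o with
  | none =>
    cases t with
    | nil => rfl
    | cons a t =>
      have : a.1 ≠ k := htk a rfl
      simp [split, glue, this]
  | some s => simp [split, glue]

theorem exists_eq_glue (k : ι) (w : Word S) : ∃ t o, w = glue k t o :=
  ⟨_, _, (glue_split k w).symm⟩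

theorem leftRep_single_glue (k : ι) (T : Module.End ℂ (Pointed (S k))) (t : Tail S k)
    (o : Option (S k)) :
    leftRep k T (Finsupp.single (glue k t o) 1) =
      Finsupp.mapDomain (glue k t) (T (Finsupp.single o 1)) := by
  simp [leftRep, split_glue]

theorem leftRep_mapDomain_glue (k : ι) (T : Module.End ℂ (Pointed (S k))) (t : Tail S k)
    (x : Pointed (S k)) :
    leftRep k T (Finsupp.mapDomain (glue k t) x) = Finsupp.mapDomain (glue k t) (T x) := by
  have : leftRep k T ∘ₗ Finsupp.lmapDomain ℂ ℂ (glue k t) =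
      Finsupp.lmapDomain ℂ ℂ (glue k t) ∘ₗ T := by
    ext o : 2
    simp [leftRep_single_glue]
  exact LinearMap.congr_fun this x

/-- The left representation as a homomorphism of algebras. -/
def leftRepHom (k : ι) : Module.End ℂ (Pointed (S k)) →ₐ[ℂ] Module.End ℂ (FreeProd S) where
  toFun := leftRep k
  map_one' := by
    ext w : 2
    obtain ⟨t, o, rfl⟩ := exists_eq_glue k w
    simp [leftRep_single_glue, Finsupp.mapDomain_single]
  map_mul' T T' := by
    ext w : 2
    obtain ⟨t, o, rfl⟩ := exists_eq_glue k w
    simp [leftRep_single_glue, leftRep_mapDomain_glue]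
  map_zero' := by
    ext w : 2
    obtain ⟨t, o, rfl⟩ := exists_eq_glue k w
    simp [leftRep_single_glue]
  map_add' T T' := by
    ext w : 2
    obtain ⟨t, o, rfl⟩ := exists_eq_glue k w
    simp [leftRep_single_glue, Finsupp.mapDomain_add]
  commutes' c := by
    ext w : 2
    obtain ⟨t, o, rfl⟩ := exists_eq_glue k w
    simp [leftRep_single_glue, Algebra.algebraMap_eq_smul_one, Finsupp.mapDomain_single]

theorem Word.reverse_reverse (w : Word S) : w.reverse.reverse = w := by
  simp [Word.reverse]

theorem flip_single (w : Word S) (c : ℂ) :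
    flip S (Finsupp.single w c) = Finsupp.single w.reverse c := by
  simp [flip, Finsupp.mapDomain_single]

theorem flip_mul_flip : flip S * flip S = 1 := by
  ext w : 2
  simp [flip_single, Word.reverse_reverse]

/-- Conjugation with the reversal of words, which interchanges left and right. -/
def flipConj : Module.End ℂ (FreeProd S) →ₐ[ℂ] Module.End ℂ (FreeProd S) where
  toFun M := flip S * M * flip S
  map_one' := by rw [mul_one, flip_mul_flip]
  map_mul' M M' := by
    simp only [mul_assoc]
    rw [← mul_assoc (flip S) (flip S), flip_mul_flip, one_mul]
  map_zero' := by simp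
  map_add' M M' := by rw [mul_add, add_mul]
  commutes' c := by
    rw [Algebra.algebraMap_eq_smul_one, mul_smul_comm, mul_one, smul_mul_assoc, flip_mul_flip]

theorem flipConj_flipConj (M : Module.End ℂ (FreeProd S)) : flipConj (flipConj M) = M := by
  change flip S * (flip S * M * flip S) * flip S = M
  simp only [mul_assoc]
  rw [flip_mul_flip, ← mul_assoc, flip_mul_flip, mul_one, one_mul]

/-- The representation on the given side. Its values are those of `leftRep` and `rightRep` by
definition. -/
def sideRep : Side → (k : ι) → Module.End ℂ (Pointed (S k)) →ₐ[ℂ] Module.End ℂ (FreeProd S)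
  | .left, k => leftRepHom k
  | .right, k => flipConj.comp (leftRepHom k)

theorem flipConj_sideRep (s : Side) (k : ι) (T : Module.End ℂ (Pointed (S k))) :
    flipConj (sideRep s k T) = sideRep s.other k T := by
  cases s
  · rfl
  · exact flipConj_flipConj _

/-- The vacuum expectation. -/
def vac : Module.End ℂ (FreeProd S) →ₗ[ℂ] ℂ :=
  Finsupp.lapply (Word.empty S) ∘ₗ LinearMap.applyₗ (Finsupp.single (Word.empty S) 1)

theorem vac_apply (M : Module.End ℂ (FreeProd S)) :
    vac M = M (Finsupp.single (Word.empty S) 1) (Word.empty S) := rfl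

theorem flip_apply_empty (x : FreeProd S) : flip S x (Word.empty S) = x (Word.empty S) := by
  have : Finsupp.lapply (Word.empty S) ∘ₗ flip S =
      (Finsupp.lapply (Word.empty S) : FreeProd S →ₗ[ℂ] ℂ) := by
    ext w : 2
    have h : w.reverse = Word.empty S ↔ w = Word.empty S := by
      simp [Word.reverse, Word.empty, Subtype.ext_iff]
    classical
    simp [flip_single, Finsupp.single_apply, h]
  exact LinearMap.congr_fun this x

theorem vac_flipConj (M : Module.End ℂ (FreeProd S)) : vac (flipConj M) = vac M := by
  rw [vac_apply, vac_apply]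
  change flip S (M (flip S _)) _ = _
  rw [flip_apply_empty, flip_single]
  rfl

/-- The vacuum expectation of an operator acting on one factor is its expectation there. -/
theorem vac_sideRep (s : Side) (k : ι) (T : Module.End ℂ (Pointed (S k))) :
    vac (sideRep s k T) = T (Finsupp.single none 1) none := by
  have h : vac (leftRep k T) = T (Finsupp.single none 1) none := by
    have h0 : Word.empty S = glue k ⟨Word.empty S, by simp [Word.empty]⟩ none := rfl
    have hinj : Function.Injective (glue k ⟨Word.empty S, by simp [Word.empty]⟩) := by
      intro o o' h
      have := congrArg (split k) h
      rw [split_glue, split_glue] at this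
      exact congrArg Prod.fst this
    rw [vac_apply, h0, leftRep_single_glue, Finsupp.mapDomain_apply hinj]
  cases s
  · exact h
  · exact (vac_flipConj _).trans h

/-! ### Concatenation of words -/

open Classical in
/-- Concatenation of words, extended bilinearly to the free product. It is `0` for two words whose
concatenation is not reduced. -/
def cat : FreeProd S →ₗ[ℂ] FreeProd S →ₗ[ℂ] FreeProd S :=
  Finsupp.linearCombination ℂ fun u => Finsupp.linearCombination ℂ fun v =>
    if h : (u.1 ++ v.1).IsChain (fun a b => a.1 ≠ b.1) then Finsupp.single ⟨u.1 ++ v.1, h⟩ 1 else 0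

theorem cat_single {u v : Word S} (h : (u.1 ++ v.1).IsChain (fun a b => a.1 ≠ b.1)) :
    cat (Finsupp.single u 1) (Finsupp.single v 1) = Finsupp.single ⟨u.1 ++ v.1, h⟩ 1 := by
  simp [cat, h]

theorem cat_single_of_not {u v : Word S} (h : ¬ (u.1 ++ v.1).IsChain (fun a b => a.1 ≠ b.1)) :
    cat (Finsupp.single u 1) (Finsupp.single v 1) = 0 := by
  simp [cat, h]

theorem cat_empty_left (x : FreeProd S) : cat (Finsupp.single (Word.empty S) 1) x = x := by
  have : cat (Finsupp.single (Word.empty S) 1) = (LinearMap.id : FreeProd S →ₗ[ℂ] _) := by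
    ext v : 2
    simp only [LinearMap.comp_apply, Finsupp.lsingle_apply, LinearMap.id_apply]
    rw [cat_single (by simpa [Word.empty] using v.2)]
    rfl
  rw [this, LinearMap.id_apply]

theorem flip_cat (x y : FreeProd S) : flip S (cat x y) = cat (flip S y) (flip S x) := by
  have : (cat (S := S)).compr₂ (flip S) = (cat.compl₁₂ (flip S) (flip S)).flip := by
    ext u v : 4
    simp only [LinearMap.comp_apply, Finsupp.lsingle_apply, LinearMap.compr₂_apply,
      LinearMap.flip_apply, LinearMap.compl₁₂_apply, flip_single]
    by_cases h : (u.1 ++ v.1).IsChain (fun a b => a.1 ≠ b.1)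
    · have h' : (v.reverse.1 ++ u.reverse.1).IsChain (fun a b => a.1 ≠ b.1) := by
        have := (Word.reverse ⟨_, h⟩).2
        simpa [Word.reverse] using this
      rw [cat_single h, cat_single h', flip_single]
      congr 1
      simp [Word.reverse]
    · have h' : ¬ (v.reverse.1 ++ u.reverse.1).IsChain (fun a b => a.1 ≠ b.1) := by
        intro h'
        apply h
        have := (Word.reverse ⟨_, h'⟩).2
        simpa [Word.reverse] using this
      rw [cat_single_of_not h, cat_single_of_not h', map_zero]
  exact LinearMap.congr_fun₂ this x y

/-- A left operator acts on the first factor of a concatenation. -/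
theorem leftRep_cat (j : ι) (T : Module.End ℂ (Pointed (S j))) {u v : Word S}
    (huv : (u.1 ++ v.1).IsChain (fun a b => a.1 ≠ b.1))
    (h : u.1 ≠ [] ∨ ∀ a ∈ v.1.head?, a.1 ≠ j) :
    leftRep j T (cat (Finsupp.single u 1) (Finsupp.single v 1)) =
      cat (leftRep j T (Finsupp.single u 1)) (Finsupp.single v 1) := by
  obtain ⟨t, o, rfl⟩ := exists_eq_glue j u
  have hchain : (t.1.1 ++ v.1).IsChain (fun a b => a.1 ≠ b.1) := by
    cases o with
    | none => exact huv
    | some s => exact (List.isChain_cons.1 huv).2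
  have hhead : ∀ a ∈ (t.1.1 ++ v.1).head?, a.1 ≠ j := by
    cases o with
    | none =>
      intro a ha
      rcases ht : t.1.1 with - | ⟨b, t'⟩
      · rw [ht] at ha
        exact (h.resolve_left (fun h => h ht)) a ha
      · refine t.2 a ?_
        rw [ht] at ha ⊢
        exact ha
    | some s => exact fun a ha => ((List.isChain_cons.1 huv).1 a ha).symm
  have hglue : ∀ o', cat (Finsupp.single (glue j t o') 1) (Finsupp.single v 1) =
      Finsupp.single (glue j ⟨⟨_, hchain⟩, hhead⟩ o') 1 := by
    intro o'
    cases o' with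
    | none => exact cat_single (u := glue j t none) hchain
    | some s =>
      exact cat_single (u := glue j t (some s))
        (List.isChain_cons.2 ⟨fun a ha => (hhead a ha).symm, hchain⟩)
  have hlin : ∀ x : Pointed (S j), cat (Finsupp.mapDomain (glue j t) x) (Finsupp.single v 1) =
      Finsupp.mapDomain (glue j ⟨⟨_, hchain⟩, hhead⟩) x := by
    intro x
    have : cat.flip (Finsupp.single v 1) ∘ₗ Finsupp.lmapDomain ℂ ℂ (glue j t) =
        Finsupp.lmapDomain ℂ ℂ (glue j ⟨⟨_, hchain⟩, hhead⟩) := by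
      ext o' : 2
      simp [hglue, Finsupp.mapDomain_single]
    exact LinearMap.congr_fun this x
  rw [hglue, leftRep_single_glue, leftRep_single_glue, hlin]

/-- A right operator acts on the second factor of a concatenation. -/
theorem rightRep_cat (j : ι) (T : Module.End ℂ (Pointed (S j))) {u v : Word S}
    (huv : (u.1 ++ v.1).IsChain (fun a b => a.1 ≠ b.1))
    (h : v.1 ≠ [] ∨ ∀ a ∈ u.1.getLast?, a.1 ≠ j) :
    rightRep j T (cat (Finsupp.single u 1) (Finsupp.single v 1)) =
      cat (Finsupp.single u 1) (rightRep j T (Finsupp.single v 1)) := by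
  change flip S (leftRep j T (flip S _)) = cat _ (flip S (leftRep j T (flip S _)))
  rw [flip_cat, flip_single, flip_single, leftRep_cat, flip_cat, flip_single,
    Word.reverse_reverse]
  · have := (Word.reverse ⟨_, huv⟩).2
    simpa [Word.reverse] using this
  · simpa [Word.reverse] using h

/-! ### Words that start or end with a letter of a given index -/

/-- The span of the words with a given property. -/
def wordSpan (P : Word S → Prop) : Submodule ℂ (FreeProd S) :=
  Submodule.span ℂ {x | ∃ w, P w ∧ x = Finsupp.single w 1}

theorem single_mem_wordSpan {P : Word S → Prop} {w : Word S} (h : P w) :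
    Finsupp.single w 1 ∈ wordSpan P := Submodule.subset_span ⟨w, h, rfl⟩

/-- The word does not start with a letter of index `k`. -/
def StartsNot (k : ι) (w : Word S) : Prop := ∀ a ∈ w.1.head?, a.1 ≠ k

/-- The word does not end with a letter of index `k`. -/
def EndsNot (k : ι) (w : Word S) : Prop := ∀ a ∈ w.1.getLast?, a.1 ≠ k

/-- The word ends with a letter of index `k`. -/
def EndsIn (k : ι) (w : Word S) : Prop := ∃ a ∈ w.1.getLast?, a.1 = k

theorem EndsIn.ne_nil {k : ι} {w : Word S} (h : EndsIn k w) : w.1 ≠ [] := by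
  rintro e
  obtain ⟨a, ha, -⟩ := h
  simp [e] at ha

theorem leftRep_single_mem {P : Word S → Prop} (i : ι) (T : Module.End ℂ (Pointed (S i)))
    (t : Tail S i) (o : Option (S i)) (h : ∀ o', P (glue i t o')) :
    leftRep i T (Finsupp.single (glue i t o) 1) ∈ wordSpan P := by
  rw [leftRep_single_glue, Finsupp.mapDomain]
  refine Submodule.sum_mem _ fun o' _ => ?_
  beta_reduce
  have : (Finsupp.single (glue i t o') ((T (Finsupp.single o 1)) o') : FreeProd S) =
      ((T (Finsupp.single o 1)) o') • Finsupp.single (glue i t o') 1 := by simp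
  rw [this]
  exact Submodule.smul_mem _ _ (single_mem_wordSpan (h o'))

theorem leftRep_endsNot {k i : ι} (T : Module.End ℂ (Pointed (S i))) {w : Word S}
    (hw : EndsNot k w) (h : w.1 ≠ [] ∨ i ≠ k) :
    leftRep i T (Finsupp.single w 1) ∈ wordSpan (EndsNot k) := by
  obtain ⟨⟨⟨t, htc⟩, ht⟩, o, rfl⟩ := exists_eq_glue i w
  refine leftRep_single_mem i T _ o fun o' => ?_
  rcases List.eq_nil_or_concat t with rfl | ⟨t, a, rfl⟩
  · have hik : i ≠ k := by
      cases o with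
      | none => simpa [glue] using h
      | some s => exact hw ⟨i, s⟩ (by simp [glue])
    cases o' <;> simp [EndsNot, glue, hik]
  · have : ∀ o'', EndsNot k (glue i ⟨⟨t.concat a, htc⟩, ht⟩ o'') ↔ a.1 ≠ k := by
      intro o''
      cases o'' <;> simp [EndsNot, glue, List.getLast?_cons]
    rw [this] at hw ⊢
    exact hw

theorem leftRep_endsIn_or {k i : ι} (T : Module.End ℂ (Pointed (S i))) {w : Word S}
    (hw : EndsIn k w) :
    leftRep i T (Finsupp.single w 1) ∈ wordSpan fun w => (w.1 = [] ∧ i = k) ∨ EndsIn k w := by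
  obtain ⟨⟨⟨t, htc⟩, ht⟩, o, rfl⟩ := exists_eq_glue i w
  refine leftRep_single_mem i T _ o fun o' => ?_
  rcases List.eq_nil_or_concat t with rfl | ⟨t, a, rfl⟩
  · have hik : i = k := by
      obtain ⟨a, ha, rfl⟩ := hw
      cases o with
      | none => simp [glue] at ha
      | some s =>
        simp [glue] at ha
        simp [← ha]
    cases o' <;> simp [EndsIn, glue, hik]
  · have : ∀ o'', EndsIn k (glue i ⟨⟨t.concat a, htc⟩, ht⟩ o'') ↔ a.1 = k := by
      intro o''
      cases o'' <;> simp [EndsIn, glue, List.getLast?_cons]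
    rw [this] at hw ⊢
    exact Or.inr hw

theorem rightRep_startsNot {k j : ι} (hj : j ≠ k) (T : Module.End ℂ (Pointed (S j)))
    {x : FreeProd S} (hx : x ∈ wordSpan (StartsNot k)) :
    rightRep j T x ∈ wordSpan (StartsNot k) := by
  have hflip : ∀ x ∈ wordSpan (EndsNot (S := S) k), flip S x ∈ wordSpan (StartsNot k) := by
    intro x hx
    induction hx using Submodule.span_induction with
    | mem x hx =>
      obtain ⟨w, hw, rfl⟩ := hx
      rw [flip_single]
      exact single_mem_wordSpan (by simpa [StartsNot, EndsNot, Word.reverse] using hw)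
    | zero => simp
    | add x y _ _ hx hy => rw [map_add]; exact Submodule.add_mem _ hx hy
    | smul c x _ hx => rw [map_smul]; exact Submodule.smul_mem _ _ hx
  induction hx using Submodule.span_induction with
  | mem x hx =>
    obtain ⟨w, hw, rfl⟩ := hx
    refine hflip _ ?_
    change leftRep j T (flip S _) ∈ _
    rw [flip_single]
    exact leftRep_endsNot T (by simpa [StartsNot, EndsNot, Word.reverse] using hw) (Or.inr hj)
  | zero => simp
  | add x y _ _ hx hy => rw [map_add]; exact Submodule.add_mem _ hx hy
  | smul c x _ hx => rw [map_smul]; exact Submodule.smul_mem _ _ hx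

/-- The span of the words that contain a letter of index `k`, each cut behind such a letter. -/
def pivotSpan (S : ι → Type u) (k : ι) : Submodule ℂ (FreeProd S) :=
  Submodule.span ℂ {x | ∃ y v, EndsIn k y ∧ StartsNot k v ∧
    x = cat (Finsupp.single y 1) (Finsupp.single v 1)}

theorem cat_mem_pivotSpan {k : ι} {x y : FreeProd S} (hx : x ∈ wordSpan (EndsIn k))
    (hy : y ∈ wordSpan (StartsNot k)) : cat x y ∈ pivotSpan S k := by
  induction hx using Submodule.span_induction with
  | mem x hx =>
    obtain ⟨u, hu, rfl⟩ := hx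
    induction hy using Submodule.span_induction with
    | mem y hy =>
      obtain ⟨v, hv, rfl⟩ := hy
      exact Submodule.subset_span ⟨u, v, hu, hv, rfl⟩
    | zero => simp
    | add x y _ _ hx hy => rw [map_add]; exact Submodule.add_mem _ hx hy
    | smul c x _ hx => rw [map_smul]; exact Submodule.smul_mem _ _ hx
  | zero => simp
  | add x y _ _ hx hy => rw [map_add, LinearMap.add_apply]; exact Submodule.add_mem _ hx hy
  | smul c x _ hx => rw [map_smul, LinearMap.smul_apply]; exact Submodule.smul_mem _ _ hx

theorem isChain_append_of {k : ι} {u v : Word S} (hu : u.1 = [] ∨ EndsIn k u)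
    (hv : StartsNot k v) : (u.1 ++ v.1).IsChain (fun a b => a.1 ≠ b.1) := by
  refine List.isChain_append.2 ⟨u.2, v.2, fun a ha b hb => ?_⟩
  rcases hu with hu | ⟨a', ha', rfl⟩
  · simp [hu] at ha
  · rw [Option.mem_unique ha ha']
    exact (hv b hb).symm

theorem leftRep_cat_of_mem {k : ι} (i : ι) (T : Module.End ℂ (Pointed (S i))) {u : Word S}
    (hu : EndsIn k u) {y : FreeProd S} (hy : y ∈ wordSpan (StartsNot k)) :
    leftRep i T (cat (Finsupp.single u 1) y) = cat (leftRep i T (Finsupp.single u 1)) y := by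
  induction hy using Submodule.span_induction with
  | mem y hy =>
    obtain ⟨v, hv, rfl⟩ := hy
    exact leftRep_cat i T (isChain_append_of (Or.inr hu) hv) (Or.inl hu.ne_nil)
  | zero => simp
  | add x y _ _ hx hy => simp only [map_add, hx, hy]
  | smul c x _ hx => simp only [map_smul, hx]

theorem rightRep_cat_of_mem {k j : ι} (hj : j ≠ k) (T : Module.End ℂ (Pointed (S j)))
    {x : FreeProd S} (hx : x ∈ wordSpan fun w => w.1 = [] ∨ EndsIn k w) {v : Word S}
    (hv : StartsNot k v) :
    rightRep j T (cat x (Finsupp.single v 1)) = cat x (rightRep j T (Finsupp.single v 1)) := by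
  induction hx using Submodule.span_induction with
  | mem x hx =>
    obtain ⟨u, hu, rfl⟩ := hx
    refine rightRep_cat j T (isChain_append_of hu hv) (Or.inr fun a ha => ?_)
    rcases hu with hu | ⟨a', ha', rfl⟩
    · simp [hu] at ha
    · rw [Option.mem_unique ha ha']
      exact hj.symm
  | zero => simp
  | add x y _ _ hx hy => simp only [map_add, LinearMap.add_apply, hx, hy]
  | smul c x _ hx => simp only [map_smul, LinearMap.smul_apply, hx]

theorem wordSpan_mono {P Q : Word S → Prop} (h : ∀ w, P w → Q w) : wordSpan P ≤ wordSpan Q :=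
  Submodule.span_mono fun _ ⟨w, hw, e⟩ => ⟨w, h w hw, e⟩

theorem leftRep_mem_pivotSpan {k i : ι} (hi : i ≠ k) (T : Module.End ℂ (Pointed (S i)))
    {x : FreeProd S} (hx : x ∈ pivotSpan S k) : leftRep i T x ∈ pivotSpan S k := by
  induction hx using Submodule.span_induction with
  | mem x hx =>
    obtain ⟨u, v, hu, hv, rfl⟩ := hx
    rw [leftRep_cat_of_mem i T hu (single_mem_wordSpan hv)]
    refine cat_mem_pivotSpan (wordSpan_mono ?_ (leftRep_endsIn_or T hu)) (single_mem_wordSpan hv)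
    exact fun w hw => hw.resolve_left fun h => hi h.2
  | zero => simp
  | add x y _ _ hx hy => rw [map_add]; exact Submodule.add_mem _ hx hy
  | smul c x _ hx => rw [map_smul]; exact Submodule.smul_mem _ _ hx

theorem rightRep_mem_pivotSpan {k j : ι} (hj : j ≠ k) (T : Module.End ℂ (Pointed (S j)))
    {x : FreeProd S} (hx : x ∈ pivotSpan S k) : rightRep j T x ∈ pivotSpan S k := by
  induction hx using Submodule.span_induction with
  | mem x hx =>
    obtain ⟨u, v, hu, hv, rfl⟩ := hx
    rw [rightRep_cat_of_mem hj T (single_mem_wordSpan (Or.inr hu)) hv]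
    exact cat_mem_pivotSpan (single_mem_wordSpan hu)
      (rightRep_startsNot hj T (single_mem_wordSpan hv))
  | zero => simp
  | add x y _ _ hx hy => rw [map_add]; exact Submodule.add_mem _ hx hy
  | smul c x _ hx => rw [map_smul]; exact Submodule.smul_mem _ _ hx

/-- A letter of index `k` separates the left operators, of any index, from the right operators of
the other indices. -/
theorem leftRep_rightRep_comm {k j : ι} (hj : j ≠ k) (i : ι) (T : Module.End ℂ (Pointed (S i)))
    (T' : Module.End ℂ (Pointed (S j))) {x : FreeProd S} (hx : x ∈ pivotSpan S k) :
    leftRep i T (rightRep j T' x) = rightRep j T' (leftRep i T x) := by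
  induction hx using Submodule.span_induction with
  | mem x hx =>
    obtain ⟨u, v, hu, hv, rfl⟩ := hx
    rw [rightRep_cat_of_mem hj T' (single_mem_wordSpan (Or.inr hu)) hv,
      leftRep_cat_of_mem i T hu (rightRep_startsNot hj T' (single_mem_wordSpan hv)),
      leftRep_cat_of_mem i T hu (single_mem_wordSpan hv), rightRep_cat_of_mem hj T' _ hv]
    refine wordSpan_mono ?_ (leftRep_endsIn_or T hu)
    exact fun w hw => hw.imp_left And.left
  | zero => simp
  | add x y _ _ hx hy => simp only [map_add, hx, hy]
  | smul c x _ hx => simp only [map_smul, hx]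

theorem apply_empty_of_mem_pivotSpan {k : ι} {x : FreeProd S} (hx : x ∈ pivotSpan S k) :
    x (Word.empty S) = 0 := by
  classical
  induction hx using Submodule.span_induction with
  | mem x hx =>
    obtain ⟨u, v, hu, hv, rfl⟩ := hx
    rw [cat_single (isChain_append_of (Or.inr hu) hv), Finsupp.single_apply, if_neg]
    intro h
    have := congrArg Subtype.val h
    exact hu.ne_nil (List.append_eq_nil_iff.1 this).1
  | zero => simp
  | add x y _ _ hx hy => simp [hx, hy]
  | smul c x _ hx => simp [hx]

end FreeProductModel

/-! ### The conjugate relation for a semicircular operator on a free product -/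

section SemicircularModel

variable {ι : Type*} {S : ι → Type u}

/-- The inclusion of the space of index `k` into the free product. -/
def emb (k : ι) : Pointed (S k) →ₗ[ℂ] FreeProd S :=
  Finsupp.lmapDomain ℂ ℂ (glue k ⟨Word.empty S, by simp [Word.empty]⟩)

theorem emb_single (k : ι) (o : Option (S k)) :
    emb k (Finsupp.single o 1) =
      (Finsupp.single (glue k ⟨Word.empty S, by simp [Word.empty]⟩ o) 1 : FreeProd S) := by
  simp [emb, Finsupp.mapDomain_single]

theorem leftRep_emb (k : ι) (T : Module.End ℂ (Pointed (S k))) (x : Pointed (S k)) :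
    leftRep k T (emb k x) = (emb k (T x) : FreeProd S) :=
  leftRep_mapDomain_glue k T _ x

theorem emb_apply_empty (k : ι) (x : Pointed (S k)) :
    (emb k x : FreeProd S) (Word.empty S) = x none := by
  have hinj : Function.Injective
      (glue (S := S) k ⟨Word.empty S, by simp [Word.empty]⟩) := by
    intro o o' h
    have := congrArg (split k) h
    rw [split_glue, split_glue] at this
    exact congrArg Prod.fst this
  exact Finsupp.mapDomain_apply hinj x none

theorem isChain_append_glue {k : ι} {u : Word S} (hu : EndsNot k u) (o : Option (S k)) :
    (u.1 ++ (glue k (⟨Word.empty S, by simp [Word.empty]⟩ : Tail S k) o).1).IsChain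
      (fun a b => a.1 ≠ b.1) := by
  refine List.isChain_append.2 ⟨u.2, (glue k _ o).2, fun a ha b hb => ?_⟩
  cases o with
  | none => simp [glue, Word.empty] at hb
  | some s =>
    simp [glue, Word.empty] at hb
    subst hb
    exact hu a ha

theorem leftRep_cat_emb {k i : ι} (T : Module.End ℂ (Pointed (S i))) {u : Word S}
    (hu : EndsNot k u) (h : u.1 ≠ [] ∨ i ≠ k) (x : Pointed (S k)) :
    leftRep i T (cat (Finsupp.single u 1) (emb k x)) =
      cat (leftRep i T (Finsupp.single u 1)) (emb k x) := by
  have : leftRep i T ∘ₗ cat (Finsupp.single u 1) ∘ₗ emb k =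
      cat (leftRep i T (Finsupp.single u 1)) ∘ₗ emb k := by
    ext o : 2
    simp only [LinearMap.comp_apply, Finsupp.lsingle_apply, emb_single]
    refine leftRep_cat i T (isChain_append_glue hu o) (h.imp_right fun hik a ha => ?_)
    cases o with
    | none => simp [glue, Word.empty] at ha
    | some s =>
      simp [glue, Word.empty] at ha
      subst ha
      exact hik.symm
  exact LinearMap.congr_fun this x

theorem cat_emb_apply_empty {k : ι} {u : Word S} (hu : EndsNot k u) (h : u.1 ≠ [])
    (x : Pointed (S k)) : cat (Finsupp.single u 1) (emb k x) (Word.empty S) = 0 := by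
  classical
  have : Finsupp.lapply (Word.empty S) ∘ₗ cat (Finsupp.single u 1) ∘ₗ emb k = 0 := by
    ext o : 2
    simp only [LinearMap.comp_apply, Finsupp.lsingle_apply, emb_single]
    rw [cat_single (isChain_append_glue hu o), Finsupp.lapply_apply, Finsupp.single_apply, if_neg]
    · simp
    · intro h'
      exact h (List.append_eq_nil_iff.1 (congrArg Subtype.val h')).1
  exact LinearMap.congr_fun this x

theorem cat_emb_mem_pivotSpan {k : ι} {u : Word S} (hu : EndsNot k u) {x : Pointed (S k)}
    (hx : x none = 0) : cat (Finsupp.single u 1) (emb k x) ∈ pivotSpan S k := by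
  have hsum : x = ∑ o ∈ x.support, x o • Finsupp.single o 1 := by
    conv_lhs => rw [← Finsupp.sum_single x]
    simp [Finsupp.sum]
  rw [hsum, map_sum, map_sum]
  refine Submodule.sum_mem _ fun o ho => ?_
  rw [map_smul, map_smul]
  refine Submodule.smul_mem _ _ ?_
  cases o with
  | none => exact absurd hx (Finsupp.mem_support_iff.1 ho)
  | some s =>
    rw [emb_single, cat_single (isChain_append_glue hu (some s))]
    refine Submodule.subset_span ⟨⟨_, isChain_append_glue hu (some s)⟩, Word.empty S, ?_, ?_, ?_⟩
    · exact ⟨⟨k, s⟩, by simp [glue, Word.empty], rfl⟩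
    · simp [StartsNot, Word.empty]
    · rw [cat_single]
      · simp [Word.empty]
      · simpa [Word.empty] using isChain_append_glue hu (some s)

/-- The operators on the side `s` of the indices other than `k`. -/
def otherOps (S : ι → Type u) (s : Side) (k : ι) : Subalgebra ℂ (Module.End ℂ (FreeProd S)) :=
  Algebra.adjoin ℂ {M | ∃ i, i ≠ k ∧ ∃ T, M = sideRep s i T}

/-- Relation between the vectors `x = u · f n` and their images `u · f (n + 1)` under a right
creation operator, where `u` does not end with a letter of index `k`. -/
def creationRel {k : ι} (f : ℕ → Pointed (S k)) : Submodule ℂ (FreeProd S × FreeProd S) :=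
  Submodule.span ℂ {p | ∃ u, EndsNot k u ∧ ∃ n,
    p = (cat (Finsupp.single u 1) (emb k (f n)), cat (Finsupp.single u 1) (emb k (f (n + 1))))}

theorem cat_mem_creationRel {k : ι} (f : ℕ → Pointed (S k)) (n : ℕ) {y : FreeProd S}
    (hy : y ∈ wordSpan (EndsNot k)) :
    (cat y (emb k (f n)), cat y (emb k (f (n + 1)))) ∈ creationRel f := by
  induction hy using Submodule.span_induction with
  | mem y hy =>
    obtain ⟨u, hu, rfl⟩ := hy
    exact Submodule.subset_span ⟨u, hu, n, rfl⟩
  | zero =>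
    simp only [map_zero, LinearMap.zero_apply]
    exact Submodule.zero_mem _
  | add x y _ _ hx hy => simpa using Submodule.add_mem _ hx hy
  | smul c x _ hx => simpa using Submodule.smul_mem _ c hx

theorem leftRep_mem_creationRel {k i : ι} (hi : i ≠ k) (f : ℕ → Pointed (S k))
    (T : Module.End ℂ (Pointed (S i))) {p : FreeProd S × FreeProd S} (hp : p ∈ creationRel f) :
    (leftRep i T p.1, leftRep i T p.2) ∈ creationRel f := by
  induction hp using Submodule.span_induction with
  | mem p hp =>
    obtain ⟨u, hu, n, rfl⟩ := hp
    rw [leftRep_cat_emb T hu (Or.inr hi), leftRep_cat_emb T hu (Or.inr hi)]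
    exact cat_mem_creationRel f n (leftRep_endsNot T hu (Or.inr hi))
  | zero =>
    simp only [Prod.fst_zero, Prod.snd_zero, map_zero]
    exact Submodule.zero_mem _
  | add x y _ _ hx hy => simpa using Submodule.add_mem _ hx hy
  | smul c x _ hx => simpa using Submodule.smul_mem _ c hx

theorem mem_creationRel_of_mem_otherOps {k : ι} (f : ℕ → Pointed (S k))
    {M : Module.End ℂ (FreeProd S)} (hM : M ∈ otherOps S .left k)
    {p : FreeProd S × FreeProd S} (hp : p ∈ creationRel f) :
    (M p.1, M p.2) ∈ creationRel f := by
  induction hM using Algebra.adjoin_induction generalizing p with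
  | mem M hM =>
    obtain ⟨i, hi, T, rfl⟩ := hM
    exact leftRep_mem_creationRel hi f T hp
  | algebraMap c => exact Submodule.smul_mem _ c hp
  | add M M' _ _ h h' => exact Submodule.add_mem _ (h hp) (h' hp)
  | mul M M' _ _ h h' => exact h (h' hp)

theorem mem_pivotSpan_of_mem_otherOps {k : ι} {s : Side} {M : Module.End ℂ (FreeProd S)}
    (hM : M ∈ otherOps S s k) {x : FreeProd S} (hx : x ∈ pivotSpan S k) :
    M x ∈ pivotSpan S k := by
  induction hM using Algebra.adjoin_induction generalizing x with
  | mem M hM =>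
    obtain ⟨i, hi, T, rfl⟩ := hM
    cases s
    · exact leftRep_mem_pivotSpan hi T hx
    · exact rightRep_mem_pivotSpan hi T hx
  | algebraMap c => simpa using Submodule.smul_mem _ c hx
  | add M M' _ _ h h' => simpa using Submodule.add_mem _ (h hx) (h' hx)
  | mul M M' _ _ h h' => exact h (h' hx)

theorem leftRep_comm_of_mem_otherOps {k : ι} (i : ι) (T : Module.End ℂ (Pointed (S i)))
    {M : Module.End ℂ (FreeProd S)} (hM : M ∈ otherOps S .right k) {x : FreeProd S}
    (hx : x ∈ pivotSpan S k) : leftRep i T (M x) = M (leftRep i T x) := by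
  induction hM using Algebra.adjoin_induction generalizing x with
  | mem M hM =>
    obtain ⟨j, hj, T', rfl⟩ := hM
    exact leftRep_rightRep_comm hj i T T' hx
  | algebraMap c => simp
  | add M M' _ _ h h' => simp [h hx, h' hx]
  | mul M M' _ hM' h h' =>
    rw [Module.End.mul_apply, Module.End.mul_apply, h (mem_pivotSpan_of_mem_otherOps hM' hx),
      h' hx]

theorem comm_of_mem_otherOps {k : ι} {M M' : Module.End ℂ (FreeProd S)}
    (hM : M ∈ otherOps S .left k) (hM' : M' ∈ otherOps S .right k) {x : FreeProd S}
    (hx : x ∈ pivotSpan S k) : M (M' x) = M' (M x) := by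
  induction hM using Algebra.adjoin_induction generalizing x with
  | mem M hM =>
    obtain ⟨i, hi, T, rfl⟩ := hM
    exact leftRep_comm_of_mem_otherOps i T hM' hx
  | algebraMap c => simp
  | add M₁ M₂ _ _ h h' => simp [h hx, h' hx]
  | mul M₁ M₂ _ hM₂ h h' =>
    rw [Module.End.mul_apply, Module.End.mul_apply, h' hx,
      h (mem_pivotSpan_of_mem_otherOps hM₂ hx)]

variable {k : ι} {f : ℕ → Pointed (S k)} {T : Module.End ℂ (Pointed (S k))} {v : ℂ}

theorem snd_mem_pivotSpan (hf : ∀ n, f (n + 1) none = 0) {p : FreeProd S × FreeProd S}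
    (hp : p ∈ creationRel f) : p.2 ∈ pivotSpan S k := by
  induction hp using Submodule.span_induction with
  | mem p hp =>
    obtain ⟨u, hu, n, rfl⟩ := hp
    exact cat_emb_mem_pivotSpan hu (hf n)
  | zero => exact Submodule.zero_mem _
  | add x y _ _ hx hy => exact Submodule.add_mem _ hx hy
  | smul c x _ hx => exact Submodule.smul_mem _ _ hx

theorem smul_pair_mem {M N : Type*} [AddCommMonoid M] [Module ℂ M] [AddCommMonoid N] [Module ℂ N]
    {P : Submodule ℂ (M × N)} (c : ℂ) {x : M} {y : N} (h : (x, y) ∈ P) : (c • x, c • y) ∈ P :=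
  P.smul_mem c h

/-- The commutation relation between the semicircular operator and the right creation operator. -/
theorem pivot_mem_creationRel (h0 : f 0 = Finsupp.single none 1) (h1 : T (f 0) = f 1)
    (hT : ∀ n, T (f (n + 1)) = f (n + 2) + v • f n) (hf : ∀ n, f (n + 1) none = 0)
    {p : FreeProd S × FreeProd S} (hp : p ∈ creationRel f) :
    (leftRep k T p.1, leftRep k T p.2 -
      (v * p.1 (Word.empty S)) • Finsupp.single (Word.empty S) 1) ∈ creationRel f := by
  induction hp using Submodule.span_induction with
  | mem p hp =>
    obtain ⟨u, hu, n, rfl⟩ := hp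
    by_cases hnil : u.1 = []
    · obtain rfl : u = Word.empty S := Subtype.ext hnil
      have hmem : ∀ n, (emb k (f n), emb k (f (n + 1))) ∈ creationRel f := fun n => by
        have := cat_mem_creationRel f n (single_mem_wordSpan hu)
        simpa only [cat_empty_left] using this
      simp only [cat_empty_left, leftRep_emb, emb_apply_empty]
      rcases n with - | n
      · have hΩ : emb k (f 0) = Finsupp.single (Word.empty S) 1 := by
          rw [h0, emb_single]
          rfl
        have h0' : f 0 none = 1 := by simp [h0]
        rw [h0', mul_one, ← hΩ, hT 0, h1, map_add, map_smul, add_sub_cancel_right]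
        exact hmem 1
      · rw [hf n, mul_zero, zero_smul, sub_zero, hT, hT, map_add, map_smul, map_add, map_smul]
        exact Submodule.add_mem _ (hmem (n + 2)) (Submodule.smul_mem _ v (hmem n))
    · simp only [leftRep_cat_emb T hu (Or.inl hnil), cat_emb_apply_empty hu hnil, mul_zero,
        zero_smul, sub_zero]
      exact cat_mem_creationRel f n (leftRep_endsNot T hu (Or.inl hnil))
  | zero =>
    simp only [Prod.fst_zero, Prod.snd_zero, map_zero, Finsupp.coe_zero, Pi.zero_apply, mul_zero,
      zero_smul, sub_zero]
    exact Submodule.zero_mem _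
  | add x y _ _ hx hy =>
    convert Submodule.add_mem _ hx hy using 1
    ext1
    · simp
    · simp only [Prod.snd_add, Prod.fst_add, map_add, Finsupp.coe_add, Pi.add_apply, Prod.mk_add_mk]
      module
  | smul c x _ hx =>
    have e : (leftRep k T (c • x.1), leftRep k T (c • x.2) -
        (v * (c • x.1) (Word.empty S)) • Finsupp.single (Word.empty S) 1) =
        (c • leftRep k T x.1, c • (leftRep k T x.2 -
          (v * x.1 (Word.empty S)) • Finsupp.single (Word.empty S) 1)) := by
      rw [map_smul, map_smul, Finsupp.smul_apply, smul_sub, smul_smul, smul_eq_mul, mul_left_comm]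
    change (_, _) ∈ _
    rw [Prod.smul_fst, Prod.smul_snd, e]
    exact smul_pair_mem c hx

theorem oppProd_mem {B : Type*} [Semiring B] [Algebra ℂ B] {P Q : Subalgebra ℂ B} (X : B)
    {w : List (Letter B)} (hw : ∀ a ∈ w, a.Mem (P : Set B) Q) : oppProd X w ∈ Q := by
  refine Subalgebra.list_prod_mem _ fun b hb => ?_
  simp only [List.mem_map, List.mem_filter] at hb
  obtain ⟨a, ⟨ha, hs⟩, rfl⟩ := hb
  have := hw a ha
  cases a
  · simp [Letter.isSame] at hs
  · simp [Letter.isSame] at hs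
  · exact this

/-- Moving the pivot at the end of a word to the front: the terms in which it is contracted with
another pivot make up the difference quotient, and the remaining term `g` is obtained from the left
letters by a right creation operator. -/
theorem exists_creationRel (h0 : f 0 = Finsupp.single none 1) (h1 : T (f 0) = f 1)
    (hT : ∀ n, T (f (n + 1)) = f (n + 2) + v • f n) (hf : ∀ n, f (n + 1) none = 0)
    (w : List (Letter (Module.End ℂ (FreeProd S))))
    (hw : ∀ a ∈ w, a.Mem (otherOps S .left k : Set _) (otherOps S .right k)) :
    ∃ g, (sameProd (leftRep k T) w (Finsupp.single (Word.empty S) 1), g) ∈ creationRel f ∧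
      wordVal (leftRep k T) w (leftRep k T (Finsupp.single (Word.empty S) 1)) =
        oppProd (leftRep k T) w g +
          v • diff vac (leftRep k T) w (Finsupp.single (Word.empty S) 1) := by
  induction w with
  | nil =>
    have hΩ : emb k (f 0) = Finsupp.single (Word.empty S) 1 := by
      rw [h0, emb_single]
      rfl
    refine ⟨emb k (f 1), ?_, ?_⟩
    · have : EndsNot k (Word.empty S) := by simp [EndsNot, Word.empty]
      have := cat_mem_creationRel f 0 (single_mem_wordSpan this)
      rw [cat_empty_left, cat_empty_left, hΩ] at this
      exact this
    · simp only [wordVal_nil, oppProd, diff, List.filter_nil, Module.End.one_apply]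
      rw [← hΩ, leftRep_emb, h1]
      simp
  | cons a w ih =>
    obtain ⟨g, hg, he⟩ := ih fun a ha => hw a (List.mem_cons_of_mem _ ha)
    have ha := hw a List.mem_cons_self
    have hopp := oppProd_mem (leftRep k T) fun a ha => hw a (List.mem_cons_of_mem _ ha)
    have hgK := snd_mem_pivotSpan hf hg
    cases a with
    | pivot =>
      have H := pivot_mem_creationRel h0 h1 hT hf hg
      dsimp only at H
      rw [sameProd_pivot, Module.End.mul_apply]
      refine ⟨_, H, ?_⟩
      rw [oppProd_pivot, wordVal_cons, Module.End.mul_apply, he, diff, map_add, map_smul]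
      simp only [Letter.val, LinearMap.add_apply, LinearMap.smul_apply, Module.End.mul_apply,
        map_sub, map_smul, vac_apply]
      rw [leftRep_comm_of_mem_otherOps k T hopp hgK]
      module
    | same b =>
      have H := mem_creationRel_of_mem_otherOps f ha hg
      dsimp only at H
      rw [sameProd_same, Module.End.mul_apply]
      refine ⟨_, H, ?_⟩
      rw [oppProd_same, wordVal_cons, Module.End.mul_apply, he, diff, map_add, map_smul]
      simp only [Letter.val, Module.End.mul_apply]
      rw [comm_of_mem_otherOps ha hopp hgK]
    | opp b =>
      refine ⟨g, hg, ?_⟩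
      rw [oppProd_opp, wordVal_cons, Module.End.mul_apply, he, diff, map_add, map_smul]
      rfl

theorem vac_wordVal_mul_leftRep (h0 : f 0 = Finsupp.single none 1) (h1 : T (f 0) = f 1)
    (hT : ∀ n, T (f (n + 1)) = f (n + 2) + v • f n) (hf : ∀ n, f (n + 1) none = 0)
    (w : List (Letter (Module.End ℂ (FreeProd S))))
    (hw : ∀ a ∈ w, a.Mem (otherOps S .left k : Set _) (otherOps S .right k)) :
    vac (wordVal (leftRep k T) w * leftRep k T) = v * vac (diff vac (leftRep k T) w) := by
  obtain ⟨g, hg, he⟩ := exists_creationRel h0 h1 hT hf w hw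
  rw [vac_apply, Module.End.mul_apply, he, Finsupp.add_apply, apply_empty_of_mem_pivotSpan
    (mem_pivotSpan_of_mem_otherOps (oppProd_mem _ hw) (snd_mem_pivotSpan hf hg)), zero_add]
  rfl

theorem flipConj_mem_otherOps {s : Side} {M : Module.End ℂ (FreeProd S)}
    (hM : M ∈ otherOps S s k) : flipConj M ∈ otherOps S s.other k := by
  induction hM using Algebra.adjoin_induction with
  | mem M hM =>
    obtain ⟨i, hi, T, rfl⟩ := hM
    rw [flipConj_sideRep]
    exact Algebra.subset_adjoin ⟨i, hi, T, rfl⟩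
  | algebraMap c =>
    rw [AlgHom.commutes]
    exact Subalgebra.algebraMap_mem _ c
  | add M M' _ _ h h' => rw [map_add]; exact Subalgebra.add_mem _ h h'
  | mul M M' _ _ h h' => rw [map_mul]; exact Subalgebra.mul_mem _ h h'

/-- The conjugate relation in the vacuum state of a free product, for an operator `T` of the factor
of index `k` that acts on orthogonal vectors `f n` as a semicircular operator of variance `v`. -/
theorem vac_wordVal_mul_sideRep (h0 : f 0 = Finsupp.single none 1) (h1 : T (f 0) = f 1)
    (hT : ∀ n, T (f (n + 1)) = f (n + 2) + v • f n) (hf : ∀ n, f (n + 1) none = 0) (s : Side)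
    (w : List (Letter (Module.End ℂ (FreeProd S))))
    (hw : ∀ a ∈ w, a.Mem (otherOps S s k : Set _) (otherOps S s.other k)) :
    vac (wordVal (sideRep s k T) w * sideRep s k T) =
      v * vac (diff vac (sideRep s k T) w) := by
  cases s with
  | left => exact vac_wordVal_mul_leftRep h0 h1 hT hf w hw
  | right =>
    have hX : flipConj (sideRep .right k T) = leftRep k T := flipConj_sideRep .right k T
    have key := vac_wordVal_mul_leftRep h0 h1 hT hf (w.map (Letter.map flipConj)) fun a ha => by
      obtain ⟨b, hb, rfl⟩ := List.mem_map.1 ha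
      have := hw b hb
      cases b with
      | pivot => trivial
      | same b => exact flipConj_mem_otherOps (s := .right) this
      | opp b => exact flipConj_mem_otherOps (s := .left) this
    rw [← hX, wordVal_map flipConj, diff_map flipConj, ← map_mul, vac_flipConj, vac_flipConj] at key
    simpa only [vac_flipConj] using key

end SemicircularModel

/-! ### The semicircular distribution and its orthogonal polynomials -/

/-- The orthogonal polynomials (Chebyshev polynomials of the second kind, rescaled and monic) of the
semicircular distribution of variance `v`, evaluated at `x`. -/
def orthoSeq {B : Type*} [Ring B] [Algebra ℂ B] (v : ℂ) (x : B) : ℕ → B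
  | 0 => 1
  | 1 => x
  | n + 2 => x * orthoSeq v x (n + 1) - v • orthoSeq v x n

theorem map_orthoSeq {B C : Type*} [Ring B] [Algebra ℂ B] [Ring C] [Algebra ℂ C]
    (f : B →ₐ[ℂ] C) (v : ℂ) (x : B) (n : ℕ) : f (orthoSeq v x n) = orthoSeq v (f x) n := by
  induction n using Nat.twoStepInduction with
  | zero => simp [orthoSeq]
  | one => simp [orthoSeq]
  | more n h h' => simp [orthoSeq, h, h']

open Polynomial in
/-- The orthogonal polynomials span all polynomials. -/
theorem linearMap_ext_orthoSeq (v : ℂ) {L L' : ℂ[X] →ₗ[ℂ] ℂ}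
    (h : ∀ n, L (orthoSeq v X n) = L' (orthoSeq v X n)) : L = L' := by
  have hX : ∀ p ∈ Submodule.span ℂ (Set.range (orthoSeq v (X : ℂ[X]))),
      X * p ∈ Submodule.span ℂ (Set.range (orthoSeq v (X : ℂ[X]))) := by
    intro p hp
    induction hp using Submodule.span_induction with
    | mem p hp =>
      obtain ⟨n, rfl⟩ := hp
      rcases n with - | n
      · exact Submodule.subset_span ⟨1, by simp [orthoSeq]⟩
      · have : X * orthoSeq v (X : ℂ[X]) (n + 1) = orthoSeq v X (n + 2) + v • orthoSeq v X n := by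
          simp [orthoSeq]
        rw [this]
        exact Submodule.add_mem _ (Submodule.subset_span ⟨_, rfl⟩)
          (Submodule.smul_mem _ _ (Submodule.subset_span ⟨_, rfl⟩))
    | zero => simp
    | add x y _ _ hx hy => rw [mul_add]; exact Submodule.add_mem _ hx hy
    | smul c x _ hx => rw [mul_smul_comm]; exact Submodule.smul_mem _ _ hx
  have hpow : ∀ k : ℕ, (X : ℂ[X]) ^ k ∈ Submodule.span ℂ (Set.range (orthoSeq v (X : ℂ[X]))) := by
    intro k
    induction k with
    | zero => exact Submodule.subset_span ⟨0, by simp [orthoSeq]⟩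
    | succ k ih => rw [pow_succ']; exact hX _ ih
  have heq : Set.EqOn L L' (Submodule.span ℂ (Set.range (orthoSeq v (X : ℂ[X])))) :=
    LinearMap.eqOn_span (by rintro _ ⟨n, rfl⟩; exact h n)
  refine Polynomial.lhom_ext' fun k => LinearMap.ext_ring ?_
  simp only [LinearMap.comp_apply, ← X_pow_eq_monomial]
  exact heq (hpow k)

open Polynomial in
/-- Integration of polynomials against the semicircular distribution of variance `v`. -/
def semicircleFunctional (v : ℝ) : ℂ[X] →ₗ[ℂ] ℂ where
  toFun p := ∫ t in (-(2 * √v))..(2 * √v),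
    p.eval (t : ℂ) * ((√(4 * v - t ^ 2) / (2 * Real.pi * v) : ℝ) : ℂ)
  map_add' p q := by
    simp_rw [eval_add, add_mul]
    exact intervalIntegral.integral_add (Continuous.intervalIntegrable (by fun_prop) _ _)
      (Continuous.intervalIntegrable (by fun_prop) _ _)
  map_smul' c p := by
    simp_rw [eval_smul, smul_eq_mul, mul_assoc]
    exact intervalIntegral.integral_const_mul _ _

open Polynomial in
theorem semicircleFunctional_X_pow (v : ℝ) (k : ℕ) : semicircleFunctional v (X ^ k) =
    ((∫ t in (-(2 * √v))..(2 * √v), t ^ k * (√(4 * v - t ^ 2) / (2 * Real.pi * v)) : ℝ) : ℂ) := by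
  rw [← intervalIntegral.integral_ofReal]
  simp [semicircleFunctional]

/-- The orthogonal polynomials at `2 √v cos θ`, as Chebyshev polynomials. -/
theorem orthoSeq_cos_mul_sin {v : ℝ} (hv : 0 < v) (θ : ℝ) (n : ℕ) :
    orthoSeq (v : ℂ) ((2 * √v * Real.cos θ : ℝ) : ℂ) n * (Real.sin θ : ℂ) =
      ((√v ^ n * Real.sin ((n + 1) * θ) : ℝ) : ℂ) := by
  induction n using Nat.twoStepInduction with
  | zero => simp [orthoSeq]
  | one =>
    norm_num [orthoSeq, Complex.sin_two_mul]
    ring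
  | more n h h' =>
    have hs : (√v : ℝ) ^ 2 = v := Real.sq_sqrt hv.le
    have e : Real.sin ((n + 1) * θ) = 2 * Real.cos θ * Real.sin ((n + 2) * θ) -
        Real.sin ((n + 3) * θ) := by
      have e1 : (n + 1) * θ = (n + 2) * θ - θ := by ring
      have e3 : (n + 3) * θ = (n + 2) * θ + θ := by ring
      rw [e1, e3, Real.sin_sub, Real.sin_add]
      ring
    rw [orthoSeq, sub_mul, mul_assoc, h', smul_mul_assoc, h, smul_eq_mul]
    have e2 : ((n + 1 : ℕ) : ℝ) + 1 = n + 2 := by push_cast; ring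
    have e4 : ((n + 2 : ℕ) : ℝ) + 1 = n + 3 := by push_cast; ring
    have hreal : 2 * √v * Real.cos θ * (√v ^ (n + 1) * Real.sin (((n + 1 : ℕ) + 1) * θ)) -
        v * (√v ^ n * Real.sin ((n + 1) * θ)) =
        √v ^ (n + 2) * Real.sin (((n + 2 : ℕ) + 1) * θ) := by
      rw [e2, e4, e]
      linear_combination (√v ^ n * (2 * Real.cos θ * Real.sin ((n + 2) * θ) -
        Real.sin ((n + 3) * θ))) * hs
    rw [← hreal]
    push_cast
    ring

theorem integral_sin_mul_sin (n : ℕ) :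
    ∫ θ in (0 : ℝ)..Real.pi, Real.sin ((n + 1) * θ) * Real.sin θ =
      if n = 0 then Real.pi / 2 else 0 := by
  split_ifs with hn
  · subst hn
    simp only [Nat.cast_zero, zero_add, one_mul, ← sq]
    rw [integral_sin_sq]
    simp
  · have hc : ∀ c : ℕ, c ≠ 0 → ∫ θ in (0 : ℝ)..Real.pi, Real.cos (c * θ) = 0 := by
      intro c hc
      have : (c : ℝ) ≠ 0 := Nat.cast_ne_zero.2 hc
      rw [intervalIntegral.integral_comp_mul_left (fun x => Real.cos x) this, integral_cos]
      simp
    have e : ∀ θ : ℝ, Real.sin ((n + 1) * θ) * Real.sin θ =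
        (1 / 2) * (Real.cos ((n : ℕ) * θ) - Real.cos ((n + 2 : ℕ) * θ)) := by
      intro θ
      have e1 : (n : ℝ) * θ = (n + 1) * θ - θ := by ring
      have e3 : ((n + 2 : ℕ) : ℝ) * θ = (n + 1) * θ + θ := by push_cast; ring
      rw [e1, e3, Real.cos_sub, Real.cos_add]
      ring
    simp_rw [e]
    rw [intervalIntegral.integral_const_mul, intervalIntegral.integral_sub, hc n hn,
      hc (n + 2) (by omega)]
    · simp
    · exact Continuous.intervalIntegrable (by fun_prop) _ _
    · exact Continuous.intervalIntegrable (by fun_prop) _ _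

open Polynomial in
/-- The substitution `t = 2 √v cos θ` reduces the orthogonality to that of the functions
`sin ((n + 1) θ)`. -/
theorem semicircleFunctional_orthoSeq {v : ℝ} (hv : 0 < v) (n : ℕ) :
    semicircleFunctional v (orthoSeq v X n) = if n = 0 then 1 else 0 := by
  set R : ℝ := 2 * √v with hR
  have hR0 : 0 < R := by positivity
  have hR2 : R ^ 2 = 4 * v := by rw [hR, mul_pow, Real.sq_sqrt hv.le]; ring
  have heval : ∀ t : ℂ, (orthoSeq (v : ℂ) (X : ℂ[X]) n).eval t = orthoSeq (v : ℂ) t n := by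
    intro t
    have := map_orthoSeq (aeval t) (v : ℂ) (X : ℂ[X]) n
    rwa [aeval_X, coe_aeval_eq_eval] at this
  set g : ℝ → ℂ := fun t => (orthoSeq (v : ℂ) (X : ℂ[X]) n).eval (t : ℂ) *
    ((√(4 * v - t ^ 2) / (2 * Real.pi * v) : ℝ) : ℂ) with hg
  have hsub := intervalIntegral.integral_deriv_smul_comp' (a := Real.pi) (b := 0)
    (f := fun θ => R * Real.cos θ) (f' := fun θ => R * (-Real.sin θ)) (g := g)
    (fun θ _ => (Real.hasDerivAt_cos θ).const_mul R) (by fun_prop) (by fun_prop)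
  have hL : semicircleFunctional v (orthoSeq v X n) = ∫ t in (-R)..R, g t := rfl
  rw [Real.cos_pi, Real.cos_zero, mul_one, mul_neg, mul_one] at hsub
  rw [hL, ← hsub, intervalIntegral.integral_symm, ← intervalIntegral.integral_neg]
  have hint : ∀ θ ∈ Set.uIcc 0 Real.pi,
      -((R * -Real.sin θ) • (g ∘ fun θ => R * Real.cos θ) θ) =
      (((2 / Real.pi * √v ^ n) * (Real.sin ((n + 1) * θ) * Real.sin θ) : ℝ) : ℂ) := by
    intro θ hθ
    rw [Set.uIcc_of_le Real.pi_pos.le] at hθ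
    have hsin : 0 ≤ Real.sin θ := Real.sin_nonneg_of_mem_Icc hθ
    have hsq : √(4 * v - (R * Real.cos θ) ^ 2) = R * Real.sin θ := by
      rw [show 4 * v - (R * Real.cos θ) ^ 2 = (R * Real.sin θ) ^ 2 by
        rw [← hR2]; linear_combination (-(R ^ 2)) * Real.sin_sq_add_cos_sq θ]
      exact Real.sqrt_sq (by positivity)
    have key := orthoSeq_cos_mul_sin hv θ n
    rw [← hR] at key
    simp only [Function.comp_apply, hg, hsq, heval]
    have e1 : (((2 / Real.pi * √v ^ n) * (Real.sin ((n + 1) * θ) * Real.sin θ) : ℝ) : ℂ) =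
        ((√v ^ n * Real.sin ((n + 1) * θ) : ℝ) : ℂ) * ((2 / Real.pi * Real.sin θ : ℝ) : ℂ) := by
      push_cast
      ring
    have e2 : R * (R * Real.sin θ / (2 * Real.pi * v)) = 2 / Real.pi * Real.sin θ := by
      have : R * (R * Real.sin θ / (2 * Real.pi * v)) = R ^ 2 * Real.sin θ / (2 * Real.pi * v) := by
        ring
      rw [this, hR2]
      field_simp
      ring
    rw [e1, ← key, ← e2, Complex.real_smul]
    push_cast
    ring
  rw [intervalIntegral.integral_congr hint, intervalIntegral.integral_ofReal,
    intervalIntegral.integral_const_mul, integral_sin_mul_sin]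
  split_ifs with h
  · subst h
    rw [pow_zero, mul_one, div_mul_div_comm, mul_comm, div_self (by positivity)]
    simp
  · simp

section Semicircular

variable {A : Type u} [CStarAlgebra A] [PartialOrder A]

open Polynomial in
/-- The semicircular distribution is determined by the vanishing of its non-constant orthogonal
polynomials. -/
theorem isSemicircular_iff {φ : A →ₚ[ℂ] ℂ} (hφ : φ 1 = 1) {v : ℝ} (hv : 0 < v) (a : A) :
    IsSemicircular φ v a ↔ ∀ n, φ (orthoSeq v a (n + 1)) = 0 := by
  let L : ℂ[X] →ₗ[ℂ] ℂ := φ.toLinearMap ∘ₗ (aeval a).toLinearMap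
  have hL : ∀ p, L p = φ (aeval a p) := fun p => rfl
  have hLo : ∀ n, L (orthoSeq v X n) = φ (orthoSeq v a n) := fun n => by
    rw [hL, map_orthoSeq, aeval_X]
  constructor
  · intro h n
    have : L = semicircleFunctional v := by
      refine Polynomial.lhom_ext' fun k => LinearMap.ext_ring ?_
      simp only [LinearMap.comp_apply, ← X_pow_eq_monomial]
      rw [semicircleFunctional_X_pow, hL, map_pow (aeval a), aeval_X, h k]
    rw [← hLo, this, semicircleFunctional_orthoSeq hv, if_neg (Nat.succ_ne_zero n)]
  · intro h k
    have : L = semicircleFunctional v := by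
      refine linearMap_ext_orthoSeq v fun n => ?_
      rw [hLo, semicircleFunctional_orthoSeq hv]
      rcases n with - | n
      · simpa [orthoSeq] using hφ
      · simpa using h n
    rw [← semicircleFunctional_X_pow, ← this, hL, map_pow (aeval a), aeval_X]

end Semicircular

section PivotPowers

variable {B : Type*} [Ring B]

theorem sameProd_replicate (X : B) (k : ℕ) :
    sameProd X (List.replicate k .pivot) = X ^ k := by
  induction k with
  | zero => simp [sameProd]
  | succ k ih => rw [List.replicate_succ, sameProd_pivot, ih, pow_succ']

theorem oppProd_replicate (X : B) (k : ℕ) :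
    oppProd X (List.replicate k .pivot) = 1 := by
  induction k with
  | zero => rfl
  | succ k ih => rw [List.replicate_succ, oppProd_pivot, ih]

variable [Algebra ℂ B]

/-- If `X / v` satisfies the conjugate relation for the powers of `X`, then `X` is orthogonal to the
polynomials of the semicircular distribution of variance `v`: the difference quotient with one
factor integrated out maps each of them to its predecessor. -/
theorem apply_orthoSeq_eq_zero (ψ : B →ₗ[ℂ] ℂ) (hψ : ψ 1 = 1) (v : ℂ) (X : B)
    (h : ∀ k, ψ (X ^ k * X) = v * ψ (diff ψ X (List.replicate k .pivot))) (n : ℕ) :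
    ψ (orthoSeq v X (n + 1)) = 0 := by
  -- The graph of the difference quotient on polynomials in `X`.
  let Q : Submodule ℂ (B × B) := Submodule.span ℂ
    (Set.range fun k : ℕ => (X ^ k, diff ψ X (List.replicate k .pivot)))
  have hstep : ∀ p ∈ Q, (X * p.1, ψ p.1 • (1 : B) + X * p.2) ∈ Q := by
    intro p hp
    induction hp using Submodule.span_induction with
    | mem p hp =>
      obtain ⟨k, rfl⟩ := hp
      refine Submodule.subset_span ⟨k + 1, ?_⟩
      simp [List.replicate_succ, diff, sameProd_replicate, oppProd_replicate, pow_succ']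
    | zero =>
      simp only [Prod.fst_zero, Prod.snd_zero, map_zero, zero_smul, mul_zero, add_zero]
      exact Q.zero_mem
    | add x y _ _ hx hy =>
      convert Submodule.add_mem _ hx hy using 1
      ext1
      · simp [mul_add]
      · simp only [Prod.snd_add, Prod.fst_add, map_add, mul_add, add_smul]
        abel
    | smul c x _ hx =>
      convert Submodule.smul_mem _ c hx using 1
      ext1
      · simp
      · change ψ (c • x.1) • (1 : B) + X * (c • x.2) = c • (ψ x.1 • (1 : B) + X * x.2)
        rw [map_smul, mul_smul_comm, smul_add, smul_assoc]
  have hψQ : ∀ p ∈ Q, ψ (X * p.1) = v * ψ p.2 := by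
    intro p hp
    induction hp using Submodule.span_induction with
    | mem p hp =>
      obtain ⟨k, rfl⟩ := hp
      rw [← h k, ← pow_succ, ← pow_succ']
    | zero => simp
    | add x y _ _ hx hy => simp [mul_add, hx, hy]
    | smul c x _ hx => simp [hx, mul_left_comm]
  have h0 : ((orthoSeq v X 0 : B), (0 : B)) ∈ Q :=
    Submodule.subset_span ⟨0, by simp [orthoSeq, diff]⟩
  have hmain : ∀ n, (orthoSeq v X (n + 1), orthoSeq v X n) ∈ Q ∧ ψ (orthoSeq v X (n + 1)) = 0 := by
    intro n
    induction n using Nat.twoStepInduction with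
    | zero =>
      refine ⟨?_, ?_⟩
      · simpa [orthoSeq, hψ] using hstep _ h0
      · simpa [orthoSeq] using hψQ _ h0
    | one =>
      have h1 : ((orthoSeq v X 1 : B), (1 : B)) ∈ Q := by
        simpa [orthoSeq, hψ] using hstep _ h0
      have hX : ψ X = 0 := by simpa [orthoSeq] using hψQ _ h0
      refine ⟨?_, ?_⟩
      · have := Submodule.sub_mem _ (hstep _ h1) (Submodule.smul_mem _ v h0)
        simpa [orthoSeq, hX] using this
      · have := hψQ _ h1
        simp only [orthoSeq] at this
        simp [orthoSeq, this, hψ]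
    | more n ih ih' =>
      refine ⟨?_, ?_⟩
      · have := Submodule.sub_mem _ (hstep _ ih'.1) (Submodule.smul_mem _ v ih.1)
        rw [ih'.2, zero_smul, zero_add] at this
        exact this
      · have := hψQ _ ih'.1
        rw [orthoSeq, map_sub, this, map_smul, smul_eq_mul, sub_self]
  exact (hmain n).2

end PivotPowers

/-! ### Uniqueness of conjugate variables and the Cauchy-Schwarz inequality -/

section Hilbert

variable {A : Type u} [CStarAlgebra A]

/-- A star subalgebra generated by a star-closed subset of a subalgebra lies in that subalgebra. -/
theorem mem_of_mem_starAdjoin {U : Set A} (hU : ∀ a ∈ U, star a ∈ U) {C : Subalgebra ℂ A}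
    (hUC : U ⊆ C) {a : A} (ha : a ∈ StarAlgebra.adjoin ℂ U) : a ∈ C := by
  have : a ∈ (StarAlgebra.adjoin ℂ U).toSubalgebra := ha
  rw [StarAlgebra.adjoin_toSubalgebra] at this
  refine Algebra.adjoin_le ?_ this
  rintro b (hb | hb)
  · exact hUC hb
  · have := hU _ hb
    rw [star_star] at this
    exact hUC this

theorem mem_of_mem_extend {B : StarSubalgebra ℂ A} {S : Set A} (hS : ∀ a ∈ S, IsSelfAdjoint a)
    {C : Subalgebra ℂ A} (hB : (B : Set A) ⊆ C) (hSC : S ⊆ C) {a : A} (ha : a ∈ extend B S) :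
    a ∈ C := by
  have hle : extend B S ≤ StarAlgebra.adjoin ℂ ((B : Set A) ∪ S) :=
    sup_le (fun b hb => StarAlgebra.subset_adjoin ℂ _ (Or.inl hb))
      (StarAlgebra.adjoin_le fun b hb => StarAlgebra.subset_adjoin ℂ _ (Or.inr hb))
  refine mem_of_mem_starAdjoin ?_ (Set.union_subset hB hSC) (hle ha)
  rintro b (hb | hb)
  · exact Or.inl (star_mem (s := B) hb)
  · exact Or.inr ((hS b hb).star_eq.symm ▸ hb)

theorem mem_of_mem_extend_sup {B : Side → StarSubalgebra ℂ A} (s : Side) {X : A}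
    (hX : IsSelfAdjoint X) {C : Subalgebra ℂ A} (hB : (B s : Set A) ⊆ C)
    (hB' : (B s.other : Set A) ⊆ C) (hXC : X ∈ C) {a : A}
    (ha : a ∈ extend (B Side.left ⊔ B Side.right) {X}) : a ∈ C := by
  refine mem_of_mem_extend (by simpa using hX) ?_ (by simpa using hXC) ha
  intro b hb
  have hle : B Side.left ⊔ B Side.right ≤
      StarAlgebra.adjoin ℂ ((B s : Set A) ∪ B s.other) := by
    cases s
    · exact sup_le (fun b hb => StarAlgebra.subset_adjoin ℂ _ (Or.inl hb))
        (fun b hb => StarAlgebra.subset_adjoin ℂ _ (Or.inr hb))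
    · exact sup_le (fun b hb => StarAlgebra.subset_adjoin ℂ _ (Or.inr hb))
        (fun b hb => StarAlgebra.subset_adjoin ℂ _ (Or.inl hb))
  refine mem_of_mem_starAdjoin ?_ (Set.union_subset hB hB') (hle hb)
  rintro b (hb | hb)
  · exact Or.inl (star_mem (s := B s) hb)
  · exact Or.inr (star_mem (s := B s.other) hb)

theorem exists_wordVal_eq {S T : Set A} {X a : A} (ha : a ∈ Submonoid.closure (S ∪ T ∪ {X})) :
    ∃ w : List (Letter A), (∀ b ∈ w, b.Mem S T) ∧ wordVal X w = a := by
  induction ha using Submonoid.closure_induction_left with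
  | one => exact ⟨[], by simp, rfl⟩
  | mul_left x hx y _ ih =>
    obtain ⟨w, hw, rfl⟩ := ih
    obtain ⟨b, hb, rfl⟩ : ∃ b : Letter A, b.Mem S T ∧ b.val X = x := by
      rcases hx with (hx | hx) | rfl
      · exact ⟨.same x, hx, rfl⟩
      · exact ⟨.opp x, hx, rfl⟩
      · exact ⟨.pivot, trivial, rfl⟩
    refine ⟨b :: w, ?_, by simp⟩
    simpa using ⟨hb, hw⟩

variable [PartialOrder A] [StarOrderedRing A] (φ : A →ₚ[ℂ] ℂ)

theorem inner_toL2 (a b : A) : inner ℂ (toL2 φ a) (toL2 φ b) = φ (star a * b) := by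
  rw [toL2, toL2, UniformSpace.Completion.inner_coe]
  rfl

theorem toL2_smul (c : ℂ) (a : A) : toL2 φ (c • a) = c • toL2 φ a := by
  rw [toL2, map_smul, UniformSpace.Completion.coe_smul]
  rfl

theorem gnsStarAlgHom_toL2 (a b : A) : φ.gnsStarAlgHom a (toL2 φ b) = toL2 φ (a * b) := by
  change φ.gnsNonUnitalStarAlgHom a _ = _
  rw [toL2, PositiveLinearMap.gnsNonUnitalStarAlgHom_apply_coe]
  rfl

theorem vectorMoment_eq_inner (a : A) (ξ : φ.GNS) :
    vectorMoment φ a ξ = inner ℂ (toL2 φ (star a)) ξ := by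
  rw [vectorMoment, ← ContinuousLinearMap.adjoint_inner_left,
    ← ContinuousLinearMap.star_eq_adjoint, ← map_star, gnsStarAlgHom_toL2, mul_one]

theorem vectorMoment_toL2 (a b : A) : vectorMoment φ a (toL2 φ b) = φ (a * b) := by
  rw [vectorMoment_eq_inner, inner_toL2, star_star]

theorem norm_toL2_sq {a : A} (ha : IsSelfAdjoint a) : ‖toL2 φ a‖ ^ 2 = (φ (a ^ 2)).re := by
  rw [← inner_self_eq_norm_sq (𝕜 := ℂ), inner_toL2, ha.star_eq, sq]
  rfl

variable {φ}

/-- The conjugate relation determines the inner products with a dense subspace of the `L₂`-space in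
which the conjugate variables lie. -/
theorem IsConjugateVariable.unique (hφ : φ 1 = 1) {s : Side} {X : A} (hX : IsSelfAdjoint X)
    {B : Side → StarSubalgebra ℂ A} {ξ ξ' : φ.GNS} (h : IsConjugateVariable φ s X B ξ)
    (h' : IsConjugateVariable φ s X B ξ') : ξ = ξ' := by
  set U : Set A := (B s : Set A) ∪ B s.other ∪ {X} with hU
  have hspan : ∀ a ∈ Submodule.span ℂ (Submonoid.closure U : Set A),
      inner ℂ (toL2 φ 1) (φ.gnsStarAlgHom a ξ) = inner ℂ (toL2 φ 1) (φ.gnsStarAlgHom a ξ') := by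
    intro a ha
    induction ha using Submodule.span_induction with
    | mem a ha =>
      obtain ⟨w, hw, rfl⟩ := exists_wordVal_eq ha
      exact (h.conjugateRelation hφ w hw).trans (h'.conjugateRelation hφ w hw).symm
    | zero => simp
    | add x y _ _ hx hy => simp only [map_add, add_apply, inner_add_right, hx, hy]
    | smul c x _ hx => simp only [map_smul, smul_apply, inner_smul_right, hx]
  have horth : ∀ a ∈ extend (B Side.left ⊔ B Side.right) {X},
      inner ℂ (toL2 φ a) (ξ - ξ') = 0 := by
    intro a ha
    have ha' : star a ∈ Algebra.adjoin ℂ U := by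
      refine mem_of_mem_extend_sup s hX ?_ ?_ ?_ (star_mem ha)
      · exact fun b hb => Algebra.subset_adjoin (Or.inl (Or.inl hb))
      · exact fun b hb => Algebra.subset_adjoin (Or.inl (Or.inr hb))
      · exact Algebra.subset_adjoin (Or.inr rfl)
    rw [← Subalgebra.mem_toSubmodule, Algebra.adjoin_eq_span] at ha'
    have := hspan _ ha'
    rw [← vectorMoment, ← vectorMoment, vectorMoment_eq_inner, vectorMoment_eq_inner,
      star_star] at this
    rw [inner_sub_right, this, sub_self]
  have hcl : ∀ ζ ∈ L2 φ (extend (B Side.left ⊔ B Side.right) {X}), inner ℂ ζ (ξ - ξ') = 0 := by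
    intro ζ hζ
    have hclosed : IsClosed {z : φ.GNS | inner ℂ z (ξ - ξ') = 0} :=
      isClosed_eq (by fun_prop) continuous_const
    refine closure_minimal ?_ hclosed hζ
    rintro _ ⟨a, ha, rfl⟩
    exact horth a ha
  have := hcl _ h.1
  rw [← sub_eq_zero, ← inner_self_eq_zero (𝕜 := ℂ), inner_sub_left, this, hcl _ h'.1, sub_zero]

theorem IsConjugateVariable.inner_eq_one (hφ : φ 1 = 1) {s : Side} {X : A} (hX : IsSelfAdjoint X)
    {B : Side → StarSubalgebra ℂ A} {ξ : φ.GNS} (h : IsConjugateVariable φ s X B ξ) :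
    inner ℂ (toL2 φ X) ξ = 1 := by
  have := h.conjugateRelation hφ [.pivot] (by simp [Letter.Mem])
  rw [vectorMoment_eq_inner] at this
  simpa [Letter.val, hX.star_eq, diff, sameProd, oppProd, hφ] using this

end Hilbert

section CauchySchwarz

variable {H : Type*} [NormedAddCommGroup H] [InnerProductSpace ℂ H] {κ : Type*} [Fintype κ]

theorem card_sq_le_of_inner_eq_one {x ξ : κ → H} (h : ∀ i, inner ℂ (x i) (ξ i) = 1) :
    (Fintype.card κ : ℝ) ^ 2 ≤ (∑ i, ‖ξ i‖ ^ 2) * ∑ i, ‖x i‖ ^ 2 := by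
  have h1 : (Fintype.card κ : ℝ) ≤ ∑ i, ‖ξ i‖ * ‖x i‖ := by
    have : (Fintype.card κ : ℝ) = ∑ _i : κ, (1 : ℝ) := by simp
    rw [this]
    refine Finset.sum_le_sum fun i _ => ?_
    have := norm_inner_le_norm (𝕜 := ℂ) (x i) (ξ i)
    rw [h i, norm_one] at this
    rwa [mul_comm]
  exact (pow_le_pow_left₀ (by positivity) h1 2).trans (Finset.sum_mul_sq_le_sq_mul_sq _ _ _)

/-- The case of equality in the Cauchy-Schwarz inequality. -/
theorem exists_eq_smul_of_card_sq_eq {x ξ : κ → H} (h : ∀ i, inner ℂ (x i) (ξ i) = 1)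
    (heq : (∑ i, ‖ξ i‖ ^ 2) * ∑ i, ‖x i‖ ^ 2 = (Fintype.card κ : ℝ) ^ 2) :
    ∃ v : ℝ, 0 < v ∧ ∀ i, ξ i = ((v⁻¹ : ℝ) : ℂ) • x i := by
  -- Without any index there is no condition on `v`.
  rcases isEmpty_or_nonempty κ with hκ | hκ
  · exact ⟨1, one_pos, fun i => (hκ.false i).elim⟩
  set c : ℝ := (Fintype.card κ : ℝ) with hc
  have hc0 : 0 < c := by
    rw [hc]
    exact_mod_cast Fintype.card_pos
  set s : ℝ := ∑ i, ‖x i‖ ^ 2 with hs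
  have hs0 : 0 < s := by
    refine lt_of_le_of_ne (by positivity) fun h0 => ?_
    rw [← h0, mul_zero] at heq
    exact absurd heq.symm (by positivity)
  -- Equality forces `ξ i` to be the same multiple of `x i` for all `i`, and `⟨x i, ξ i⟩ = 1`
  -- identifies `v` as the mean of the `‖x i‖ ^ 2`.
  refine ⟨s / c, by positivity, fun i => ?_⟩
  set r : ℝ := (s / c)⁻¹ with hr
  have hrs : r * s = c := by rw [hr]; field_simp
  have hsum : ∑ i, ‖ξ i - (r : ℂ) • x i‖ ^ 2 = 0 := by
    have : ∀ i, ‖ξ i - (r : ℂ) • x i‖ ^ 2 = ‖ξ i‖ ^ 2 - 2 * r + r ^ 2 * ‖x i‖ ^ 2 := by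
      intro i
      have hi : inner ℂ (ξ i) (x i) = 1 := by rw [← inner_conj_symm, h i, map_one]
      rw [norm_sub_sq (𝕜 := ℂ), inner_smul_right, hi, norm_smul, mul_pow]
      simp
    simp_rw [this]
    rw [Finset.sum_add_distrib, Finset.sum_sub_distrib,
      ← Finset.mul_sum Finset.univ (fun i => ‖x i‖ ^ 2), Finset.sum_const, nsmul_eq_mul,
      Finset.card_univ, ← hs, ← hc]
    have hξ : (∑ i, ‖ξ i‖ ^ 2) = r * c := by
      have : (∑ i, ‖ξ i‖ ^ 2) = c ^ 2 / s := by rw [eq_div_iff hs0.ne', heq]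
      rw [this, hr]
      field_simp
    rw [hξ]
    linear_combination r * hrs
  have := (Finset.sum_eq_zero_iff_of_nonneg fun i _ => by positivity).1 hsum i (Finset.mem_univ i)
  rw [sq_eq_zero_iff, norm_eq_zero, sub_eq_zero] at this
  exact this

end CauchySchwarz

/-! ### Fisher information and the family of all variables -/

section Fisher

variable {A : Type u} [CStarAlgebra A] {n m : ℕ}

/-- The side of a variable. -/
def varSide : Fin n ⊕ Fin m → Side
  | .inl _ => .left
  | .inr _ => .right

/-- The pair of algebras with respect to which the conjugate variable of a variable is formed. -/
def varContext (X : Fin n → A) (Y : Fin m → A) (Bl Br : StarSubalgebra ℂ A) :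
    Fin n ⊕ Fin m → Side → StarSubalgebra ℂ A
  | .inl i => leftContext X Y Bl Br i
  | .inr j => rightContext X Y Bl Br j

theorem mem_varContext (X : Fin n → A) (Y : Fin m → A) (Bl Br : StarSubalgebra ℂ A)
    {k k' : Fin n ⊕ Fin m} (h : k' ≠ k) :
    Sum.elim X Y k' ∈ varContext X Y Bl Br k (varSide k') := by
  have hext : ∀ {B : StarSubalgebra ℂ A} {S : Set A} {a : A}, a ∈ S → a ∈ extend B S :=
    fun ha => (le_sup_right : _ ≤ extend _ _) (StarAlgebra.subset_adjoin ℂ _ ha)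
  rcases k with i | j <;> rcases k' with i' | j'
  · exact hext ⟨i', fun e => h (e ▸ rfl), rfl⟩
  · exact hext ⟨j', rfl⟩
  · exact hext ⟨i', rfl⟩
  · exact hext ⟨j', fun e => h (e ▸ rfl), rfl⟩

theorem mem_of_mem_varContext {X : Fin n → A} {Y : Fin m → A}
    (hXY : ∀ k, IsSelfAdjoint (Sum.elim X Y k)) {Bl Br : StarSubalgebra ℂ A}
    {k : Fin n ⊕ Fin m} {t : Side} {C : Subalgebra ℂ A} (hB : ∀ b ∈ facePair Bl Br t, b ∈ C)
    (hC : ∀ k', k' ≠ k → varSide k' = t → Sum.elim X Y k' ∈ C) {b : A}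
    (hb : b ∈ varContext X Y Bl Br k t) : b ∈ C := by
  rcases k with i | j <;> cases t
  · refine mem_of_mem_extend ?_ hB ?_ hb
    · rintro _ ⟨i', -, rfl⟩
      exact hXY (.inl i')
    · rintro _ ⟨i', hi', rfl⟩
      exact hC (.inl i') (fun e => hi' (Sum.inl_injective e)) rfl
  · refine mem_of_mem_extend ?_ hB ?_ hb
    · rintro _ ⟨j', rfl⟩
      exact hXY (.inr j')
    · rintro _ ⟨j', rfl⟩
      exact hC (.inr j') (by simp) rfl
  · refine mem_of_mem_extend ?_ hB ?_ hb
    · rintro _ ⟨i', rfl⟩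
      exact hXY (.inl i')
    · rintro _ ⟨i', rfl⟩
      exact hC (.inl i') (by simp) rfl
  · refine mem_of_mem_extend ?_ hB ?_ hb
    · rintro _ ⟨j', -, rfl⟩
      exact hXY (.inr j')
    · rintro _ ⟨j', hj', rfl⟩
      exact hC (.inr j') (fun e => hj' (Sum.inr_injective e)) rfl

variable [PartialOrder A] [StarOrderedRing A]

/-- The vectors `ζ k` are the bi-free conjugate variables of the variables. -/
def IsConjugateSystem (φ : A →ₚ[ℂ] ℂ) (X : Fin n → A) (Y : Fin m → A)
    (Bl Br : StarSubalgebra ℂ A) (ζ : Fin n ⊕ Fin m → φ.GNS) : Prop :=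
  ∀ k, IsConjugateVariable φ (varSide k) (Sum.elim X Y k) (varContext X Y Bl Br k) (ζ k)

variable {φ : A →ₚ[ℂ] ℂ} {X : Fin n → A} {Y : Fin m → A} {Bl Br : StarSubalgebra ℂ A}

theorem exists_isConjugateSystem (h : cramerRaoProduct φ X Y Bl Br ≠ ⊤) :
    ∃ ζ, IsConjugateSystem φ X Y Bl Br ζ := by
  by_contra hcon
  refine h (if_pos (dif_neg fun h' => hcon ?_))
  choose ξ hξ using h'.1
  choose η hη using h'.2
  exact ⟨Sum.elim ξ η, fun k => by
    rcases k with i | j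
    · exact hξ i
    · exact hη j⟩

theorem cramerRaoProduct_eq (hφ : φ 1 = 1) (hXY : ∀ k, IsSelfAdjoint (Sum.elim X Y k))
    {ζ : Fin n ⊕ Fin m → φ.GNS} (hζ : IsConjugateSystem φ X Y Bl Br ζ) :
    cramerRaoProduct φ X Y Bl Br =
      ENNReal.ofReal ((∑ k, ‖ζ k‖ ^ 2) * ∑ k, ‖toL2 φ (Sum.elim X Y k)‖ ^ 2) := by
  have h : (∀ i, ∃ ξ, IsConjugateVariable φ Side.left (X i) (leftContext X Y Bl Br i) ξ) ∧
      (∀ j, ∃ η, IsConjugateVariable φ Side.right (Y j) (rightContext X Y Bl Br j) η) :=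
    ⟨fun i => ⟨_, hζ (.inl i)⟩, fun j => ⟨_, hζ (.inr j)⟩⟩
  have hF : fisherInformation φ X Y Bl Br = ENNReal.ofReal (∑ k, ‖ζ k‖ ^ 2) := by
    rw [fisherInformation, dif_pos h, Fintype.sum_sum_type,
      ENNReal.ofReal_add (by positivity) (by positivity),
      ENNReal.ofReal_sum_of_nonneg (fun _ _ => by positivity),
      ENNReal.ofReal_sum_of_nonneg (fun _ _ => by positivity)]
    congr 1
    · refine Finset.sum_congr rfl fun i _ => ?_
      rw [IsConjugateVariable.unique hφ (hXY (.inl i)) (h.1 i).choose_spec (hζ (.inl i))]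
    · refine Finset.sum_congr rfl fun j _ => ?_
      rw [IsConjugateVariable.unique hφ (hXY (.inr j)) (h.2 j).choose_spec (hζ (.inr j))]
  have hV : (φ (∑ i, X i ^ 2 + ∑ j, Y j ^ 2)).re = ∑ k, ‖toL2 φ (Sum.elim X Y k)‖ ^ 2 := by
    simp_rw [fun k => norm_toL2_sq φ (hXY k)]
    rw [Fintype.sum_sum_type, map_add, map_sum, map_sum, Complex.add_re, Complex.re_sum,
      Complex.re_sum]
    rfl
  rw [cramerRaoProduct, hF, hV, topMul, if_neg ENNReal.ofReal_ne_top,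
    ENNReal.ofReal_mul (by positivity)]

theorem IsConjugateSystem.inner_eq_one (hφ : φ 1 = 1) (hXY : ∀ k, IsSelfAdjoint (Sum.elim X Y k))
    {ζ : Fin n ⊕ Fin m → φ.GNS} (hζ : IsConjugateSystem φ X Y Bl Br ζ) (k : Fin n ⊕ Fin m) :
    inner ℂ (toL2 φ (Sum.elim X Y k)) (ζ k) = 1 :=
  (hζ k).inner_eq_one hφ (hXY k)

theorem ofReal_card_sq (n m : ℕ) :
    ENNReal.ofReal ((Fintype.card (Fin n ⊕ Fin m) : ℝ) ^ 2) = ((n : ℝ≥0∞) + m) ^ 2 := by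
  rw [ENNReal.ofReal_pow (by positivity)]
  simp [ENNReal.ofReal_add]

theorem sq_le_cramerRaoProduct (hφ : φ 1 = 1) (hXY : ∀ k, IsSelfAdjoint (Sum.elim X Y k)) :
    ((n : ℝ≥0∞) + m) ^ 2 ≤ cramerRaoProduct φ X Y Bl Br := by
  by_cases h : cramerRaoProduct φ X Y Bl Br = ⊤
  · rw [h]
    exact le_top
  · obtain ⟨ζ, hζ⟩ := exists_isConjugateSystem h
    rw [cramerRaoProduct_eq hφ hXY hζ, ← ofReal_card_sq]
    exact ENNReal.ofReal_le_ofReal (card_sq_le_of_inner_eq_one (hζ.inner_eq_one hφ hXY))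

end Fisher

/-! ### Comparison of two functionals on words -/

section Compare

variable {B C Λ : Type*} [Semiring B] [Algebra ℂ B] [Semiring C] [Algebra ℂ C]

/-- Functionals that agree on words agree on the algebra generated by the letters. -/
theorem apply_eq_of_mem_adjoin (ψ : B →ₗ[ℂ] ℂ) (ψ' : C →ₗ[ℂ] ℂ) (G : Λ → B × C)
    (h : ∀ w : List Λ, ψ (w.map G).prod.1 = ψ' (w.map G).prod.2) {z : B × C}
    (hz : z ∈ Algebra.adjoin ℂ (Set.range G)) : ψ z.1 = ψ' z.2 := by
  rw [← Subalgebra.mem_toSubmodule, Algebra.adjoin_eq_span] at hz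
  induction hz using Submodule.span_induction with
  | mem z hz =>
    suffices H : ∃ w : List Λ, (w.map G).prod = z by
      obtain ⟨w, rfl⟩ := H
      exact h w
    induction hz using Submonoid.closure_induction_left with
    | one => exact ⟨[], rfl⟩
    | mul_left x hx y _ ih =>
      obtain ⟨a, rfl⟩ := hx
      obtain ⟨w, rfl⟩ := ih
      exact ⟨a :: w, by simp⟩
  | zero => simp
  | add x y _ _ hx hy => simp [hx, hy]
  | smul c x _ hx => simp [hx]

theorem wordVal_mem_filtration {X : B} (M : ℕ → Submodule ℂ B) (h1 : 1 ∈ M 0)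
    {w : List (Letter B)} (hmul : ∀ a ∈ w, ∀ n, ∀ z ∈ M n, a.val X * z ∈ M (n + 1)) :
    wordVal X w ∈ M w.length := by
  induction w with
  | nil => simpa using h1
  | cons a w ih =>
    rw [wordVal_cons]
    exact hmul a List.mem_cons_self _ _ (ih fun b hb => hmul b (List.mem_cons_of_mem _ hb))

/-- The difference quotient of a word depends only on the functional on shorter words, and is a
combination of shorter words. The filtration `M` plays the role of the length of words. -/
theorem diff_congr_of_filtration {X : B} (M : ℕ → Submodule ℂ B) (hM : Monotone M)
    (h1 : 1 ∈ M 0) (ψ ψ' : B → ℂ) (w : List (Letter B)) (N : ℕ) (hN : w.length ≤ N + 1)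
    (hψ : ∀ z ∈ M N, ψ z = ψ' z)
    (hmul : ∀ a ∈ w, ∀ n, ∀ z ∈ M n, a.val X * z ∈ M (n + 1)) :
    diff ψ X w = diff ψ' X w ∧ diff ψ X w ∈ M N := by
  induction w generalizing N with
  | nil => exact ⟨rfl, Submodule.zero_mem _⟩
  | cons a w ih =>
    rw [List.length_cons] at hN
    have hmul' : ∀ a ∈ w, ∀ n, ∀ z ∈ M n, a.val X * z ∈ M (n + 1) :=
      fun b hb => hmul b (List.mem_cons_of_mem _ hb)
    have hfil : ∀ p : Letter B → Bool, wordVal X (w.filter p) ∈ M N := fun p =>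
      hM ((List.length_filter_le _ _).trans (by omega))
        (wordVal_mem_filtration M h1 fun b hb => hmul' b (List.mem_filter.1 hb).1)
    have hrest : diff ψ X w = diff ψ' X w ∧ a.val X * diff ψ X w ∈ M N := by
      rcases N with - | N
      · obtain rfl : w = [] := List.eq_nil_of_length_eq_zero (by omega)
        refine ⟨rfl, ?_⟩
        rw [diff, mul_zero]
        exact Submodule.zero_mem _
      · obtain ⟨e, he⟩ := ih N (by omega) (fun z hz => hψ z (hM (Nat.le_succ N) hz)) hmul'
        exact ⟨e, hmul a List.mem_cons_self N _ he⟩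
    rw [diff_cons, diff_cons, ← hrest.1, sameProd, hψ _ (hfil _)]
    refine ⟨rfl, Submodule.add_mem _ ?_ hrest.2⟩
    split_ifs
    · exact Submodule.smul_mem _ _ (hfil _)
    · exact Submodule.zero_mem _

/-- Two functionals that agree on sufficiently long words in pairs of letters agree on difference
quotients. -/
theorem apply_diff_eq {X : B × C} (M : ℕ → Submodule ℂ (B × C)) (hM : Monotone M)
    (h1 : 1 ∈ M 0) (ψ : B →ₗ[ℂ] ℂ) (ψ' : C →ₗ[ℂ] ℂ) (w : List (Letter (B × C))) (N : ℕ)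
    (hN : w.length ≤ N + 1) (hψ : ∀ z ∈ M N, ψ z.1 = ψ' z.2)
    (hmul : ∀ a ∈ w, ∀ n, ∀ z ∈ M n, a.val X * z ∈ M (n + 1)) :
    ψ (diff ψ X.1 (w.map (Letter.map Prod.fst))) =
      ψ' (diff ψ' X.2 (w.map (Letter.map Prod.snd))) := by
  obtain ⟨e, he⟩ := diff_congr_of_filtration M hM h1 (fun z => ψ z.1) (fun z => ψ' z.2) w N hN hψ
    hmul
  have e1 : diff ψ X.1 (w.map (Letter.map Prod.fst)) = (diff (fun z => ψ z.1) X w).1 :=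
    diff_map (AlgHom.fst ℂ B C) ψ X w
  have e2 : diff ψ' X.2 (w.map (Letter.map Prod.snd)) = (diff (fun z => ψ' z.2) X w).2 :=
    diff_map (AlgHom.snd ℂ B C) ψ' X w
  rw [e1, e2, ← e]
  exact hψ _ he

end Compare

/-! ### Bi-free semicircular systems -/

section SemicircularOperator

variable {ι : Type*} {S : ι → Type u}

open Polynomial in
/-- The conjugate relation in the vacuum state of a free product, for an operator that is orthogonal
to the polynomials of the semicircular distribution of variance `v`. -/
theorem vac_wordVal_mul_of_orthoSeq {k : ι} {T : Module.End ℂ (Pointed (S k))} {v : ℂ} (s : Side)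
    (hT : ∀ n, vac (aeval (sideRep s k T) (orthoSeq v (X : ℂ[X]) (n + 1))) = 0)
    (w : List (Letter (Module.End ℂ (FreeProd S))))
    (hw : ∀ a ∈ w, a.Mem (otherOps S s k : Set _) (otherOps S s.other k)) :
    vac (wordVal (sideRep s k T) w * sideRep s k T) =
      v * vac (diff vac (sideRep s k T) w) := by
  refine vac_wordVal_mul_sideRep
    (f := fun n => aeval T (orthoSeq v (X : ℂ[X]) n) (Finsupp.single none 1)) ?_ ?_ ?_ ?_ s w hw
  · simp [orthoSeq]
  · simp [orthoSeq]
  · intro n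
    have e : X * orthoSeq v (X : ℂ[X]) (n + 1) = orthoSeq v X (n + 2) + v • orthoSeq v X n := by
      simp [orthoSeq]
    have := congrArg (fun p => aeval T p (Finsupp.single none 1 : Pointed (S k))) e
    simpa only [map_mul, aeval_X, map_add, map_smul, Module.End.mul_apply, LinearMap.add_apply,
      LinearMap.smul_apply] using this
  · intro n
    rw [← vac_sideRep s k, ← aeval_algHom_apply]
    exact hT n

end SemicircularOperator

section Faces

variable {A : Type u} [CStarAlgebra A] {n m : ℕ}

/-- The faces of a given side of the family `{(B_ℓ, B_r)} ∪ {(X_i, 1)} ∪ {(1, Y_j)}`. -/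
def sideFaces (X : Fin n → A) (Y : Fin m → A) (Bl Br : StarSubalgebra ℂ A) :
    Side → Unit ⊕ Fin n ⊕ Fin m → StarSubalgebra ℂ A
  | .left => leftFaces (m := m) X Bl
  | .right => rightFaces (n := n) Y Br

theorem facePair_eq_sideFaces (X : Fin n → A) (Y : Fin m → A) (Bl Br : StarSubalgebra ℂ A)
    (t : Side) : facePair Bl Br t = sideFaces X Y Bl Br t (.inl ()) := by
  cases t <;> rfl

theorem mem_sideFaces (X : Fin n → A) (Y : Fin m → A) (Bl Br : StarSubalgebra ℂ A)
    (k : Fin n ⊕ Fin m) :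
    Sum.elim X Y k ∈ sideFaces X Y Bl Br (varSide k) (.inr k) := by
  cases k <;> exact StarAlgebra.subset_adjoin ℂ _ rfl

/-- Letterwise preimages give a preimage of a word. -/
theorem exists_list_map_eq {α β : Type*} (f : α → β) {P : α → Prop} {Q : β → Prop}
    (h : ∀ b, Q b → ∃ a, P a ∧ f a = b) (w : List β) (hw : ∀ b ∈ w, Q b) :
    ∃ w' : List α, (∀ a ∈ w', P a) ∧ w'.map f = w := by
  induction w with
  | nil => exact ⟨[], by simp, rfl⟩
  | cons b w ih =>
    obtain ⟨w', hw', rfl⟩ := ih fun b hb => hw b (List.mem_cons_of_mem _ hb)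
    obtain ⟨a, ha, rfl⟩ := h b (hw b List.mem_cons_self)
    exact ⟨a :: w', by simpa using ⟨ha, hw'⟩, rfl⟩

variable [PartialOrder A]

open Polynomial in
/-- In a bi-free semicircular system of variance `v`, each variable `x` satisfies the relation
`φ(w x) = v (φ ⊗ φ)(∂ w)`. -/
theorem apply_wordVal_mul_of_isBiFree {φ : A →ₚ[ℂ] ℂ} (hφ : φ 1 = 1) {X : Fin n → A}
    {Y : Fin m → A} (hXY : ∀ k, IsSelfAdjoint (Sum.elim X Y k)) {Bl Br : StarSubalgebra ℂ A}
    (hfree : IsBiFree φ (leftFaces (m := m) X Bl) (rightFaces (n := n) Y Br)) {v : ℝ} (hv : 0 < v)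
    (k : Fin n ⊕ Fin m) (hsc : IsSemicircular φ v (Sum.elim X Y k)) (w : List (Letter A))
    (hw : ∀ a ∈ w, a.Mem (varContext X Y Bl Br k (varSide k))
      (varContext X Y Bl Br k (varSide k).other)) :
    φ (wordVal (Sum.elim X Y k) w * Sum.elim X Y k) =
      v * φ (diff φ (Sum.elim X Y k) w) := by
  obtain ⟨S, l, r, hmom⟩ := hfree
  let G : (Σ i, (leftFaces (m := m) X Bl i) ⊕ (rightFaces (n := n) Y Br i)) →
      A × Module.End ℂ (FreeProd S) := fun a => (letterVal a, letterRep l r a)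
  -- The pairs of an element of the algebra and an operator on the free product that represents it.
  let P : Subalgebra ℂ (A × Module.End ℂ (FreeProd S)) := Algebra.adjoin ℂ (Set.range G)
  have hP : ∀ z ∈ P, φ z.1 = vac z.2 := by
    intro z hz
    refine apply_eq_of_mem_adjoin φ.toLinearMap vac G (fun w => ?_) hz
    have e1 : (w.map G).prod.1 = (w.map letterVal).prod := by
      have := map_list_prod (MonoidHom.fst A (Module.End ℂ (FreeProd S))) (w.map G)
      simpa [Function.comp_def, G] using this
    have e2 : (w.map G).prod.2 = (w.map (letterRep l r)).prod := by
      have := map_list_prod (MonoidHom.snd A (Module.End ℂ (FreeProd S))) (w.map G)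
      simpa [Function.comp_def, G] using this
    rw [e1, e2]
    exact hmom w
  -- The action of an element of a face.
  have hface : ∀ t i, ∀ b ∈ sideFaces X Y Bl Br t i,
      ∃ T : Module.End ℂ (Pointed (S i)), (b, sideRep t i T) ∈ P := by
    intro t i b hb
    cases t
    · exact ⟨l i ⟨b, hb⟩, Algebra.subset_adjoin ⟨⟨i, Sum.inl ⟨b, hb⟩⟩, rfl⟩⟩
    · exact ⟨r i ⟨b, hb⟩, Algebra.subset_adjoin ⟨⟨i, Sum.inr ⟨b, hb⟩⟩, rfl⟩⟩
  -- The elements of the context of the variable `k` are represented without the index of `k`.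
  have hctx : ∀ t, ∀ b ∈ varContext X Y Bl Br k t,
      ∃ M ∈ otherOps S t (.inr k), (b, M) ∈ P := by
    intro t b hb
    let C : Subalgebra ℂ A := (P ⊓ (otherOps S t (.inr k)).comap (AlgHom.snd ℂ A _)).map
      (AlgHom.fst ℂ A (Module.End ℂ (FreeProd S)))
    have hC : ∀ i, i ≠ Sum.inr k → ∀ b ∈ sideFaces X Y Bl Br t i, b ∈ C := by
      intro i hi b hb
      obtain ⟨T, hT⟩ := hface t i b hb
      exact ⟨_, ⟨hT, Algebra.subset_adjoin ⟨i, hi, T, rfl⟩⟩, rfl⟩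
    have hbC : b ∈ C := by
      refine mem_of_mem_varContext hXY (fun b hb => ?_) (fun k' hk' ht => ?_) hb
      · rw [facePair_eq_sideFaces X Y] at hb
        exact hC _ (by simp) b hb
      · refine hC (.inr k') (fun e => hk' (Sum.inr_injective e)) _ ?_
        rw [← ht]
        exact mem_sideFaces X Y Bl Br k'
    obtain ⟨⟨b', M⟩, ⟨h1, h2⟩, rfl⟩ := hbC
    exact ⟨M, h2, h1⟩
  obtain ⟨T, hT⟩ := hface _ _ _ (mem_sideFaces X Y Bl Br k)
  set s := varSide k with hs
  set x := Sum.elim X Y k with hx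
  set z : A × Module.End ℂ (FreeProd S) := (x, sideRep s (.inr k) T) with hz
  have hortho : ∀ j, vac (aeval (sideRep s (Sum.inr k) T)
      (orthoSeq (v : ℂ) (Polynomial.X : ℂ[X]) (j + 1))) = 0 := by
    intro j
    have hmem : aeval z (orthoSeq (v : ℂ) (Polynomial.X : ℂ[X]) (j + 1)) ∈ P :=
      Algebra.adjoin_le (by simpa using hT) (aeval_mem_adjoin_singleton ℂ z)
    have h := hP _ hmem
    have e1 := aeval_algHom_apply (AlgHom.fst ℂ A (Module.End ℂ (FreeProd S))) z
      (orthoSeq (v : ℂ) (Polynomial.X : ℂ[X]) (j + 1))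
    have e2 := aeval_algHom_apply (AlgHom.snd ℂ A (Module.End ℂ (FreeProd S))) z
      (orthoSeq (v : ℂ) (Polynomial.X : ℂ[X]) (j + 1))
    have e1' : (aeval z (orthoSeq (v : ℂ) (Polynomial.X : ℂ[X]) (j + 1))).1 =
        orthoSeq (v : ℂ) x (j + 1) := by
      refine e1.symm.trans ?_
      rw [map_orthoSeq, aeval_X]
      rfl
    have e2' : (aeval z (orthoSeq (v : ℂ) (Polynomial.X : ℂ[X]) (j + 1))).2 =
        aeval (sideRep s (Sum.inr k) T) (orthoSeq (v : ℂ) (Polynomial.X : ℂ[X]) (j + 1)) := e2.symm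
    rw [← e2', ← h, e1']
    exact (isSemicircular_iff hφ hv x).1 hsc j
  -- Lift the word to pairs of elements of the algebra and operators on the free product.
  obtain ⟨w', hw', rfl⟩ := exists_list_map_eq (Letter.map Prod.fst)
    (P := fun a : Letter (A × Module.End ℂ (FreeProd S)) => a.val z ∈ P ∧
      (a.map Prod.snd).Mem (otherOps S s (.inr k) : Set _) (otherOps S s.other (.inr k)))
    (fun a ha => by
      cases a with
      | pivot => exact ⟨.pivot, ⟨hT, trivial⟩, rfl⟩
      | same b =>
        obtain ⟨M, hM, hMP⟩ := hctx _ _ ha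
        exact ⟨.same (b, M), ⟨hMP, hM⟩, rfl⟩
      | opp b =>
        obtain ⟨M, hM, hMP⟩ := hctx _ _ ha
        exact ⟨.opp (b, M), ⟨hMP, hM⟩, rfl⟩) w hw
  have key := vac_wordVal_mul_of_orthoSeq s hortho (w'.map (Letter.map Prod.snd)) fun a ha => by
    obtain ⟨b, hb, rfl⟩ := List.mem_map.1 ha
    exact (hw' b hb).2
  have hwP : wordVal z w' * z ∈ P := by
    refine P.mul_mem (P.list_prod_mem fun b hb => ?_) hT
    obtain ⟨a, ha, rfl⟩ := List.mem_map.1 hb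
    exact (hw' a ha).1
  have e1 : wordVal x (w'.map (Letter.map Prod.fst)) = (wordVal z w').1 :=
    wordVal_map (AlgHom.fst ℂ A (Module.End ℂ (FreeProd S))) z w'
  have e2 : wordVal (sideRep s (.inr k) T) (w'.map (Letter.map Prod.snd)) = (wordVal z w').2 :=
    wordVal_map (AlgHom.snd ℂ A (Module.End ℂ (FreeProd S))) z w'
  have e3 := apply_diff_eq (X := z) (fun _ => Subalgebra.toSubmodule P) (fun _ _ _ => le_rfl)
    P.one_mem φ.toLinearMap vac w' w'.length (Nat.le_succ _) hP
    fun a ha n y hy => P.mul_mem (hw' a ha).1 hy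
  rw [e1]
  refine (hP _ hwP).trans ?_
  rw [Prod.snd_mul, ← e2]
  refine key.trans ?_
  rw [← e3]
  rfl

variable [StarOrderedRing A]

/-- In a bi-free semicircular system of variance `v`, the conjugate variables are the variables
divided by `v`. -/
theorem isConjugateSystem_of_isBiFree {φ : A →ₚ[ℂ] ℂ} (hφ : φ 1 = 1) {X : Fin n → A}
    {Y : Fin m → A} (hXY : ∀ k, IsSelfAdjoint (Sum.elim X Y k)) {Bl Br : StarSubalgebra ℂ A}
    (hfree : IsBiFree φ (leftFaces (m := m) X Bl) (rightFaces (n := n) Y Br)) {v : ℝ} (hv : 0 < v)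
    (hsc : ∀ k, IsSemicircular φ v (Sum.elim X Y k)) :
    IsConjugateSystem φ X Y Bl Br fun k => toL2 φ ((v : ℂ)⁻¹ • Sum.elim X Y k) := by
  intro k
  refine ConjugateRelation.isConjugateVariable hφ ?_ fun w hw => ?_
  · refine subset_closure ⟨_, ?_, rfl⟩
    exact SMulMemClass.smul_mem (s := extend _ _) _
      ((le_sup_right : _ ≤ extend _ _) (StarAlgebra.subset_adjoin ℂ _ rfl))
  · rw [vectorMoment_toL2, mul_smul_comm, map_smul,
      apply_wordVal_mul_of_isBiFree hφ hXY hfree hv k (hsc k) w hw, smul_eq_mul,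
      inv_mul_cancel_left₀ (Complex.ofReal_ne_zero.2 hv.ne')]

theorem norm_toL2_sq_of_isSemicircular {φ : A →ₚ[ℂ] ℂ} (hφ : φ 1 = 1) {v : ℝ} (hv : 0 < v) {a : A}
    (ha : IsSelfAdjoint a) (hsc : IsSemicircular φ v a) : ‖toL2 φ a‖ ^ 2 = v := by
  have := (isSemicircular_iff hφ hv a).1 hsc 1
  simp only [orthoSeq, map_sub, map_smul, hφ, ← sq, smul_eq_mul, mul_one] at this
  rw [norm_toL2_sq φ ha, sub_eq_zero.1 this, Complex.ofReal_re]

theorem cramerRaoProduct_of_isBiFree {φ : A →ₚ[ℂ] ℂ} (hφ : φ 1 = 1) {X : Fin n → A}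
    {Y : Fin m → A} (hXY : ∀ k, IsSelfAdjoint (Sum.elim X Y k)) {Bl Br : StarSubalgebra ℂ A}
    (h : IsBiFreeSemicircularSystem φ X Y Bl Br) :
    cramerRaoProduct φ X Y Bl Br = ((n : ℝ≥0∞) + m) ^ 2 := by
  obtain ⟨⟨v, hv, hX, hY⟩, hfree⟩ := h
  have hsc : ∀ k, IsSemicircular φ v (Sum.elim X Y k) := by
    rintro (i | j)
    · exact hX i
    · exact hY j
  rw [cramerRaoProduct_eq hφ hXY (isConjugateSystem_of_isBiFree hφ hXY hfree hv hsc),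
    ← ofReal_card_sq]
  congr 1
  have h1 : ∀ k, ‖toL2 φ (Sum.elim X Y k)‖ ^ 2 = v :=
    fun k => norm_toL2_sq_of_isSemicircular hφ hv (hXY k) (hsc k)
  have h2 : ∀ k, ‖toL2 φ ((v : ℂ)⁻¹ • Sum.elim X Y k)‖ ^ 2 = v⁻¹ := by
    intro k
    rw [toL2_smul, norm_smul, mul_pow, h1, norm_inv, Complex.norm_real, Real.norm_of_nonneg hv.le]
    field_simp
  simp only [h1, h2, Finset.sum_const, nsmul_eq_mul, Finset.card_univ]
  field_simp

/-! ### The case of equality -/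

/-- The algebra, with the unit as state vector and the kernel of the state as complement, in
coordinates. -/
theorem exists_pointed_equiv {A : Type u} [CStarAlgebra A] [PartialOrder A] (φ : A →ₚ[ℂ] ℂ)
    (hφ : φ 1 = 1) :
    ∃ (S₀ : Type u) (e : A ≃ₗ[ℂ] Pointed S₀), e 1 = Finsupp.single none 1 ∧
      ∀ a, e a none = φ a := by
  let b := Module.Basis.ofVectorSpace ℂ (LinearMap.ker φ.toLinearMap)
  let S₀ := Module.Basis.ofVectorSpaceIndex ℂ (LinearMap.ker φ.toLinearMap)
  let p : A →ₗ[ℂ] LinearMap.ker φ.toLinearMap :=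
    LinearMap.codRestrict _ (LinearMap.id - φ.toLinearMap.smulRight (1 : A)) fun a => by
      simp [hφ]
  have hp : ∀ a, (p a : A) = a - φ a • (1 : A) := fun a => rfl
  let f : A →ₗ[ℂ] Pointed S₀ := (Finsupp.lsingle none) ∘ₗ φ.toLinearMap +
    (Finsupp.lmapDomain ℂ ℂ some) ∘ₗ b.repr.toLinearMap ∘ₗ p
  have hf : ∀ a, f a = Finsupp.single none (φ a) + Finsupp.mapDomain some (b.repr (p a)) :=
    fun a => rfl
  have hnone : ∀ a, f a none = φ a := by
    intro a
    rw [hf, Finsupp.add_apply, Finsupp.single_eq_same,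
      Finsupp.mapDomain_of_notMem_range _ _ (by simp), add_zero]
  have hsome : ∀ a s, f a (some s) = b.repr (p a) s := by
    intro a s
    rw [hf, Finsupp.add_apply, Finsupp.single_eq_of_ne (by simp),
      Finsupp.mapDomain_apply (Option.some_injective _), zero_add]
  refine ⟨S₀, LinearEquiv.ofBijective f ⟨?_, ?_⟩, ?_, hnone⟩
  · rw [← LinearMap.ker_eq_bot, LinearMap.ker_eq_bot']
    intro a ha
    have h1 : φ a = 0 := by rw [← hnone, ha, Finsupp.zero_apply]
    have h2 : p a = 0 := by
      rw [← b.repr.map_eq_zero_iff]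
      ext s
      rw [← hsome, ha, Finsupp.zero_apply, Finsupp.zero_apply]
    have h3 := hp a
    rw [h2, h1, zero_smul, sub_zero] at h3
    exact h3.symm
  · intro x
    let y := b.repr.symm x.some
    have hy : φ (y : A) = 0 := y.2
    have hφa : φ (x none • (1 : A) + y) = x none := by
      rw [map_add, map_smul, hφ, hy, smul_eq_mul, mul_one, add_zero]
    have hpa : p (x none • (1 : A) + y) = y := by
      ext
      rw [hp, hφa, add_sub_cancel_left]
    refine ⟨x none • (1 : A) + y, ?_⟩
    ext o
    cases o with
    | none => rw [hnone, hφa]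
    | some s => rw [hsome, hpa, b.repr.apply_symm_apply, Finsupp.some_apply]
  · change f 1 = _
    have : p 1 = 0 := by
      ext
      rw [hp, hφ, one_smul, sub_self]
      rfl
    rw [hf, this, hφ]
    simp

end Faces

section Equality

variable {A : Type u} [CStarAlgebra A] [PartialOrder A] {n m : ℕ}

theorem wordVal_replicate_pivot {B : Type*} [Semiring B] (x : B) (k : ℕ) :
    wordVal x (List.replicate k .pivot) = x ^ k := by
  simp [wordVal, Letter.val]

/-- The relation of a semicircular system determines the distribution of each variable. -/
theorem isSemicircular_of_apply_wordVal_mul {φ : A →ₚ[ℂ] ℂ} (hφ : φ 1 = 1) {v : ℝ} (hv : 0 < v)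
    (x : A) {S T : Set A} (h : ∀ w : List (Letter A), (∀ a ∈ w, a.Mem S T) →
      φ (wordVal x w * x) = v * φ (diff φ x w)) : IsSemicircular φ v x := by
  refine (isSemicircular_iff hφ hv x).2 (apply_orthoSeq_eq_zero φ.toLinearMap hφ v x fun k => ?_)
  have := h (List.replicate k .pivot) fun a ha => by
    rw [List.eq_of_mem_replicate ha]
    trivial
  rwa [wordVal_replicate_pivot] at this

/-- The span of the products of at most `N` of the elements `G k`. -/
def lengthFiltration {K B : Type*} [Semiring B] [Algebra ℂ B] (G : K → B) (N : ℕ) :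
    Submodule ℂ B :=
  Submodule.span ℂ {z | ∃ w : List K, w.length ≤ N ∧ (w.map G).prod = z}

section LengthFiltration

variable {K B : Type*} [Semiring B] [Algebra ℂ B] (G : K → B)

theorem lengthFiltration_mono : Monotone (lengthFiltration G) := fun _ _ h =>
  Submodule.span_mono fun _ ⟨w, hw, e⟩ => ⟨w, hw.trans h, e⟩

theorem one_mem_lengthFiltration (N : ℕ) : 1 ∈ lengthFiltration G N :=
  Submodule.subset_span ⟨[], Nat.zero_le _, rfl⟩

theorem mul_mem_lengthFiltration (k : K) {N : ℕ} {z : B} (hz : z ∈ lengthFiltration G N) :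
    G k * z ∈ lengthFiltration G (N + 1) := by
  induction hz using Submodule.span_induction with
  | mem z hz =>
    obtain ⟨w, hw, rfl⟩ := hz
    exact Submodule.subset_span ⟨k :: w, Nat.succ_le_succ hw, by simp⟩
  | zero => simp
  | add x y _ _ hx hy => rw [mul_add]; exact Submodule.add_mem _ hx hy
  | smul c x _ hx => rw [mul_smul_comm]; exact Submodule.smul_mem _ _ hx

end LengthFiltration

open Classical in
/-- The letter of the variable `k'` in a word with pivot `k`. -/
def varLetter {B : Type*} (G : Fin n ⊕ Fin m → B) (k k' : Fin n ⊕ Fin m) : Letter B :=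
  if k' = k then .pivot else if varSide k' = varSide k then .same (G k') else .opp (G k')

theorem val_varLetter {B : Type*} (G : Fin n ⊕ Fin m → B) (k k' : Fin n ⊕ Fin m) :
    (varLetter G k k').val (G k) = G k' := by
  unfold varLetter
  split_ifs with h
  · rw [h]
    rfl
  · rfl
  · rfl

theorem mem_map_varLetter {B C : Type*} (G : Fin n ⊕ Fin m → B) (f : B → C)
    {k : Fin n ⊕ Fin m} {M : Side → Set C} (k' : Fin n ⊕ Fin m)
    (h : k' ≠ k → f (G k') ∈ M (varSide k')) :
    ((varLetter G k k').map f).Mem (M (varSide k)) (M (varSide k).other) := by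
  unfold varLetter
  split_ifs with hk hs
  · trivial
  · exact hs ▸ h hk
  · have : varSide k' = (varSide k).other := by
      cases h1 : varSide k' <;> cases h2 : varSide k <;> simp_all [Side.other]
    exact this ▸ h hk

theorem wordVal_map_varLetter {B : Type*} [Semiring B] (G : Fin n ⊕ Fin m → B)
    (k : Fin n ⊕ Fin m) (u : List (Fin n ⊕ Fin m)) :
    wordVal (G k) (u.map (varLetter G k)) = (u.map G).prod := by
  simp [wordVal, Function.comp_def, val_varLetter]

open Polynomial in
/-- The relation of a semicircular system expresses a moment by moments of lower degree, in `φ` as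
well as in the vacuum state of the free product of copies of the algebra. Hence the moments
agree. -/
theorem apply_prod_eq_vac {φ : A →ₚ[ℂ] ℂ} (hφ : φ 1 = 1) {X : Fin n → A} {Y : Fin m → A}
    {v : ℝ} (hv : 0 < v) {Bl Br : StarSubalgebra ℂ A}
    (hrel : ∀ k, ∀ w : List (Letter A), (∀ a ∈ w, a.Mem (varContext X Y Bl Br k (varSide k))
      (varContext X Y Bl Br k (varSide k).other)) →
      φ (wordVal (Sum.elim X Y k) w * Sum.elim X Y k) = v * φ (diff φ (Sum.elim X Y k) w))
    {S₀ : Type u} (lm : A →ₐ[ℂ] Module.End ℂ (Pointed S₀))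
    (hlm : ∀ a, lm a (Finsupp.single none 1) none = φ a)
    {G : Fin n ⊕ Fin m → A × Module.End ℂ (FreeProd fun _ : Unit ⊕ Fin n ⊕ Fin m => S₀)}
    (hG : ∀ k, G k = (Sum.elim X Y k, sideRep (varSide k) (.inr k) (lm (Sum.elim X Y k))))
    (w : List (Fin n ⊕ Fin m)) : φ (w.map G).prod.1 = vac (w.map G).prod.2 := by
  have hfst : ∀ k, (G k).1 = Sum.elim X Y k := fun k => by rw [hG]
  have hsnd : ∀ k, (G k).2 = sideRep (varSide k) (.inr k) (lm (Sum.elim X Y k)) :=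
    fun k => by rw [hG]
  induction hN : w.length using Nat.strong_induction_on generalizing w with
  | _ N ih =>
  subst hN
  -- The last letter of the word is taken as the pivot.
  rcases List.eq_nil_or_concat w with rfl | ⟨u, k, rfl⟩
  · change φ 1 = vac 1
    rw [hφ, vac_apply, Module.End.one_apply, Finsupp.single_eq_same]
  have hprod : ((u.concat k).map G).prod = wordVal (G k) (u.map (varLetter G k)) * G k := by
    rw [wordVal_map_varLetter]
    simp
  have e1 := wordVal_map (AlgHom.fst ℂ A (Module.End ℂ (FreeProd
    fun _ : Unit ⊕ Fin n ⊕ Fin m => S₀))) (G k) (u.map (varLetter G k))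
  have e2 := wordVal_map (AlgHom.snd ℂ A (Module.End ℂ (FreeProd
    fun _ : Unit ⊕ Fin n ⊕ Fin m => S₀))) (G k) (u.map (varLetter G k))
  have e3 := apply_diff_eq (X := G k) (lengthFiltration G) (lengthFiltration_mono G)
    (one_mem_lengthFiltration G 0) φ.toLinearMap vac (u.map (varLetter G k)) u.length (by simp)
    (fun z hz => by
      induction hz using Submodule.span_induction with
      | mem z hz =>
        obtain ⟨w', hw', rfl⟩ := hz
        exact ih _ (by simpa [Nat.lt_succ_iff] using hw') w' rfl
      | zero => simp
      | add x y _ _ hx hy => rw [Prod.fst_add, Prod.snd_add, map_add, map_add, hx, hy]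
      | smul c x _ hx => rw [Prod.smul_fst, Prod.smul_snd, map_smul, map_smul, hx])
    (fun a ha N z hz => by
      obtain ⟨k', -, rfl⟩ := List.mem_map.1 ha
      rw [val_varLetter]
      exact mul_mem_lengthFiltration G k' hz)
  have h1 := hrel k ((u.map (varLetter G k)).map (Letter.map Prod.fst)) fun a ha => by
    simp only [List.map_map, List.mem_map, Function.comp_apply] at ha
    obtain ⟨k', -, rfl⟩ := ha
    refine mem_map_varLetter G Prod.fst (M := fun t => (varContext X Y Bl Br k t : Set A)) k'
      fun hk => ?_
    rw [hfst]
    exact mem_varContext X Y Bl Br hk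
  have h2 := vac_wordVal_mul_of_orthoSeq (S := fun _ : Unit ⊕ Fin n ⊕ Fin m => S₀)
    (k := .inr k) (T := lm (Sum.elim X Y k)) (v := v) (varSide k) (fun j => by
      rw [aeval_algHom_apply, aeval_algHom_apply, vac_sideRep, hlm, map_orthoSeq, aeval_X]
      exact (isSemicircular_iff hφ hv _).1
        (isSemicircular_of_apply_wordVal_mul hφ hv _ (hrel k)) j)
    ((u.map (varLetter G k)).map (Letter.map Prod.snd)) fun a ha => by
      simp only [List.map_map, List.mem_map, Function.comp_apply] at ha
      obtain ⟨k', -, rfl⟩ := ha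
      refine mem_map_varLetter G Prod.snd
        (M := fun t => (otherOps (fun _ : Unit ⊕ Fin n ⊕ Fin m => S₀) t (.inr k) : Set _)) k'
        fun hk => ?_
      rw [hsnd]
      exact Algebra.subset_adjoin ⟨.inr k', fun e => hk (Sum.inr_injective e), _, rfl⟩
  rw [← hfst] at h1
  rw [← hsnd] at h2
  rw [hprod, Prod.fst_mul, Prod.snd_mul]
  have e1' : (wordVal (G k) (u.map (varLetter G k))).1 =
      wordVal (G k).1 ((u.map (varLetter G k)).map (Letter.map Prod.fst)) := e1.symm
  have e2' : (wordVal (G k) (u.map (varLetter G k))).2 =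
      wordVal (G k).2 ((u.map (varLetter G k)).map (Letter.map Prod.snd)) := e2.symm
  rw [e1', e2', h1, h2, ← e3]
  rfl

/-- If the relation of a semicircular system holds, the algebra itself, with the state as vacuum
functional, is a model in which each variable acts by left multiplication. -/
theorem isBiFree_of_apply_wordVal_mul {φ : A →ₚ[ℂ] ℂ} (hφ : φ 1 = 1) {X : Fin n → A}
    {Y : Fin m → A} (hXY : ∀ k, IsSelfAdjoint (Sum.elim X Y k)) {v : ℝ} (hv : 0 < v)
    (hrel : ∀ k, ∀ w : List (Letter A), (∀ a ∈ w, a.Mem (varContext X Y ⊥ ⊥ k (varSide k))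
      (varContext X Y ⊥ ⊥ k (varSide k).other)) →
      φ (wordVal (Sum.elim X Y k) w * Sum.elim X Y k) = v * φ (diff φ (Sum.elim X Y k) w)) :
    IsBiFree φ (leftFaces (m := m) X ⊥) (rightFaces (n := n) Y ⊥) := by
  obtain ⟨S₀, e, he, heφ⟩ := exists_pointed_equiv φ hφ
  let lm : A →ₐ[ℂ] Module.End ℂ (Pointed S₀) :=
    (e.conjAlgEquiv ℂ : Module.End ℂ A →ₐ[ℂ] Module.End ℂ (Pointed S₀)).comp (Algebra.lmul ℂ A)
  have hlm : ∀ a, lm a (Finsupp.single none 1) none = φ a := by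
    intro a
    change e (a * e.symm (Finsupp.single none 1)) none = φ a
    rw [← he, e.symm_apply_apply, mul_one, heφ]
  let S : Unit ⊕ Fin n ⊕ Fin m → Type u := fun _ => S₀
  let G : Fin n ⊕ Fin m → A × Module.End ℂ (FreeProd S) := fun k =>
    (Sum.elim X Y k, sideRep (S := S) (varSide k) (.inr k) (lm (Sum.elim X Y k)))
  let P : Subalgebra ℂ (A × Module.End ℂ (FreeProd S)) := Algebra.adjoin ℂ (Set.range G)
  have hP : ∀ z ∈ P, φ z.1 = vac z.2 := fun z hz =>
    apply_eq_of_mem_adjoin φ.toLinearMap vac G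
      (apply_prod_eq_vac hφ hv hrel lm hlm fun _ => rfl) hz
  have hface : ∀ t i, ∀ b ∈ sideFaces X Y ⊥ ⊥ t i,
      ((b, sideRep (S := S) t i (lm b)) : A × Module.End ℂ (FreeProd S)) ∈ P := by
    intro t i
    let C : Subalgebra ℂ A := P.comap ((AlgHom.id ℂ A).prod ((sideRep (S := S) t i).comp lm))
    have hbot : ∀ b ∈ (⊥ : StarSubalgebra ℂ A), b ∈ C := by
      intro b hb
      obtain ⟨c, rfl⟩ := StarSubalgebra.mem_bot.1 hb
      exact C.algebraMap_mem c
    have hvar : ∀ k : Fin n ⊕ Fin m, varSide k = t → i = .inr k →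
        ∀ b ∈ StarAlgebra.adjoin ℂ {Sum.elim X Y k}, b ∈ C := by
      rintro k rfl rfl b hb
      refine mem_of_mem_starAdjoin ?_ ?_ hb
      · rintro _ rfl
        exact (hXY k).star_eq
      · rintro _ rfl
        exact Algebra.subset_adjoin ⟨k, rfl⟩
    rcases t with - | - <;> rcases i with i | i | i
    · exact hbot
    · exact hvar (.inl i) rfl rfl
    · exact hbot
    · exact hbot
    · exact hbot
    · exact hvar (.inr i) rfl rfl
  refine ⟨S, fun i => lm.comp (leftFaces (m := m) X ⊥ i).subtype.toAlgHom,
    fun i => lm.comp (rightFaces (n := n) Y ⊥ i).subtype.toAlgHom, fun w => ?_⟩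
  set l : ∀ i, leftFaces (m := m) X ⊥ i →ₐ[ℂ] Module.End ℂ (Pointed (S i)) :=
    fun i => lm.comp (leftFaces (m := m) X ⊥ i).subtype.toAlgHom with hl
  set r : ∀ i, rightFaces (n := n) Y ⊥ i →ₐ[ℂ] Module.End ℂ (Pointed (S i)) :=
    fun i => lm.comp (rightFaces (n := n) Y ⊥ i).subtype.toAlgHom with hr
  suffices H : (((w.map letterVal).prod, (w.map (letterRep l r)).prod) :
      A × Module.End ℂ (FreeProd S)) ∈ P from hP _ H
  induction w with
  | nil => exact P.one_mem
  | cons a w ih =>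
    have ha : ((letterVal a, letterRep l r a) : A × Module.End ℂ (FreeProd S)) ∈ P := by
      rcases a with ⟨i, a | a⟩
      · exact hface .left i a a.2
      · exact hface .right i a a.2
    have := P.mul_mem ha ih
    rwa [Prod.mk_mul_mk] at this

variable [StarOrderedRing A]

theorem isBiFreeSemicircularSystem_of_cramerRaoProduct_eq {φ : A →ₚ[ℂ] ℂ} (hφ : φ 1 = 1)
    {X : Fin n → A} {Y : Fin m → A} (hXY : ∀ k, IsSelfAdjoint (Sum.elim X Y k))
    (h : cramerRaoProduct φ X Y ⊥ ⊥ = ((n : ℝ≥0∞) + m) ^ 2) :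
    IsBiFreeSemicircularSystem φ X Y ⊥ ⊥ := by
  obtain ⟨ζ, hζ⟩ : ∃ ζ, IsConjugateSystem φ X Y ⊥ ⊥ ζ := by
    refine exists_isConjugateSystem ?_
    rw [h, ← ofReal_card_sq]
    exact ENNReal.ofReal_ne_top
  rw [cramerRaoProduct_eq hφ hXY hζ, ← ofReal_card_sq,
    ENNReal.ofReal_eq_ofReal_iff (by positivity) (by positivity)] at h
  obtain ⟨v, hv, hζv⟩ := exists_eq_smul_of_card_sq_eq (hζ.inner_eq_one hφ hXY) h
  have hrel : ∀ k, ∀ w : List (Letter A), (∀ a ∈ w, a.Mem (varContext X Y ⊥ ⊥ k (varSide k))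
      (varContext X Y ⊥ ⊥ k (varSide k).other)) →
      φ (wordVal (Sum.elim X Y k) w * Sum.elim X Y k) = v * φ (diff φ (Sum.elim X Y k) w) := by
    intro k w hw
    rw [← (hζ k).conjugateRelation hφ w hw, hζv, ← toL2_smul, vectorMoment_toL2, mul_smul_comm,
      map_smul, smul_eq_mul, Complex.ofReal_inv, mul_inv_cancel_left₀]
    exact Complex.ofReal_ne_zero.2 hv.ne'
  have hsc := fun k => isSemicircular_of_apply_wordVal_mul hφ hv _ (hrel k)
  exact ⟨⟨v, hv, fun i => hsc (.inl i), fun j => hsc (.inr j)⟩,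
    isBiFree_of_apply_wordVal_mul hφ hXY hv hrel⟩

end Equality

end

end BiFree

theorem mainTheorem5 {A : Type*} [CStarAlgebra A] [PartialOrder A] [StarOrderedRing A]
    (φ : A →ₚ[ℂ] ℂ) (hφ : φ 1 = 1) {n m : ℕ} (X : Fin n → A) (Y : Fin m → A)
    (hX : ∀ i, IsSelfAdjoint (X i)) (hY : ∀ j, IsSelfAdjoint (Y j))
    (Bl Br : StarSubalgebra ℂ A) :
    ((n : ℝ≥0∞) + (m : ℝ≥0∞)) ^ 2 ≤ BiFree.cramerRaoProduct φ X Y Bl Br ∧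
    (BiFree.IsBiFreeSemicircularSystem φ X Y Bl Br →
      BiFree.cramerRaoProduct φ X Y Bl Br = ((n : ℝ≥0∞) + (m : ℝ≥0∞)) ^ 2) ∧
    (Bl = ⊥ → Br = ⊥ →
      BiFree.cramerRaoProduct φ X Y Bl Br = ((n : ℝ≥0∞) + (m : ℝ≥0∞)) ^ 2 →
      BiFree.IsBiFreeSemicircularSystem φ X Y Bl Br) := by
  have hXY : ∀ k, IsSelfAdjoint (Sum.elim X Y k) := by
    rintro (i | j)
    · exact hX i
    · exact hY j
  refine ⟨BiFree.sq_le_cramerRaoProduct hφ hXY, BiFree.cramerRaoProduct_of_isBiFree hφ hXY, ?_⟩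
  rintro rfl rfl h
  exact BiFree.isBiFreeSemicircularSystem_of_cramerRaoProduct_eq hφ hXY h
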